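/- **Setting.** A tied link is a link in $S^3$ together with a partition of its set of components; in a diagram (on $S^2$) the partition is recorded by ties, each tie connecting two points of the link, and it is the partition generated by the ties. Ties are not topological objects: only the partition matters. All diagrams have at least one component. Let $A$ and $c$ be commuting independent variables. The *bracket polynomial* $\langle\langle\ \rangle\rangle$ for tied links is the function from unoriented tied link diagrams to $\mathbb Z[A^{\pm1},c]$ defined by the following rules: 1. $\langle\langle \bigcirc\rangle\rangle=1$; 2. $\langle\langle \bigcirc\sqcup D\rangle\rangle=c\,\langle\langle D\rangle\rangle$; 3. $\langle\langle \bigcirc\,\widetilde\sqcup\, D\rangle\rangle=-(A^2+A^{-2})\langle\langle D\rangle\rangle$, where $\widetilde\sqcup$ is disjoint union with a tie added between the circle and $D$; 4. $\langle\langle\ \rangle\rangle$ is invariant under isotopy of diagrams on $S^2$, under Reidemeister moves II and III, and under changes of the ties that preserve the partition of the components; 5. if the two strands at a crossing of $D$ are tied together next to the crossing, then $\langle\langle D\rangle\rangle=A\langle\langle D_e\rangle\rangle+A^{-1}\langle\langle D_f\rangle\rangle$, where $D_e$ and $D_f$ are the $A$-smoothing and the $B$-smoothing of Kauffman's bracket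 at this crossing, with the tie kept, so that it connects the two arcs of the smoothing; 6. if $D_+,D_-,D_e,D_f$ are identical except in a disc, where they are a crossing, the opposite crossing and the two smoothings, a tie connecting the two arcs being added in $D_e$ and in $D_f$, then $\langle\langle D_+\rangle\rangle+\langle\langle D_-\rangle\rangle=(A+A^{-1})\bigl(\langle\langle D_e\rangle\rangle+\langle\langle D_f\rangle\rangle\bigr)$. For an oriented tied link diagram $\overrightarrow D$ with writhe $w(D)$ and underlying unoriented diagram $D$ put $$\mathcal J(\overrightarrow D)=(-A)^{-3w(D)}\langle\langle D\rangle\rangle .$$ For an oriented classical link diagram $K$ let $$V_K(t)=\Bigl((-A)^{-3w(K)}\sum_{S} A^{a(S)-b(S)}\,(-A^2-A^{-2})^{|S|-1}\Bigr)_{A=t^{-1/4}}$$ be its one-variable Jones polynomial (Kauffman's state model: $S$ runs over the states of $K$, with $a(S)$ $A$-smoothings, $b(S)$ $B$-smoothings and $|S|$ circles). **Statement.** A function $\langle\langle\ \rangle\rangle$ satisfying rules 1–6 exists. The polynomial $V$ is the Jones polynomial: it is invariant under all Reidemeister moves and planar isotopy, is $1$ on the unknot diagram without crossings, and satisfies $t^{-1}V_{K_+}-tV_{K_-}=(t^{1/2}-t^{-1/2})V_{K_0}$.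 Every oriented classical link diagram arises by forgetting the ties of a tied link diagram whose components are all tied together. For every function $\langle\langle\ \rangle\rangle$ satisfying rules 1–6 and every oriented tied link diagram $\overrightarrow D$ whose components are all tied together, with $\overrightarrow D^{\nsim}$ the classical diagram obtained by forgetting the ties, the substitution $A=t^{-1/4}$ turns $\mathcal J(\overrightarrow D)$ into $V_{\overrightarrow D^{\nsim}}(t)$; in particular the variable $c$ does not occur. Thus $\mathcal J$ generalizes the Jones polynomial to tied links. -/

import Mathlib

namespace TiedLink

/-! ### Sliced diagrams

A link diagram is put in general position with respect to the height function and cut into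
horizontal slices, read from bottom to top. Strands at a given height are numbered `0, 1, 2, …`
from left to right. The type `δ` records directions of strands: `Unit` for unoriented diagrams,
`Bool` for oriented ones (`true` is upwards). -/

class Direction (δ : Type) where
  decEq : DecidableEq δ
  opp : δ → δ

attribute [reducible, instance] Direction.decEq

instance : Direction Unit where
  decEq := inferInstance
  opp := id

instance : Direction Bool where
  decEq := inferInstance
  opp := not

/-- `cup d`: a local minimum, creating two adjacent strands, the left one with direction `d`.
`cap`: a local maximum, joining two adjacent strands.
`cross o`: a crossing of two adjacent strands; the strand that runs from bottom left to top right
is the overstrand if `o = true` and the understrand if `o = false`. -/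
inductive Piece (δ : Type) where
  | cup (d : δ)
  | cap
  | cross (o : Bool)

/-- `piece e i`: the piece `e`, whose leftmost strand has number `i`, beside vertical strands.
`tieEnd i k`: vertical strands only; an end of the tie with name `k` is attached to strand `i`.
Ties are not topological objects: a tie is given by the points of the link at which its ends
are attached, and strands that carry ends with the same name are connected by ties. -/
inductive Slice (δ : Type) where
  | piece (e : Piece δ) (i : ℕ)
  | tieEnd (i k : ℕ)

open Piece Slice Direction

/-- Number of strands that enter a piece from below. -/
def Piece.ins {δ : Type} : Piece δ → ℕ
  | .cup _ => 0
  | .cap => 2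
  | .cross _ => 2

/-- Number of strands that leave a piece at the top. -/
def Piece.outs {δ : Type} : Piece δ → ℕ
  | .cup _ => 2
  | .cap => 0
  | .cross _ => 2

/-- The directions of the strands above a slice, from those below it;
`none` if the slice does not fit on the strands below it. -/
def Slice.step {δ : Type} [Direction δ] (s : List δ) : Slice δ → Option (List δ)
  | .piece (.cup d) i =>
      if i ≤ s.length then some (s.take i ++ d :: opp d :: s.drop i) else none
  | .piece .cap i =>
      match s.drop i with
      | a :: b :: r => if b = opp a then some (s.take i ++ r) else none
      | _ => none
  | .piece (.cross _) i =>
      match s.drop i with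
      | a :: b :: r => some (s.take i ++ b :: a :: r)
      | _ => none
  | .tieEnd i _ => if i < s.length then some s else none

/-- The directions of the strands above a word of slices. -/
def run {δ : Type} [Direction δ] : List (Slice δ) → List δ → Option (List δ)
  | [], s => some s
  | l :: w, s => (l.step s).bind (run w)

/-- A tied link diagram (with at least one component). -/
structure TiedDiagram (δ : Type) [Direction δ] where
  word : List (Slice δ)
  nonempty : word ≠ []
  closed : run word [] = some []

def Slice.IsTieEnd {δ : Type} : Slice δ → Prop
  | .piece _ _ => False
  | .tieEnd _ _ => True

instance {δ : Type} (l : Slice δ) : Decidable l.IsTieEnd :=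
  match l with
  | .piece _ _ => isFalse id
  | .tieEnd _ _ => isTrue trivial

/-- A classical link diagram: a diagram without ties. -/
structure LinkDiagram (δ : Type) [Direction δ] extends TiedDiagram δ where
  tieFree : ∀ l ∈ word, ¬ l.IsTieEnd

/-! ### Forgetting ties and orientations -/

theorem run_filter {δ : Type} [Direction δ] (w : List (Slice δ)) (s s' : List δ)
    (h : run w s = some s') : run (w.filter fun l => ¬ l.IsTieEnd) s = some s' := by
  induction w generalizing s with
  | nil => exact h
  | cons l w ih =>
    cases l with
    | piece e i =>
      simp only [run, Option.bind_eq_some_iff] at h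
      obtain ⟨u, hu, hw⟩ := h
      simp only [List.filter, Slice.IsTieEnd, not_false_eq_true, decide_true, run,
        Option.bind_eq_some_iff]
      exact ⟨u, hu, ih u hw⟩
    | tieEnd i k =>
      simp only [run, Slice.step, Option.bind_eq_some_iff] at h
      obtain ⟨u, hu, hw⟩ := h
      split_ifs at hu
      cases hu
      simpa [List.filter, Slice.IsTieEnd] using ih _ hw

/-- The classical link diagram obtained by erasing all ties. -/
def TiedDiagram.forgetTies {δ : Type} [Direction δ] (D : TiedDiagram δ) : LinkDiagram δ where
  word := D.word.filter fun l => ¬ l.IsTieEnd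
  nonempty := by
    obtain ⟨w, h0, hc⟩ := D
    cases w with
    | nil => exact absurd rfl h0
    | cons l w =>
      cases l with
      | piece e i => simp [Slice.IsTieEnd]
      | tieEnd i k => simp [run, Slice.step] at hc
  closed := run_filter _ _ _ D.closed
  tieFree := by
    intro l hl
    simpa using (List.mem_filter.mp hl).2

def Slice.unorient {δ : Type} : Slice δ → Slice Unit
  | .piece (.cup _) i => .piece (.cup ()) i
  | .piece .cap i => .piece .cap i
  | .piece (.cross o) i => .piece (.cross o) i
  | .tieEnd i k => .tieEnd i k

theorem step_unorient {δ : Type} [Direction δ] (l : Slice δ) (s s' : List δ)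
    (h : l.step s = some s') :
    l.unorient.step (s.map fun _ => ()) = some (s'.map fun _ => ()) := by
  rcases l with ⟨e | _ | o, i⟩ | ⟨i, k⟩
  · simp only [Slice.step] at h
    split_ifs at h with hi
    cases h
    simp [Slice.unorient, Slice.step, hi]
  · simp only [Slice.step] at h
    split at h
    · rename_i a b r hd
      split_ifs at h
      cases h
      have hd' : (s.map fun _ => ()).drop i = () :: () :: r.map fun _ => () := by
        rw [← List.map_drop, hd]; rfl
      simp only [Slice.unorient, Slice.step, hd']
      simp
    · cases h
  · simp only [Slice.step] at h
    split at h
    · rename_i a b r hd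
      cases h
      have hd' : (s.map fun _ => ()).drop i = () :: () :: r.map fun _ => () := by
        rw [← List.map_drop, hd]; rfl
      simp only [Slice.unorient, Slice.step, hd']
      simp
    · cases h
  · simp only [Slice.step] at h
    split_ifs at h with hi
    cases h
    simp [Slice.unorient, Slice.step, hi]

theorem run_unorient {δ : Type} [Direction δ] (w : List (Slice δ)) (s s' : List δ)
    (h : run w s = some s') :
    run (w.map Slice.unorient) (s.map fun _ => ()) = some (s'.map fun _ => ()) := by
  induction w generalizing s with
  | nil => cases h; rfl
  | cons l w ih =>
    simp only [run, Option.bind_eq_some_iff] at h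
    obtain ⟨u, hu, hw⟩ := h
    simp only [List.map_cons, run, step_unorient l s u hu, Option.bind_some]
    exact ih u hw

/-- The unoriented diagram underlying an oriented one. -/
def TiedDiagram.unorient {δ : Type} [Direction δ] (D : TiedDiagram δ) : TiedDiagram Unit where
  word := D.word.map Slice.unorient
  nonempty := by simpa using D.nonempty
  closed := by simpa using run_unorient _ _ _ D.closed

/-! ### Components and ties

The point `(k, p)` is the point of strand `p` at the height between the first `k` slices and the
remaining ones. -/

def IsPoint {δ : Type} [Direction δ] (w : List (Slice δ)) (x : ℕ × ℕ) : Prop :=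
  ∃ s, run (w.take x.1) [] = some s ∧ x.2 < s.length

/-- In the given slice a strand leads from bottom position `p` to top position `q`. -/
def Slice.Through {δ : Type} : Slice δ → ℕ → ℕ → Prop
  | .piece (.cup _) i, p, q => q = if p < i then p else p + 2
  | .piece .cap i, p, q => p = if q < i then q else q + 2
  | .piece (.cross _) i, p, q => q = Equiv.swap i (i + 1) p
  | .tieEnd _ _, p, q => q = p

/-- Two points that are joined by an arc of the diagram inside one slice. -/
inductive Joined {δ : Type} (w : List (Slice δ)) : ℕ × ℕ → ℕ × ℕ → Prop
  | through (k p q : ℕ) (l : Slice δ) (hl : w[k]? = some l) (h : l.Through p q) :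
      Joined w (k, p) (k + 1, q)
  | cup (k i : ℕ) (d : δ) (hl : w[k]? = some (piece (cup d) i)) :
      Joined w (k + 1, i) (k + 1, i + 1)
  | cap (k i : ℕ) (hl : w[k]? = some (piece cap i)) :
      Joined w (k, i) (k, i + 1)

/-- The point `x` carries an end of the tie with name `k`. -/
def HasTieEnd {δ : Type} (w : List (Slice δ)) (x : ℕ × ℕ) (k : ℕ) : Prop :=
  w[x.1]? = some (tieEnd x.2 k)

/-- The name `k` occurs among the ties. -/
def TieOccurs {δ : Type} (w : List (Slice δ)) (k : ℕ) : Prop :=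
  ∃ i, tieEnd i k ∈ w

/-- The components of `x` and `y` belong to the same class of the partition that is generated by
the ties. -/
def TiedTogether {δ : Type} (w : List (Slice δ)) : ℕ × ℕ → ℕ × ℕ → Prop :=
  Relation.EqvGen fun x y => Joined w x y ∨ ∃ k, HasTieEnd w x k ∧ HasTieEnd w y k

/-- All components are tied together. -/
def TiedDiagram.AllTied {δ : Type} [Direction δ] (D : TiedDiagram δ) : Prop :=
  ∀ x y, IsPoint D.word x → IsPoint D.word y → TiedTogether D.word x y

/-- The number of components. -/
noncomputable def componentCount {δ : Type} [Direction δ] (w : List (Slice δ)) : ℕ :=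
  Nat.card (Quot fun x y : {x // IsPoint w x} => Joined w x.1 y.1)

/-! ### Isotopy -/

/-- Local planar isotopies of sliced diagrams: two pieces side by side exchange their heights, a
minimum and a neighbouring maximum cancel, a crossing is rotated. Both words of slices are
replaced by each other inside a diagram. -/
inductive PlanarMove {δ : Type} : List (Slice δ) → List (Slice δ) → Prop
  | exchange (e f : Piece δ) (i m : ℕ) :
      PlanarMove [piece e i, piece f (i + e.outs + m)] [piece f (i + e.ins + m), piece e i]
  | zigzag (d : δ) (i : ℕ) : PlanarMove [piece (cup d) (i + 1), piece cap i] []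
  | zagzig (d : δ) (i : ℕ) : PlanarMove [piece (cup d) i, piece cap (i + 1)] []
  | slideCup (d : δ) (o : Bool) (i : ℕ) :
      PlanarMove [piece (cup d) i, piece (cross o) (i + 1)]
        [piece (cup d) (i + 1), piece (cross (!o)) i]
  | slideCap (o : Bool) (i : ℕ) :
      PlanarMove [piece (cross o) (i + 1), piece cap i]
        [piece (cross (!o)) i, piece cap (i + 1)]

inductive ReidemeisterI {δ : Type} : List (Slice δ) → List (Slice δ) → Prop
  | right (d : δ) (o : Bool) (i : ℕ) :
      ReidemeisterI [piece (cup d) (i + 1), piece (cross o) i, piece cap (i + 1)] []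
  | left (d : δ) (o : Bool) (i : ℕ) :
      ReidemeisterI [piece (cup d) i, piece (cross o) (i + 1), piece cap i] []

inductive ReidemeisterII {δ : Type} : List (Slice δ) → List (Slice δ) → Prop
  | mk (o : Bool) (i : ℕ) : ReidemeisterII [piece (cross o) i, piece (cross (!o)) i] []

/-- The hypothesis says that among the three strands there is a top one and a bottom one. -/
inductive ReidemeisterIII {δ : Type} : List (Slice δ) → List (Slice δ) → Prop
  | mk (a b c : Bool) (i : ℕ) (h : a = b ∨ c = b) :
      ReidemeisterIII [piece (cross a) i, piece (cross b) (i + 1), piece (cross c) i]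
        [piece (cross c) (i + 1), piece (cross b) i, piece (cross a) (i + 1)]

def Slice.shift {δ : Type} : Slice δ → Slice δ
  | .piece e i => .piece e (i + 1)
  | .tieEnd i k => .tieEnd (i + 1) k

/-- Elementary regular isotopies of diagrams in the sphere: planar isotopy, Reidemeister moves II
and III, and moving an outermost arc through the point at infinity (a one-strand tangle `T` is
closed up on its left or on its right). -/
inductive RegularMove {δ : Type} [Direction δ] : List (Slice δ) → List (Slice δ) → Prop
  | planar (u v m m' : List (Slice δ)) (h : PlanarMove m m') :
      RegularMove (u ++ m ++ v) (u ++ m' ++ v)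
  | two (u v m m' : List (Slice δ)) (h : ReidemeisterII m m') :
      RegularMove (u ++ m ++ v) (u ++ m' ++ v)
  | three (u v m m' : List (Slice δ)) (h : ReidemeisterIII m m') :
      RegularMove (u ++ m ++ v) (u ++ m' ++ v)
  | infinity (T : List (Slice δ)) (d : δ) (h : run T [opp d] = some [opp d]) :
      RegularMove (piece (cup d) 0 :: (T.map Slice.shift ++ [piece cap 0]))
        (piece (cup (opp d)) 0 :: (T ++ [piece cap 0]))

/-- Elementary ambient isotopies: regular isotopies and Reidemeister move I. -/
inductive AmbientMove {δ : Type} [Direction δ] : List (Slice δ) → List (Slice δ) → Prop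
  | regular (w w' : List (Slice δ)) (h : RegularMove w w') : AmbientMove w w'
  | one (u v m m' : List (Slice δ)) (h : ReidemeisterI m m') :
      AmbientMove (u ++ m ++ v) (u ++ m' ++ v)

/-- Creating (and, read backwards, destroying) a tie end in a way that does not change the
partition of the components: the strand to which the new end of tie `k` is attached is already
tied together with every point at which an end of tie `k` is attached. These moves connect any two
systems of ties on a link diagram that define the same partition. -/
inductive TieMove {δ : Type} : List (Slice δ) → List (Slice δ) → Prop
  | mk (u v : List (Slice δ)) (i k : ℕ)
      (h : ∀ y, HasTieEnd (u ++ v) y k → TiedTogether (u ++ v) (u.length, i) y) :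
      TieMove (u ++ v) (u ++ tieEnd i k :: v)

/-! ### The bracket polynomial for tied links -/

/-- `ℤ[A, A⁻¹]` -/
abbrev RingA := LaurentPolynomial ℤ

/-- `ℤ[A, A⁻¹, c]` -/
abbrev RingAc := Polynomial RingA

noncomputable def A (n : ℤ) : RingA := LaurentPolynomial.T n

/-- `1` or `-1`, according to the type of the crossing `cross o` -/
def eps (o : Bool) : ℤ := if o then 1 else -1

/-- The defining rules of the bracket polynomial for unoriented tied link diagrams. -/
structure IsTiedBracket (br : TiedDiagram Unit → RingAc) : Prop where
  circle : ∀ D : TiedDiagram Unit, D.word = [piece (cup ()) 0, piece cap 0] → br D = 1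
  /-- disjoint union with a crossingless circle -/
  union : ∀ (D D' : TiedDiagram Unit) (u v : List (Slice Unit)) (i : ℕ),
    D.word = u ++ v → D'.word = u ++ [piece (cup ()) i, piece cap i] ++ v →
    br D' = Polynomial.X * br D
  /-- disjoint union with a crossingless circle and a tie between the circle and the diagram -/
  tiedUnion : ∀ (D D' : TiedDiagram Unit) (u v : List (Slice Unit)) (i k : ℕ),
    D.word = u ++ v → TieOccurs D.word k →
    D'.word = u ++ [piece (cup ()) i, tieEnd i k, piece cap i] ++ v →
    br D' = Polynomial.C (-(A 2 + A (-2))) * br D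
  regular : ∀ D D' : TiedDiagram Unit, RegularMove D.word D'.word → br D = br D'
  ties : ∀ D D' : TiedDiagram Unit, TieMove D.word D'.word → br D = br D'
  /-- skein rule for a crossing whose strands are tied together (next to the crossing) -/
  tiedCrossing : ∀ (D De Df : TiedDiagram Unit) (u v : List (Slice Unit)) (o : Bool) (i k : ℕ),
    D.word = u ++ [tieEnd i k, tieEnd (i + 1) k, piece (cross o) i] ++ v →
    De.word = u ++ [tieEnd i k, tieEnd (i + 1) k] ++ v →
    Df.word = u ++ [tieEnd i k, tieEnd (i + 1) k,
      piece cap i, piece (cup ()) i, tieEnd i k] ++ v →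
    br D = Polynomial.C (A (eps o)) * br De + Polynomial.C (A (-eps o)) * br Df
  /-- skein rule for an arbitrary crossing; in both smoothings the two arcs are connected by a new
  tie -/
  crossing : ∀ (Dp Dm De Df : TiedDiagram Unit) (u v : List (Slice Unit)) (i k : ℕ),
    ¬ TieOccurs (u ++ v) k →
    Dp.word = u ++ [piece (cross true) i] ++ v →
    Dm.word = u ++ [piece (cross false) i] ++ v →
    De.word = u ++ [tieEnd i k, tieEnd (i + 1) k] ++ v →
    Df.word = u ++ [tieEnd i k, piece cap i, piece (cup ()) i, tieEnd i k] ++ v →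
    br Dp + br Dm = Polynomial.C (A 1 + A (-1)) * (br De + br Df)

/-- Sum of the signs of the crossings in an oriented word of slices above strands with directions
`s`. The crossing `cross true` of two parallel strands is positive. -/
def writheFrom : List Bool → List (Slice Bool) → ℤ
  | _, [] => 0
  | s, l :: w =>
    (match l with
      | .piece (.cross o) i => if s[i]? = s[i + 1]? then eps o else -eps o
      | _ => 0) + writheFrom ((l.step s).getD []) w

def TiedDiagram.writhe (D : TiedDiagram Bool) : ℤ := writheFrom [] D.word

/-- The unit `-A`. -/
noncomputable def negA : RingAˣ where
  val := -A 1
  inv := -A (-1)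
  val_inv := by
    rw [neg_mul_neg, A, A, ← LaurentPolynomial.T_add]; simp
  inv_val := by
    rw [neg_mul_neg, A, A, ← LaurentPolynomial.T_add]; simp

/-- `(-A)^{-3 w(D)} ⟨⟨D⟩⟩` for an oriented tied link diagram `D`, where `br` is `⟨⟨ ⟩⟩`. -/
noncomputable def tiedJ (br : TiedDiagram Unit → RingAc) (D : TiedDiagram Bool) : RingAc :=
  Polynomial.C ((negA ^ (-3 * D.writhe) : RingAˣ) : RingA) * br D.unorient

/-! ### The Jones polynomial -/

/-- `ℤ[t^q : q ∈ ℚ]`; it contains `ℤ[t^{1/2}, t^{-1/2}]` and `ℤ[t^{1/4}, t^{-1/4}]`. -/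
abbrev RingT := AddMonoidAlgebra ℤ ℚ

/-- `t ^ q` -/
noncomputable def t (q : ℚ) : RingT := AddMonoidAlgebra.single q 1

/-- The substitution `A = t^{-1/4}`. -/
noncomputable def substA : RingA →+* RingT :=
  AddMonoidAlgebra.mapDomainRingHom ℤ
    ((AddMonoidHom.mulLeft (-1 / 4 : ℚ)).comp (Int.castAddHom ℚ))

/-- All states of an unoriented diagram (every crossing is smoothed in one of the two ways), each
with the exponent of `A` that it contributes. Ties are ignored. -/
def states : List (Slice Unit) → List (ℤ × List (Slice Unit))
  | [] => [(0, [])]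
  | .piece (.cross o) i :: w =>
      (states w).map (fun x => (x.1 + eps o, x.2)) ++
      (states w).map (fun x => (x.1 - eps o, piece cap i :: piece (cup ()) i :: x.2))
  | .tieEnd _ _ :: w => states w
  | .piece e i :: w => (states w).map fun x => (x.1, piece e i :: x.2)

/-- The Kauffman bracket of a classical diagram, as a sum over all states. -/
noncomputable def kauffmanBracket (w : List (Slice Unit)) : RingA :=
  ((states w).map fun x => A x.1 * (-(A 2 + A (-2))) ^ (componentCount x.2 - 1)).sum

/-- The one-variable Jones polynomial of an oriented classical link diagram, by Kauffman's state
model. -/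
noncomputable def jonesPolynomial (K : LinkDiagram Bool) : RingT :=
  substA (((negA ^ (-3 * K.writhe) : RingAˣ) : RingA) * kauffmanBracket K.unorient.word)

/-- The characterization of the Jones polynomial: an ambient isotopy invariant of oriented links
with value `1` on the unknot and with
`t⁻¹ V(K₊) - t V(K₋) = (t^{1/2} - t^{-1/2}) V(K₀)`. (By planar isotopy a crossing can be rotated
until its strands are parallel with respect to the height.) -/
structure IsJonesPolynomial (V : LinkDiagram Bool → RingT) : Prop where
  unknot : ∀ (K : LinkDiagram Bool) (d : Bool),
    K.word = [piece (cup d) 0, piece cap 0] → V K = 1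
  invariant : ∀ K K' : LinkDiagram Bool, AmbientMove K.word K'.word → V K = V K'
  skein : ∀ (Kp Km K0 : LinkDiagram Bool) (u v : List (Slice Bool)) (s : List Bool) (i : ℕ),
    run u [] = some s → s[i]? = s[i + 1]? →
    Kp.word = u ++ [piece (cross true) i] ++ v →
    Km.word = u ++ [piece (cross false) i] ++ v →
    K0.word = u ++ v →
    t (-1) * V Kp - t 1 * V Km = (t (1 / 2) - t (-1 / 2)) * V K0

end TiedLink

set_option linter.unusedSectionVars false
set_option linter.unusedSimpArgs false

/-! ### Transfer operators of a coloured vertex model and their local identities. -/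

namespace TiedLink
open Piece Slice Direction

/-! ### Transfer operators -/

/-! Existence comes from a vertex model. Strands carry labels (colour, spin), with N+1 linearly
ordered colours and M+1 spins. For A one substitutes a number `loopRoot M` at which the loop value
-A²-A⁻² is M+1. Where two strands of equal colour cross, Kauffman's smoothing rule acts on the
spins; strands of different colours pass through each other with a sign, which is opposite for the
two crossings. All ends of a tie lie on strands of one colour, and the sum runs over the colours of
the ties. Regular isotopies become identities of operators: within one colour they are Kauffman's
computation, and otherwise signs only have to match. Rule 5 is the equal-colour case. In rule 6 the
terms with different colours cancel, and the colour of the new tie is the common colour of the two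
strands. An untied circle contributes (N+1)(M+1), a tied one M+1, so that c becomes (N+1)(M+1).

These numbers must come from one element of ℤ[A^{±1},c], which is the main point
(`exists_polynomial_stateSum`). Every crossing is split into its two smoothings, restricted to equal
colours, and a crossing restricted to different colours. In a single term the spins contribute
(M+1)^e, where e is the number of components of the term. The weight of the colours is invariant
under recolouring, because the resulting signs telescope along the height and the diagram is closed
(`colourWeight_recolour`). A pattern with k different colours is therefore counted (N+1)N⋯(N+2-k)
times. Since k ≤ e, the product of this number and (M+1)^e is (M+1)^(e-k) times the product of
c-j(M+1) over j < k, a polynomial in c and the loop value (`exists_polynomial_of_prefix`). Splitting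
off one factor c normalizes the circle to 1. The points (`loopRoot M`, (N+1)(M+1)) determine a
polynomial (`evalAc_ext`), so the rules may be checked at these points.

With a single colour the model evaluates Kauffman's state sum (`evalA_kauffmanBracket`). The same
operator identities thus prove the rules of the Kauffman bracket, and together with the behaviour of
the writhe they give the properties of the Jones polynomial.

Now let an arbitrary function satisfy the rules. On a diagram whose components are all tied together
further tie ends may be attached anywhere, so the value depends only on the underlying classical
diagram (`wordValue_eq_of_strip`), and rule 5 applies at every crossing. Diagrams without crossings
are reduced to the circle by planar isotopy and rules 1 and 3 (`wordValue_arcs`). Rules 2 and 6 are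
never needed, so c does not occur and the value is the Kauffman bracket
(`IsTiedBracket.eq_kauffmanBracket`). A classical diagram becomes tied together when one tie is
attached to all its minima (`tieUp`). -/

/-- Operators on functions of the list of labels of the strands at some height. -/
abbrev Op (K : Type) := Module.End ℂ (List K → ℂ)

/-- The operator that acts on all strands but the leftmost one. -/
def shiftOp {K : Type} (L : Op K) : Op K where
  toFun φ s := match s with
    | [] => 0
    | x :: s => L (fun r => φ (x :: r)) s
  map_add' φ ψ := by
    funext s
    cases s with
    | nil => simp
    | cons x s => exact congrFun (L.map_add (fun r => φ (x :: r)) fun r => ψ (x :: r)) s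
  map_smul' c φ := by
    funext s
    cases s with
    | nil => simp
    | cons x s => exact congrFun (L.map_smul c fun r => φ (x :: r)) s

theorem shiftOp_nil {K : Type} (L : Op K) (φ : List K → ℂ) : shiftOp L φ [] = 0 := rfl

theorem shiftOp_cons {K : Type} (L : Op K) (φ : List K → ℂ) (x : K) (s : List K) :
    shiftOp L φ (x :: s) = L (fun r => φ (x :: r)) s := rfl

theorem shiftOp_mul {K : Type} (L L' : Op K) : shiftOp (L * L') = shiftOp L * shiftOp L' := by
  ext φ s; cases s <;> rfl

theorem shiftOp_add {K : Type} (L L' : Op K) : shiftOp (L + L') = shiftOp L + shiftOp L' := by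
  ext φ s; cases s <;> simp [shiftOp]

theorem shiftOp_smul {K : Type} (c : ℂ) (L : Op K) : shiftOp (c • L) = c • shiftOp L := by
  ext φ s; cases s <;> simp [shiftOp]

theorem shiftOp_sum {K ι : Type} (t : Finset ι) (L : ι → Op K) :
    shiftOp (∑ a ∈ t, L a) = ∑ a ∈ t, shiftOp (L a) := by
  classical
  induction t using Finset.induction_on with
  | empty => ext φ s; cases s <;> simp [shiftOp]
  | insert a t ha ih => rw [Finset.sum_insert ha, Finset.sum_insert ha, shiftOp_add, ih]

theorem shiftOp_iterate_mul {K : Type} (i : ℕ) (L L' : Op K) :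
    shiftOp^[i] (L * L') = shiftOp^[i] L * shiftOp^[i] L' := by
  induction i with
  | zero => rfl
  | succ i ih => rw [Function.iterate_succ_apply', ih, shiftOp_mul, Function.iterate_succ_apply',
      Function.iterate_succ_apply']

theorem shiftOp_iterate_add {K : Type} (i : ℕ) (L L' : Op K) :
    shiftOp^[i] (L + L') = shiftOp^[i] L + shiftOp^[i] L' := by
  induction i with
  | zero => rfl
  | succ i ih => rw [Function.iterate_succ_apply', ih, shiftOp_add, Function.iterate_succ_apply',
      Function.iterate_succ_apply']

theorem shiftOp_iterate_smul {K : Type} (i : ℕ) (c : ℂ) (L : Op K) :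
    shiftOp^[i] (c • L) = c • shiftOp^[i] L := by
  induction i with
  | zero => rfl
  | succ i ih => rw [Function.iterate_succ_apply', ih, shiftOp_smul, Function.iterate_succ_apply']

theorem shiftOp_iterate_sum {K ι : Type} (i : ℕ) (t : Finset ι) (L : ι → Op K) :
    shiftOp^[i] (∑ a ∈ t, L a) = ∑ a ∈ t, shiftOp^[i] (L a) := by
  induction i with
  | zero => rfl
  | succ i ih => simp only [Function.iterate_succ_apply', ih, shiftOp_sum]

/-- Caps and crossings give zero on rows that are too short for them, whereas the identity does not.
Relations such as the second Reidemeister move therefore hold only on rows of sufficient length, and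
are transported with that bound. -/
theorem shiftOp_iterate_congr {K : Type} {n : ℕ} {L L' : Op K}
    (h : ∀ φ s, n ≤ s.length → L φ s = L' φ s) (i : ℕ) (φ : List K → ℂ) (s : List K)
    (hs : i + n ≤ s.length) : (shiftOp^[i] L) φ s = (shiftOp^[i] L') φ s := by
  induction i generalizing φ s with
  | zero => exact h φ s (by simpa using hs)
  | succ i ih =>
    cases s with
    | nil => simp at hs
    | cons x s =>
      simp only [Function.iterate_succ_apply', shiftOp_cons]
      exact ih _ _ (by simp at hs; omega)

theorem shiftOp_iterate_one {K : Type} (i : ℕ) (φ : List K → ℂ) (s : List K)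
    (hs : i ≤ s.length) : (shiftOp^[i] (1 : Op K)) φ s = φ s := by
  induction i generalizing φ s with
  | zero => rfl
  | succ i ih =>
    cases s with
    | nil => simp at hs
    | cons x s =>
      simp only [Function.iterate_succ_apply', shiftOp_cons]
      exact ih _ _ (by simp at hs; omega)

def cupOp (K : Type) [Fintype K] : Op K where
  toFun φ s := ∑ a, φ (a :: a :: s)
  map_add' φ ψ := by funext s; simp [Finset.sum_add_distrib]
  map_smul' c φ := by funext s; simp [Finset.mul_sum]

def capOp (K : Type) [DecidableEq K] : Op K where
  toFun φ s := match s with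
    | a :: b :: s => if a = b then φ s else 0
    | _ => 0
  map_add' φ ψ := by funext s; rcases s with _ | ⟨a, _ | ⟨b, s⟩⟩ <;> simp; split_ifs <;> simp
  map_smul' c φ := by funext s; rcases s with _ | ⟨a, _ | ⟨b, s⟩⟩ <;> simp

/-- The operator of a slice, if crossings and tie ends at the left end act by `X` and `T`. -/
def sliceOp {K : Type} [Fintype K] [DecidableEq K] (X : Bool → Op K) (T : ℕ → Op K) :
    Slice Unit → Op K
  | piece (cup _) i => shiftOp^[i] (cupOp K)
  | piece cap i => shiftOp^[i] (capOp K)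
  | piece (cross o) i => shiftOp^[i] (X o)
  | tieEnd i k => shiftOp^[i] (T k)

/-- Operators pull functions of the row above back to functions of the row below. The lowest slice
is thus the leftmost factor, and a closed word is evaluated by applying its operator to the constant
function 1 and reading the value at the empty row. -/
def wordOp {K : Type} [Fintype K] [DecidableEq K] (X : Bool → Op K) (T : ℕ → Op K)
    (w : List (Slice Unit)) : Op K := (w.map (sliceOp X T)).prod

section
variable {K : Type} [Fintype K] [DecidableEq K] (X : Bool → Op K) (T : ℕ → Op K)

theorem cupOp_apply (φ : List K → ℂ) (s : List K) : cupOp K φ s = ∑ a, φ (a :: a :: s) := rfl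

theorem capOp_cons (φ : List K → ℂ) (a b : K) (s : List K) :
    capOp K φ (a :: b :: s) = if a = b then φ s else 0 := rfl

theorem capOp_nil (φ : List K → ℂ) : capOp K φ [] = 0 := rfl

theorem capOp_single (φ : List K → ℂ) (a : K) : capOp K φ [a] = 0 := rfl

theorem wordOp_nil : wordOp X T [] = 1 := rfl

theorem wordOp_cons (l : Slice Unit) (w : List (Slice Unit)) :
    wordOp X T (l :: w) = sliceOp X T l * wordOp X T w := by simp [wordOp]

theorem wordOp_append (u v : List (Slice Unit)) :
    wordOp X T (u ++ v) = wordOp X T u * wordOp X T v := by simp [wordOp]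

theorem wordOp_cons_apply (l : Slice Unit) (w : List (Slice Unit)) (φ : List K → ℂ) :
    wordOp X T (l :: w) φ = sliceOp X T l (wordOp X T w φ) := by rw [wordOp_cons]; rfl

theorem wordOp_append_apply (u v : List (Slice Unit)) (φ : List K → ℂ) :
    wordOp X T (u ++ v) φ = wordOp X T u (wordOp X T v φ) := by rw [wordOp_append]; rfl

theorem sliceOp_shift (l : Slice Unit) : sliceOp X T l.shift = shiftOp (sliceOp X T l) := by
  rcases l with ⟨e | _ | o, i⟩ | ⟨i, k⟩ <;> exact Function.iterate_succ_apply' _ _ _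

/-- The leftmost strand is a spectator, and its label is a fixed parameter of the function. -/
theorem wordOp_shift (w : List (Slice Unit)) (φ : List K → ℂ) (x : K) (s : List K) :
    wordOp X T (w.map Slice.shift) φ (x :: s) = wordOp X T w (fun r => φ (x :: r)) s := by
  induction w generalizing s with
  | nil => rfl
  | cons l w ih =>
    rw [List.map_cons, wordOp_cons_apply, wordOp_cons_apply, sliceOp_shift, shiftOp_cons]
    exact congrFun (congrArg _ (funext ih)) s

/-! ### Planar moves -/

theorem cupOp_comm (L : Op K) : cupOp K * shiftOp (shiftOp L) = L * cupOp K := by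
  ext φ s
  have h : cupOp K φ = ∑ a, fun r => φ (a :: a :: r) := by
    funext r; simp [cupOp_apply]
  simp only [Module.End.mul_apply, h, map_sum, Finset.sum_apply]
  rfl

theorem capOp_comm (L : Op K) : capOp K * L = shiftOp (shiftOp L) * capOp K := by
  ext φ s
  rcases s with _ | ⟨a, _ | ⟨b, s⟩⟩
  · rfl
  · rfl
  · simp only [Module.End.mul_apply, capOp_cons, shiftOp_cons]
    split_ifs
    · rfl
    · exact (congrFun (map_zero L) s).symm

theorem zigzagOp (φ : List K → ℂ) (s : List K) (hs : 1 ≤ s.length) :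
    (shiftOp (cupOp K) * capOp K) φ s = (1 : Op K) φ s := by
  rcases s with _ | ⟨x, s⟩
  · simp at hs
  · simp [shiftOp_cons, cupOp_apply, capOp_cons]

theorem zagzigOp (φ : List K → ℂ) (s : List K) (hs : 1 ≤ s.length) :
    (cupOp K * shiftOp (capOp K)) φ s = (1 : Op K) φ s := by
  rcases s with _ | ⟨x, s⟩
  · simp at hs
  · simp [shiftOp_cons, cupOp_apply, capOp_cons]

theorem circleOp : cupOp K * capOp K = (Fintype.card K : ℂ) • (1 : Op K) := by
  ext φ s
  simp [cupOp_apply, capOp_cons]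

end

/-! ### Coloured strands

The labels are pairs of a colour and a spin. -/

section
variable {C S : Type} [Fintype C] [LinearOrder C] [Fintype S] [DecidableEq S]

/-- `-1` if the overstrand has the smaller colour. -/
def colourSign (o : Bool) (a b : C) : ℤ := if (if o then a < b else b < a) then -1 else 1

/-- Kauffman's smoothing rule at crossings of strands of the same colour, a sign at crossings of
strands of different colours. -/
noncomputable def crossOp (α : ℂ) (o : Bool) : Op (C × S) where
  toFun φ s := match s with
    | a :: b :: s =>
        if a.1 = b.1 then
          α ^ eps o * φ (a :: b :: s) +
            α ^ (-eps o) * (if a.2 = b.2 then ∑ m, φ ((a.1, m) :: (a.1, m) :: s) else 0)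
        else colourSign o a.1 b.1 * φ (b :: a :: s)
    | _ => 0
  map_add' φ ψ := by
    funext s
    rcases s with _ | ⟨a, _ | ⟨b, s⟩⟩ <;> simp [Finset.sum_add_distrib]
    split_ifs <;> ring
  map_smul' c φ := by
    funext s
    rcases s with _ | ⟨a, _ | ⟨b, s⟩⟩ <;> simp [← Finset.mul_sum]
    split_ifs <;> ring

def tieOp (S : Type) (c : C) : Op (C × S) where
  toFun φ s := match s with
    | a :: s => if a.1 = c then φ (a :: s) else 0
    | [] => 0
  map_add' φ ψ := by
    funext s; rcases s with _ | ⟨a, s⟩ <;> simp; split_ifs <;> simp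
  map_smul' c φ := by
    funext s; rcases s with _ | ⟨a, s⟩ <;> simp

theorem crossOp_cons (α : ℂ) (o : Bool) (φ : List (C × S) → ℂ) (a b : C × S)
    (s : List (C × S)) : crossOp α o φ (a :: b :: s) =
      if a.1 = b.1 then
          α ^ eps o * φ (a :: b :: s) +
            α ^ (-eps o) * (if a.2 = b.2 then ∑ m, φ ((a.1, m) :: (a.1, m) :: s) else 0)
        else colourSign o a.1 b.1 * φ (b :: a :: s) := rfl

theorem crossOp_nil (α : ℂ) (o : Bool) (φ : List (C × S) → ℂ) : crossOp α o φ [] = 0 := rfl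

theorem crossOp_single (α : ℂ) (o : Bool) (φ : List (C × S) → ℂ) (a : C × S) :
    crossOp α o φ [a] = 0 := rfl

theorem tieOp_cons (c : C) (φ : List (C × S) → ℂ) (a : C × S) (s : List (C × S)) :
    tieOp S c φ (a :: s) = if a.1 = c then φ (a :: s) else 0 := rfl

theorem tieOp_nil (c : C) (φ : List (C × S) → ℂ) : tieOp S c φ [] = 0 := rfl

theorem colourSign_not (o : Bool) (a b : C) : colourSign (!o) b a = colourSign o a b := by
  cases o <;> rfl

theorem colourSign_sq (o : Bool) (a b : C) :
    (colourSign o a b : ℂ) * (colourSign o a b : ℂ) = 1 := by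
  unfold colourSign; split_ifs <;> simp

theorem eps_not (o : Bool) : eps (!o) = -eps o := by cases o <;> rfl

theorem crossOp_comm (α : ℂ) (o : Bool) (L : Op (C × S)) :
    crossOp α o * shiftOp (shiftOp L) = shiftOp (shiftOp L) * crossOp α o := by
  ext φ s
  rcases s with _ | ⟨a, _ | ⟨b, s⟩⟩
  · rfl
  · rfl
  · simp only [Module.End.mul_apply, crossOp_cons, shiftOp_cons]
    by_cases h : a.1 = b.1
    · simp only [h, if_true]
      by_cases h' : a.2 = b.2
      · simp only [h', if_true]
        have : (fun r => α ^ eps o * φ (a :: b :: r) +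
            α ^ (-eps o) * ∑ m, φ ((b.1, m) :: (b.1, m) :: r)) =
            α ^ eps o • (fun r => φ (a :: b :: r)) +
            α ^ (-eps o) • ∑ m, fun r => φ ((b.1, m) :: (b.1, m) :: r) := by
          funext r; simp
        rw [this]
        simp only [map_add, map_smul, map_sum, Pi.add_apply, Pi.smul_apply, Finset.sum_apply,
          smul_eq_mul]
      · simp only [h', if_false, mul_zero, add_zero]
        exact (congrFun (L.map_smul (α ^ eps o) fun r => φ (a :: b :: r)) s).symm
    · simp only [h, if_false]
      exact (congrFun (L.map_smul (colourSign o a.1 b.1 : ℂ) fun r => φ (b :: a :: r)) s).symm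

/-- Rotating a crossing interchanges its two smoothings, and it interchanges the two colours in the
comparison that gives the sign. Replacing `o` by `!o` has both effects. -/
theorem slideCupOp (α : ℂ) (o : Bool) :
    cupOp (C × S) * shiftOp (crossOp α o) = shiftOp (cupOp (C × S)) * crossOp α (!o) := by
  ext φ s
  rcases s with _ | ⟨x, s⟩
  · simp [shiftOp_nil, shiftOp_cons, cupOp_apply, crossOp_single]
  · obtain ⟨c, x⟩ := x
    simp only [Module.End.mul_apply, shiftOp_cons, cupOp_apply, crossOp_cons,
      Fintype.sum_prod_type, colourSign_not, eps_not, neg_neg]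
    refine Finset.sum_congr rfl fun a _ => ?_
    by_cases h : a = c
    · subst h
      simp [Finset.sum_add_distrib, ← Finset.mul_sum]
      ring
    · simp [h, Ne.symm h]

theorem slideCapOp (α : ℂ) (o : Bool) :
    shiftOp (crossOp α o) * capOp (C × S) = crossOp α (!o) * shiftOp (capOp (C × S)) := by
  ext φ s
  rcases s with _ | ⟨⟨a, x⟩, _ | ⟨⟨b, y⟩, _ | ⟨⟨c, z⟩, s⟩⟩⟩
  · rfl
  · simp [shiftOp_nil, shiftOp_cons, crossOp_single, crossOp_nil]
  · simp [shiftOp_nil, shiftOp_cons, crossOp_single, crossOp_cons, capOp_single]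
  · simp only [Module.End.mul_apply, shiftOp_cons, crossOp_cons, capOp_cons,
      colourSign_not, eps_not, neg_neg, Prod.mk.injEq]
    by_cases h : a = b
    · subst h
      by_cases h' : a = c
      · subst h'
        by_cases h1 : x = y <;> by_cases h2 : y = z <;> simp [h1, h2] 
        all_goals ring
      · simp [h']
    · by_cases h' : b = c
      · subst h'
        simp [h]
      · by_cases h2 : a = c
        · subst h2
          by_cases h3 : x = z
          · subst h3; simp [h, h', ← colourSign_not o b a]
          · simp [h, h', h3]
        · simp [h, h', h2]

/-- For equal colours this is Kauffman's computation, with U the cap followed by the cup: the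
coefficient of U is α²+α⁻² plus the loop value, which vanishes by `hM`. For different colours the
same sign occurs twice. -/
theorem reidemeisterTwoOp {α : ℂ} (hα : α ≠ 0)
    (hM : α ^ 2 + α ^ (-2 : ℤ) = -(Fintype.card S : ℂ)) (o : Bool) (φ : List (C × S) → ℂ)
    (s : List (C × S)) (hs : 2 ≤ s.length) :
    (crossOp α o * crossOp α (!o) : Op (C × S)) φ s = (1 : Op (C × S)) φ s := by
  rcases s with _ | ⟨⟨a, x⟩, _ | ⟨⟨b, y⟩, s⟩⟩
  · simp at hs
  · simp at hs
  · simp only [Module.End.mul_apply, crossOp_cons, eps_not, neg_neg, Module.End.one_apply]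
    by_cases h : a = b
    · subst h
      have h1 : α ^ eps o * α ^ (-eps o) = 1 := by rw [← zpow_add₀ hα]; simp
      have h2 : α ^ eps o * α ^ eps o + α ^ (-eps o) * α ^ (-eps o) =
          -(Fintype.card S : ℂ) := by
        rw [← hM]
        cases o <;> simp [eps] <;> field_simp
        ring
      by_cases h' : x = y
      · subst h'
        simp [Finset.sum_add_distrib, ← Finset.mul_sum]
        rw [zpow_neg] at h1 h2
        -- The three terms come from the identity, from the two single smoothings, and from the
        -- double smoothing, which produces a free loop and hence the factor `Fintype.card S`.
        linear_combination φ ((a, x) :: (a, x) :: s) * h1 +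
          (∑ m, φ ((a, m) :: (a, m) :: s)) * h2 +
          (Fintype.card S : ℂ) * (∑ m, φ ((a, m) :: (a, m) :: s)) * h1
      · simp [h']
        rw [zpow_neg] at h1
        linear_combination φ ((a, x) :: (a, y) :: s) * h1
    · simp [h, Ne.symm h, colourSign_not, ← mul_assoc, colourSign_sq]

/-- Strands of three different colours give the same three signs on both sides. If exactly two
colours agree, the smoothings of the one equal-coloured crossing slide past the third strand, whose
two signs depend on colours only. The hypothesis `ho` is used only when all three colours agree,
where the identity is Kauffman's. -/
theorem reidemeisterThreeOp {α : ℂ} (hα : α ≠ 0)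
    (hM : α ^ 2 + α ^ (-2 : ℤ) = -(Fintype.card S : ℂ)) (o₁ o₂ o₃ : Bool)
    (ho : o₁ = o₂ ∨ o₃ = o₂) :
    (crossOp α o₁ * shiftOp (crossOp α o₂) * crossOp α o₃ : Op (C × S)) =
      shiftOp (crossOp α o₃) * crossOp α o₂ * shiftOp (crossOp α o₁) := by
  have hz : α ^ (-2 : ℤ) = α⁻¹ * α⁻¹ := by
    rw [zpow_neg]; simp [sq]
  -- Eliminating the number of spins leaves, in each case, an identity between rational expressions
  -- in α.
  have hd : (Fintype.card S : ℂ) = -(α ^ 2 + α⁻¹ * α⁻¹) := by rw [← hz, hM, neg_neg]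
  clear hM hz
  ext φ s
  rcases s with _ | ⟨⟨a, x⟩, _ | ⟨⟨b, y⟩, _ | ⟨⟨c, z⟩, s⟩⟩⟩
  · rfl
  · simp [shiftOp_cons, crossOp_single, crossOp_nil]
  · simp [shiftOp_cons, crossOp_single, crossOp_cons, crossOp_nil]
  simp only [Module.End.mul_apply, shiftOp_cons, crossOp_cons]
  by_cases h : a = b
  · subst h
    by_cases h' : a = c
    · subst h'
      rcases eq_or_ne x y with rfl | h2 <;> rcases eq_or_ne x z with rfl | h3
      · simp [Finset.sum_add_distrib, mul_add, ← Finset.mul_sum]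
        rcases o₁ <;> rcases o₂ <;> rcases o₃ <;> simp [eps] at ho ⊢ <;> rw [hd] <;>
          field_simp <;> ring
      · simp [h3, Finset.sum_add_distrib, mul_add, ← Finset.mul_sum]
        rcases o₁ <;> rcases o₂ <;> rcases o₃ <;> simp [eps] at ho ⊢ <;> rw [hd] <;>
          field_simp <;> ring
      · simp [h2, h2.symm]
        ring
      · rcases eq_or_ne y z with rfl | h4
        · simp [h2, Finset.sum_add_distrib, mul_add, ← Finset.mul_sum]
          rcases o₁ <;> rcases o₂ <;> rcases o₃ <;> simp [eps] at ho ⊢ <;> rw [hd] <;>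
            field_simp <;> ring
        · simp [h2, h4]
          ring
    · simp [h', Ne.symm h', ← Finset.mul_sum]
      split_ifs <;> ring
  · by_cases h' : b = c
    · subst h'
      simp [h, Ne.symm h, ← Finset.mul_sum]
      split_ifs <;> ring
    · by_cases h2 : a = c
      · subst h2
        simp [h, h', ← Finset.mul_sum]
        split_ifs <;> ring
      · simp [h, h', h2]
        ring

end
end TiedLink

/-! ### Labellings of diagrams and the partition generated by the ties. -/

namespace TiedLink
open Piece Slice Direction

/-! ### Numbers of strands -/

/-- The number of strands above a slice of an unoriented diagram. -/
def heightStep : Slice Unit → ℕ → Option ℕ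
  | piece (cup _) i, n => if i ≤ n then some (n + 2) else none
  | piece cap i, n => if i + 2 ≤ n then some (n - 2) else none
  | piece (cross _) i, n => if i + 2 ≤ n then some n else none
  | tieEnd i _, n => if i < n then some n else none

def heightRun : List (Slice Unit) → ℕ → Option ℕ
  | [], n => some n
  | l :: w, n => (heightStep l n).bind (heightRun w)

theorem unit_list_eq (s : List Unit) : s = List.replicate s.length () :=
  List.eq_replicate_of_mem fun _ _ => rfl

/-- A row of unoriented strands carries no information besides its length, so whether an unoriented
word fits together is arithmetic with heights. -/
theorem step_unit (l : Slice Unit) (s : List Unit) :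
    l.step s = (heightStep l s.length).map (List.replicate · ()) := by
  rcases l with ⟨e | _ | o, i⟩ | ⟨i, k⟩
  · simp only [Slice.step, heightStep]
    split_ifs with h
    · simp only [Option.map_some, Option.some.injEq]
      rw [unit_list_eq (List.take i s ++ _)]
      congr 1
      simp; omega
    · rfl
  · simp only [Slice.step, heightStep]
    split
    · rename_i a b r hd
      have hl := congrArg List.length hd
      simp at hl
      rw [if_pos trivial, if_pos (by omega)]
      simp only [Option.map_some, Option.some.injEq]
      rw [unit_list_eq (List.take i s ++ _)]
      congr 1
      simp; omega
    · rename_i h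
      rw [if_neg]; · rfl
      intro hi
      rcases hd : s.drop i with _ | ⟨a, _ | ⟨b, r⟩⟩
      · have := congrArg List.length hd; simp at this; omega
      · have := congrArg List.length hd; simp at this; omega
      · exact h a b r hd
  · simp only [Slice.step, heightStep]
    split
    · rename_i a b r hd
      have hl := congrArg List.length hd
      simp at hl
      rw [if_pos (by omega)]
      simp only [Option.map_some, Option.some.injEq]
      rw [unit_list_eq (List.take i s ++ _)]
      congr 1
      simp; omega
    · rename_i h
      rw [if_neg]; · rfl
      intro hi
      rcases hd : s.drop i with _ | ⟨a, _ | ⟨b, r⟩⟩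
      · have := congrArg List.length hd; simp at this; omega
      · have := congrArg List.length hd; simp at this; omega
      · exact h a b r hd
  · simp only [Slice.step, heightStep]
    split_ifs with h
    · simp [← unit_list_eq]
    · rfl

theorem run_unit (w : List (Slice Unit)) (s : List Unit) :
    run w s = (heightRun w s.length).map (List.replicate · ()) := by
  induction w generalizing s with
  | nil => simp [run, heightRun, ← unit_list_eq]
  | cons l w ih =>
    simp only [run, heightRun, step_unit]
    cases heightStep l s.length with
    | none => rfl
    | some n => simp [ih]

theorem heightRun_of_run {w : List (Slice Unit)} {s s' : List Unit} (h : run w s = some s') :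
    heightRun w s.length = some s'.length := by
  rw [run_unit] at h
  cases hn : heightRun w s.length with
  | none => simp [hn] at h
  | some n => simp [hn] at h; simp [← h]

theorem run_of_heightRun {w : List (Slice Unit)} {s s' : List Unit}
    (h : heightRun w s.length = some s'.length) : run w s = some s' := by
  rw [run_unit, h]; simp [← unit_list_eq]

theorem closed_iff (w : List (Slice Unit)) : run w [] = some [] ↔ heightRun w 0 = some 0 :=
  ⟨heightRun_of_run, run_of_heightRun (s := []) (s' := [])⟩

theorem heightRun_append (u v : List (Slice Unit)) (n : ℕ) :
    heightRun (u ++ v) n = (heightRun u n).bind (heightRun v) := by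
  induction u generalizing n with
  | nil => rfl
  | cons l u ih =>
    simp only [List.cons_append, heightRun]
    cases heightStep l n with
    | none => rfl
    | some m => simp [ih]

theorem heightRun_append_eq {u v : List (Slice Unit)} {n m : ℕ}
    (h : heightRun (u ++ v) n = some m) :
    ∃ k, heightRun u n = some k ∧ heightRun v k = some m := by
  rw [heightRun_append] at h
  exact Option.bind_eq_some_iff.mp h

/-- The number of strands of a closed diagram at the given height. -/
def heightAt (w : List (Slice Unit)) (j : ℕ) : ℕ := (heightRun (w.take j) 0).getD 0

theorem isPoint_iff (w : List (Slice Unit)) (x : ℕ × ℕ) :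
    IsPoint w x ↔ x.2 < heightAt w x.1 := by
  unfold IsPoint heightAt
  rw [run_unit]
  simp only [List.length_nil]
  cases h : heightRun (w.take x.1) 0 with
  | none => simp
  | some n => simp

theorem heightStep_heightAt {w : List (Slice Unit)} {m : ℕ} (hw : heightRun w 0 = some m) {j : ℕ}
    {l : Slice Unit} (hl : w[j]? = some l) :
    heightStep l (heightAt w j) = some (heightAt w (j + 1)) := by
  obtain ⟨hj, rfl⟩ := List.getElem?_eq_some_iff.mp hl
  have h : w = w.take j ++ w[j] :: w.drop (j + 1) := by simp
  rw [h] at hw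
  obtain ⟨n, h1, h2⟩ := heightRun_append_eq hw
  simp only [heightRun] at h2
  obtain ⟨n', h3, h4⟩ := Option.bind_eq_some_iff.mp h2
  have h5 : heightRun (w.take (j + 1)) 0 = some n' := by
    rw [List.take_succ_eq_append_getElem hj, heightRun_append, h1]
    simp [heightRun, h3]
  simp [heightAt, h1, h5, h3]

/-! ### Rows of labels -/

/-- Rows of labels below and above a slice that agree along the strands. The labels of strands
that carry an end of a tie `k` satisfy `τ k`. -/
def Next {δ K : Type} (τ : ℕ → K → Prop) : Slice δ → List K → List K → Prop
  | piece (cup _) i, s, s' => ∃ p r a, p.length = i ∧ s = p ++ r ∧ s' = p ++ a :: a :: r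
  | piece cap i, s, s' => ∃ p r a, p.length = i ∧ s = p ++ a :: a :: r ∧ s' = p ++ r
  | piece (cross _) i, s, s' =>
      ∃ p r a b, p.length = i ∧ s = p ++ a :: b :: r ∧ s' = p ++ b :: a :: r
  | tieEnd i k, s, s' => s' = s ∧ ∃ a, s[i]? = some a ∧ τ k a

def Follows {δ K : Type} (τ : ℕ → K → Prop) (w : List (Slice δ)) (F : ℕ → List K) : Prop :=
  ∀ j l, w[j]? = some l → Next τ l (F j) (F (j + 1))

section
variable {δ K : Type} {τ : ℕ → K → Prop}

theorem follows_nil (F : ℕ → List K) : Follows τ ([] : List (Slice δ)) F := by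
  intro j l h; simp at h

theorem follows_cons {l : Slice δ} {w : List (Slice δ)} {F : ℕ → List K} :
    Follows τ (l :: w) F ↔ Next τ l (F 0) (F 1) ∧ Follows τ w (fun j => F (j + 1)) := by
  constructor
  · intro h
    exact ⟨h 0 l (by simp), fun j m hm => h (j + 1) m (by simpa using hm)⟩
  · rintro ⟨h0, h1⟩ (_ | j) m hm
    · simp at hm; subst hm; exact h0
    · exact h1 j m (by simpa using hm)

theorem follows_append {u v : List (Slice δ)} {F : ℕ → List K} :
    Follows τ (u ++ v) F ↔ Follows τ u F ∧ Follows τ v (fun j => F (u.length + j)) := by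
  induction u generalizing F with
  | nil => simp [follows_nil]
  | cons l u ih =>
    rw [List.cons_append, follows_cons, ih, follows_cons, and_assoc]
    simp [Nat.add_right_comm, Nat.add_assoc, Nat.add_comm 1]

theorem follows_cons_mk {l : Slice δ} {w : List (Slice δ)} {s : List K} {F : ℕ → List K}
    (h : Next τ l s (F 0)) (hF : Follows τ w F) :
    Follows τ (l :: w) (fun j => Nat.casesOn j s F) :=
  follows_cons.mpr ⟨h, hF⟩

/-- Two successions of rows that fit together. -/
theorem follows_append_mk {u v : List (Slice δ)} {F G : ℕ → List K} (hF : Follows τ u F)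
    (hG : Follows τ v G) (h : F u.length = G 0) :
    ∃ H, Follows τ (u ++ v) H ∧ H 0 = F 0 ∧ H u.length = G 0 := by
  induction u generalizing F with
  | nil => exact ⟨G, hG, h.symm, rfl⟩
  | cons l u ih =>
    rw [follows_cons] at hF
    obtain ⟨H, h1, h2, h3⟩ := ih hF.2 h
    refine ⟨fun j => Nat.casesOn j (F 0) H, ?_, rfl, h3⟩
    exact follows_cons_mk (by rw [h2]; exact hF.1) h1

theorem next_shift {l : Slice δ} {s s' : List K} (x : K) (h : Next τ l s s') :
    Next τ l.shift (x :: s) (x :: s') := by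
  rcases l with ⟨e | _ | o, i⟩ | ⟨i, k⟩
  · obtain ⟨p, r, a, rfl, rfl, rfl⟩ := h
    exact ⟨x :: p, r, a, rfl, rfl, rfl⟩
  · obtain ⟨p, r, a, rfl, rfl, rfl⟩ := h
    exact ⟨x :: p, r, a, rfl, rfl, rfl⟩
  · obtain ⟨p, r, a, b, rfl, rfl, rfl⟩ := h
    exact ⟨x :: p, r, a, b, rfl, rfl, rfl⟩
  · obtain ⟨rfl, a, h1, h2⟩ := h
    exact ⟨rfl, a, by simpa using h1, h2⟩

theorem next_heightStep {l : Slice Unit} {s s' : List K} (h : Next τ l s s') :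
    heightStep l s.length = some s'.length := by
  rcases l with ⟨e | _ | o, i⟩ | ⟨i, k⟩
  · obtain ⟨p, r, a, rfl, rfl, rfl⟩ := h
    simp [heightStep]; omega
  · obtain ⟨p, r, a, rfl, rfl, rfl⟩ := h
    simp [heightStep]; omega
  · obtain ⟨p, r, a, b, rfl, rfl, rfl⟩ := h
    simp [heightStep]
  · obtain ⟨rfl, a, h1, h2⟩ := h
    obtain ⟨hi, -⟩ := List.getElem?_eq_some_iff.mp h1
    simp [heightStep, hi]

theorem follows_heightRun {w : List (Slice Unit)} {F : ℕ → List K} (hF : Follows τ w F) :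
    heightRun w (F 0).length = some (F w.length).length := by
  induction w generalizing F with
  | nil => rfl
  | cons l w ih =>
    rw [follows_cons] at hF
    simp only [heightRun, next_heightStep hF.1, Option.bind_some]
    exact ih hF.2

theorem next_through {l : Slice δ} {s s' : List K} (h : Next τ l s s') {p q : ℕ}
    (hpq : l.Through p q) : s[p]? = s'[q]? := by
  rcases l with ⟨e | _ | o, i⟩ | ⟨i, k⟩
  · obtain ⟨t, r, a, rfl, rfl, rfl⟩ := h
    simp only [Slice.Through] at hpq
    subst hpq
    split_ifs with hp
    · rw [List.getElem?_append_left hp, List.getElem?_append_left hp]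
    · rw [List.getElem?_append_right (by omega), List.getElem?_append_right (by omega)]
      rw [show p + 2 - t.length = (p - t.length) + 1 + 1 by omega]
      simp
  · obtain ⟨t, r, a, rfl, rfl, rfl⟩ := h
    simp only [Slice.Through] at hpq
    subst hpq
    split_ifs with hp
    · rw [List.getElem?_append_left hp, List.getElem?_append_left hp]
    · rw [List.getElem?_append_right (by omega), List.getElem?_append_right (by omega)]
      rw [show q + 2 - t.length = (q - t.length) + 1 + 1 by omega]
      simp
  · obtain ⟨t, r, a, b, rfl, rfl, rfl⟩ := h
    simp only [Slice.Through] at hpq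
    subst hpq
    rw [Equiv.swap_apply_def]
    split_ifs with h1 h2
    · subst h1; simp
    · subst h2; simp
    · rcases lt_or_ge p t.length with hp | hp
      · rw [List.getElem?_append_left hp, List.getElem?_append_left hp]
      · obtain ⟨m, rfl⟩ : ∃ m, p = t.length + (m + 2) := ⟨p - t.length - 2, by omega⟩
        rw [List.getElem?_append_right (by omega), List.getElem?_append_right (by omega)]
        simp
  · obtain ⟨rfl, -⟩ := h
    simp only [Slice.Through] at hpq
    rw [hpq]

theorem follows_joined {w : List (Slice δ)} {F : ℕ → List K} (hF : Follows τ w F) {x y : ℕ × ℕ}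
    (h : Joined w x y) : (F x.1)[x.2]? = (F y.1)[y.2]? := by
  cases h with
  | through k p q l hl h => exact next_through (hF k l hl) h
  | cup k i d hl =>
    obtain ⟨t, r, a, rfl, h1, h2⟩ := hF k _ hl
    simp [h2]
  | cap k i hl =>
    obtain ⟨t, r, a, rfl, h1, h2⟩ := hF k _ hl
    simp [h1]

theorem follows_tieEnd {w : List (Slice δ)} {F : ℕ → List K} (hF : Follows τ w F) {x : ℕ × ℕ}
    {k : ℕ} (h : HasTieEnd w x k) : ∃ a, (F x.1)[x.2]? = some a ∧ τ k a :=
  (hF _ _ h).2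

/-- This passes from equality along single strands to the splitting of rows that `Next` asks for. It
is what turns a function on points that is constant along arcs into a sequence of rows. -/
theorem next_of_getElem {l : Slice Unit} {s s' : List K}
    (hlen : heightStep l s.length = some s'.length)
    (hthrough : ∀ p q, l.Through p q → p < s.length → q < s'.length → s[p]? = s'[q]?)
    (hcup : ∀ d i, l = piece (cup d) i → s'[i]? = s'[i + 1]?)
    (hcap : ∀ i, l = piece cap i → s[i]? = s[i + 1]?)
    (htie : ∀ i k, l = tieEnd i k → ∃ a, s[i]? = some a ∧ τ k a) : Next τ l s s' := by
  rcases l with ⟨e | _ | o, i⟩ | ⟨i, k⟩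
  · simp only [heightStep] at hlen
    split_ifs at hlen with hi
    simp only [Option.some.injEq] at hlen
    have h2 := hcup e i rfl
    refine ⟨s.take i, s.drop i, s'[i], by simp [hi], by simp, ?_⟩
    apply List.ext_getElem?
    intro q
    rcases lt_or_ge q i with hq | hq
    · rw [List.getElem?_append_left (by simp; omega), List.getElem?_take_of_lt hq]
      exact (hthrough q q (by simp [Slice.Through, hq]) (by omega) (by omega)).symm
    · rw [List.getElem?_append_right (by simp; omega), List.length_take, min_eq_left hi]
      obtain ⟨m, rfl⟩ : ∃ m, q = i + m := ⟨q - i, by omega⟩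
      rw [Nat.add_sub_cancel_left]
      rcases m with _ | _ | m
      · simp
      · simp only [zero_add, List.getElem?_cons_succ, List.getElem?_cons_zero]
        rw [← h2]; simp
      · simp only [List.getElem?_cons_succ, List.getElem?_drop]
        rcases lt_or_ge (i + m) s.length with hm | hm
        · exact (hthrough (i + m) (i + (m + 1 + 1)) (by simp [Slice.Through]; omega) hm
            (by omega)).symm
        · rw [List.getElem?_eq_none hm, List.getElem?_eq_none (by omega)]
  · simp only [heightStep] at hlen
    split_ifs at hlen with hi
    simp only [Option.some.injEq] at hlen
    have h2 := hcap i rfl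
    refine ⟨s'.take i, s'.drop i, s[i], by simp; omega, ?_, by simp⟩
    apply List.ext_getElem?
    intro q
    rcases lt_or_ge q i with hq | hq
    · rw [List.getElem?_append_left (by simp; omega), List.getElem?_take_of_lt hq]
      exact hthrough q q (by simp [Slice.Through, hq]) (by omega) (by omega)
    · rw [List.getElem?_append_right (by simp; omega), List.length_take,
        min_eq_left (by omega)]
      obtain ⟨m, rfl⟩ : ∃ m, q = i + m := ⟨q - i, by omega⟩
      rw [Nat.add_sub_cancel_left]
      rcases m with _ | _ | m
      · simp
      · simp only [zero_add, List.getElem?_cons_succ, List.getElem?_cons_zero]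
        rw [← h2]; simp
      · simp only [List.getElem?_cons_succ, List.getElem?_drop]
        rcases lt_or_ge (i + m) s'.length with hm | hm
        · exact hthrough (i + (m + 1 + 1)) (i + m) (by simp [Slice.Through]; omega) (by omega) hm
        · rw [List.getElem?_eq_none hm, List.getElem?_eq_none (by omega)]
  · simp only [heightStep] at hlen
    split_ifs at hlen with hi
    simp only [Option.some.injEq] at hlen
    refine ⟨s.take i, s.drop (i + 2), s[i], s[i + 1], by simp; omega, ?_, ?_⟩
    · simp
    · apply List.ext_getElem?
      intro q
      rcases lt_or_ge q i with hq | hq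
      · rw [List.getElem?_append_left (by simp; omega), List.getElem?_take_of_lt hq]
        exact (hthrough q q (by
          simp [Slice.Through, Equiv.swap_apply_def]; split_ifs <;> omega)
          (by omega) (by omega)).symm
      · rw [List.getElem?_append_right (by simp; omega), List.length_take,
          min_eq_left (by omega)]
        obtain ⟨m, rfl⟩ : ∃ m, q = i + m := ⟨q - i, by omega⟩
        rw [Nat.add_sub_cancel_left]
        rcases m with _ | _ | m
        · rw [← hthrough (i + 1) (i + 0) (by simp [Slice.Through]) (by omega) (by omega)]
          simp
        · rw [← hthrough i (i + (0 + 1)) (by simp [Slice.Through]) (by omega) (by omega)]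
          simp
        · simp only [List.getElem?_cons_succ, List.getElem?_drop]
          rcases lt_or_ge (i + 2 + m) s.length with hm | hm
          · rw [show i + (m + 1 + 1) = i + 2 + m by omega]
            exact (hthrough (i + 2 + m) (i + 2 + m) (by
              simp [Slice.Through, Equiv.swap_apply_def]; split_ifs <;> omega) hm
              (by omega)).symm
          · rw [List.getElem?_eq_none hm, List.getElem?_eq_none (by omega)]
  · simp only [heightStep] at hlen
    split_ifs at hlen with hi
    simp only [Option.some.injEq] at hlen
    refine ⟨?_, htie i k rfl⟩
    apply List.ext_getElem?
    intro q
    rcases lt_or_ge q s.length with hm | hm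
    · exact (hthrough q q rfl hm (by omega)).symm
    · rw [List.getElem?_eq_none hm, List.getElem?_eq_none (by omega)]

/-- The rows of a labelling of the points of a closed diagram. -/
def rowsOf (w : List (Slice Unit)) (f : ℕ × ℕ → K) (j : ℕ) : List K :=
  (List.range (heightAt w j)).map fun p => f (j, p)

theorem length_rowsOf (w : List (Slice Unit)) (f : ℕ × ℕ → K) (j : ℕ) :
    (rowsOf w f j).length = heightAt w j := by simp [rowsOf]

theorem getElem?_rowsOf {w : List (Slice Unit)} (f : ℕ × ℕ → K) {j p : ℕ}
    (h : p < heightAt w j) : (rowsOf w f j)[p]? = some (f (j, p)) := by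
  simp [rowsOf, h]

theorem follows_rowsOf {w : List (Slice Unit)} {m : ℕ} (hw : heightRun w 0 = some m)
    (f : ℕ × ℕ → K)
    (hf : ∀ x y, Joined w x y → IsPoint w x → IsPoint w y → f x = f y)
    (hτ : ∀ x k, HasTieEnd w x k → τ k (f x)) : Follows τ w (rowsOf w f) := by
  intro j l hl
  have hstep := heightStep_heightAt hw hl
  have key : ∀ j p j' p', Joined w (j, p) (j', p') → p < heightAt w j → p' < heightAt w j' →
      (rowsOf w f j)[p]? = (rowsOf w f j')[p']? := by
    intro j p j' p' h h1 h2
    rw [getElem?_rowsOf f h1, getElem?_rowsOf f h2,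
      hf _ _ h ((isPoint_iff _ _).mpr h1) ((isPoint_iff _ _).mpr h2)]
  apply next_of_getElem
  · simpa only [length_rowsOf] using hstep
  · intro p q hpq h1 h2
    rw [length_rowsOf] at h1 h2
    exact key _ _ _ _ (.through j p q l hl hpq) h1 h2
  · rintro d i rfl
    simp only [heightStep] at hstep
    split_ifs at hstep with hi
    simp only [Option.some.injEq] at hstep
    exact key _ _ _ _ (.cup j i d hl) (by omega) (by omega)
  · rintro i rfl
    simp only [heightStep] at hstep
    split_ifs at hstep with hi
    exact key _ _ _ _ (.cap j i hl) (by omega) (by omega)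
  · rintro i k rfl
    simp only [heightStep] at hstep
    split_ifs at hstep with hi
    exact ⟨f (j, i), getElem?_rowsOf f hi, hτ (j, i) k hl⟩

/-! ### Tied components -/

/-- Each tie prescribes one label for all its ends, so labels are constant along both kinds of
generators of the equivalence relation. -/
theorem follows_tiedTogether {g : ℕ → K} {w : List (Slice δ)} {F : ℕ → List K}
    (hF : Follows (fun k a => a = g k) w F) {x y : ℕ × ℕ} (h : TiedTogether w x y) :
    (F x.1)[x.2]? = (F y.1)[y.2]? := by
  induction h with
  | rel x y h =>
    rcases h with h | ⟨k, hx, hy⟩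
    · exact follows_joined hF h
    · obtain ⟨a, h1, h2⟩ := follows_tieEnd hF hx
      obtain ⟨b, h3, h4⟩ := follows_tieEnd hF hy
      rw [h1, h3, h2, h4]
  | refl x => rfl
  | symm x y _ ih => exact ih.symm
  | trans x y z _ _ h1 h2 => exact h1.trans h2

/-- All components are tied together if and only if there are only constant labellings. -/
theorem allTied_iff (D : TiedDiagram Unit) :
    D.AllTied ↔ ∀ (g : ℕ → Prop) (F : ℕ → List Prop), F 0 = [] →
      Follows (fun k a => a = g k) D.word F →
      ∀ j j', j ≤ D.word.length → j' ≤ D.word.length → ∀ a ∈ F j, ∀ b ∈ F j', a = b := by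
  have hw := (closed_iff _).mp D.closed
  constructor
  · intro h g F h0 hF j j' hj hj' a ha b hb
    have hlen : ∀ j ≤ D.word.length, (F j).length = heightAt D.word j := by
      intro j hj
      have h1 : Follows (fun k a => a = g k) (D.word.take j) F := by
        have : Follows (fun k a => a = g k) (D.word.take j ++ D.word.drop j) F := by simpa using hF
        exact (follows_append.mp this).1
      have := follows_heightRun h1
      rw [h0, List.length_take, min_eq_left hj] at this
      simp only [List.length_nil] at this
      simp [heightAt, this]
    obtain ⟨p, hp, rfl⟩ := List.mem_iff_getElem.mp ha
    obtain ⟨q, hq, rfl⟩ := List.mem_iff_getElem.mp hb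
    have := follows_tiedTogether hF (h (j, p) (j', q)
      ((isPoint_iff _ _).mpr (by rw [← hlen j hj]; exact hp))
      ((isPoint_iff _ _).mpr (by rw [← hlen j' hj']; exact hq)))
    simpa [hp, hq] using this
  · intro h x y hx hy
    have hj : ∀ x : ℕ × ℕ, IsPoint D.word x → x.1 ≤ D.word.length := by
      intro x hx
      by_contra hlt
      rw [isPoint_iff, heightAt, List.take_of_length_le (by omega), hw] at hx
      simp at hx
    -- The indicator of the class of x is a labelling, and a tie receives the value true if one of
    -- its ends lies in this class. Constancy then puts y into the class of x.
    let f : ℕ × ℕ → Prop := TiedTogether D.word x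
    have hf : ∀ y z, TiedTogether D.word y z → f y = f z := fun y z hyz =>
      propext ⟨fun h => h.trans _ _ _ hyz, fun h => h.trans _ _ _ (hyz.symm _ _)⟩
    have hF : Follows (fun k a => a = ∃ y, HasTieEnd D.word y k ∧ f y) D.word
        (rowsOf D.word f) := by
      refine follows_rowsOf hw f (fun y z hyz _ _ => hf y z (.rel _ _ (.inl hyz))) ?_
      intro y k hy
      refine propext ⟨fun h => ⟨y, hy, h⟩, ?_⟩
      rintro ⟨z, hz, h⟩
      rwa [hf y z (.rel _ _ (.inr ⟨k, hy, hz⟩))]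
    have := h _ _ (by simp [rowsOf, heightAt, heightRun]) hF x.1 y.1 (hj x hx) (hj y hy)
      (f x) (List.mem_of_getElem? (getElem?_rowsOf f ((isPoint_iff _ _).mp hx)))
      (f y) (List.mem_of_getElem? (getElem?_rowsOf f ((isPoint_iff _ _).mp hy)))
    exact this.mp (.refl x)

end
end TiedLink

/-! ### The number of labellings of a closed diagram when crossings and ties are ignored. -/

namespace TiedLink
open Piece Slice Direction

/-! ### Counting labellings -/

section
variable {K : Type}

/-- Here a crossing only transposes labels and multiplies by a weight. Constant weight 1 serves to
count labellings; other weights describe the terms into which the coloured model is expanded. -/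
def swapOp (ω : Bool → K → K → ℤ) (o : Bool) : Op K where
  toFun φ s := match s with
    | a :: b :: s => ω o a b * φ (b :: a :: s)
    | _ => 0
  map_add' φ ψ := by
    funext s; rcases s with _ | ⟨a, _ | ⟨b, s⟩⟩ <;> simp; ring
  map_smul' c φ := by
    funext s; rcases s with _ | ⟨a, _ | ⟨b, s⟩⟩ <;> simp; ring

/-- The weight may look at the labels to the right of the strand. This allows a tie end to test
whether two neighbouring strands have equal colours. -/
def weightOp (τ : ℕ → K → List K → ℤ) (k : ℕ) : Op K where
  toFun φ s := match s with
    | a :: s => τ k a s * φ (a :: s)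
    | [] => 0
  map_add' φ ψ := by
    funext s; rcases s with _ | ⟨a, s⟩ <;> simp; ring
  map_smul' c φ := by
    funext s; rcases s with _ | ⟨a, s⟩ <;> simp; ring

theorem swapOp_cons (ω : Bool → K → K → ℤ) (o : Bool) (φ : List K → ℂ) (a b : K)
    (s : List K) : swapOp ω o φ (a :: b :: s) = ω o a b * φ (b :: a :: s) := rfl

theorem swapOp_nil (ω : Bool → K → K → ℤ) (o : Bool) (φ : List K → ℂ) :
    swapOp ω o φ [] = 0 := rfl

theorem swapOp_single (ω : Bool → K → K → ℤ) (o : Bool) (φ : List K → ℂ) (a : K) :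
    swapOp ω o φ [a] = 0 := rfl

theorem weightOp_cons (τ : ℕ → K → List K → ℤ) (k : ℕ) (φ : List K → ℂ) (a : K)
    (s : List K) : weightOp τ k φ (a :: s) = τ k a s * φ (a :: s) := rfl

theorem weightOp_nil (τ : ℕ → K → List K → ℤ) (k : ℕ) (φ : List K → ℂ) :
    weightOp τ k φ [] = 0 := rfl

theorem not_next_shift_nil {δ : Type} {τ : ℕ → K → Prop} {l : Slice δ} {s' : List K} :
    ¬ Next τ l.shift [] s' := by
  rcases l with ⟨e | _ | o, i⟩ | ⟨i, k⟩
  · rintro ⟨p, r, a, h1, h2, h3⟩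
    cases p <;> simp at h1 h2
  · rintro ⟨p, r, a, h1, h2, h3⟩
    simp at h2
  · rintro ⟨p, r, a, b, h1, h2, h3⟩
    simp at h2
  · rintro ⟨h1, a, h2, h3⟩
    simp at h2

theorem next_shift_iff {δ : Type} {τ : ℕ → K → Prop} {l : Slice δ} {x : K} {s s' : List K} :
    Next τ l.shift (x :: s) s' ↔ ∃ s'', s' = x :: s'' ∧ Next τ l s s'' := by
  refine ⟨fun h => ?_, ?_⟩
  · rcases l with ⟨e | _ | o, i⟩ | ⟨i, k⟩
    · obtain ⟨_ | ⟨y, p⟩, r, a, h1, h2, h3⟩ := h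
      · simp at h1
      · simp at h1 h2
        exact ⟨p ++ a :: a :: r, by simp [h3, h2.1], p, r, a, h1, h2.2, rfl⟩
    · obtain ⟨_ | ⟨y, p⟩, r, a, h1, h2, h3⟩ := h
      · simp at h1
      · simp at h1 h2
        exact ⟨p ++ r, by simp [h3, h2.1], p, r, a, h1, h2.2, rfl⟩
    · obtain ⟨_ | ⟨y, p⟩, r, a, b, h1, h2, h3⟩ := h
      · simp at h1
      · simp at h1 h2
        exact ⟨p ++ b :: a :: r, by simp [h3, h2.1], p, r, a, b, h1, h2.2, rfl⟩
    · obtain ⟨rfl, a, h1, h2⟩ := h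
      exact ⟨s, rfl, rfl, a, by simpa using h1, h2⟩
  · rintro ⟨s'', rfl, h⟩
    exact next_shift x h

variable [Fintype K] [DecidableEq K]

/-- The operator of a word when crossings and ties are ignored. -/
noncomputable def countOp (w : List (Slice Unit)) : Op K :=
  wordOp (swapOp fun _ _ _ => 1) (weightOp fun _ _ _ => 1) w

/-- With weights 1 an operator sums over the finitely many rows that can follow; iterating this,
`countOp` counts labellings. -/
theorem exists_successors (l : Slice Unit) (s : List K) :
    ∃ t : Finset (List K), (∀ s', s' ∈ t ↔ Next (fun _ _ => True) l s s') ∧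
      ∀ φ, sliceOp (swapOp fun _ _ _ => 1) (weightOp fun _ _ _ => 1) l φ s = ∑ s' ∈ t, φ s' := by
  have step : ∀ l : Slice Unit, (∀ s : List K, ∃ t : Finset (List K),
      (∀ s', s' ∈ t ↔ Next (fun _ _ => True) l s s') ∧
      ∀ φ, sliceOp (swapOp fun _ _ _ => 1) (weightOp fun _ _ _ => 1) l φ s = ∑ s' ∈ t, φ s') →
      ∀ s : List K, ∃ t : Finset (List K),
      (∀ s', s' ∈ t ↔ Next (fun _ _ => True) l.shift s s') ∧
      ∀ φ, sliceOp (swapOp fun _ _ _ => 1) (weightOp fun _ _ _ => 1) l.shift φ s =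
        ∑ s' ∈ t, φ s' := by
    intro l hl s
    rcases s with _ | ⟨x, s⟩
    · refine ⟨∅, fun s' => by simp [not_next_shift_nil], fun φ => ?_⟩
      rw [sliceOp_shift]; rfl
    · obtain ⟨t, h1, h2⟩ := hl s
      refine ⟨t.image (x :: ·), fun s' => ?_, fun φ => ?_⟩
      · simp only [Finset.mem_image, h1, next_shift_iff]
        constructor
        · rintro ⟨a, h, rfl⟩; exact ⟨a, rfl, h⟩
        · rintro ⟨a, rfl, h⟩; exact ⟨a, h, rfl⟩
      · rw [sliceOp_shift, shiftOp_cons, h2, Finset.sum_image (by simp)]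
  rcases l with ⟨e | _ | o, i⟩ | ⟨i, k⟩
  · induction i generalizing s with
    | succ i ih => exact step (piece (cup e) i) ih s
    | zero =>
      refine ⟨Finset.univ.image fun a => a :: a :: s, fun s' => ?_, fun φ => ?_⟩
      · simp [Next, eq_comm]
      · rw [Finset.sum_image fun a _ b _ h => by simpa using h]; rfl
  · induction i generalizing s with
    | succ i ih => exact step (piece cap i) ih s
    | zero =>
      rcases s with _ | ⟨a, _ | ⟨b, s⟩⟩
      · exact ⟨∅, by simp [Next], fun φ => rfl⟩
      · exact ⟨∅, by simp [Next], fun φ => rfl⟩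
      · by_cases h : a = b
        · subst h
          exact ⟨{s}, by simp [Next, eq_comm], fun φ => by simp [sliceOp, capOp_cons]⟩
        · exact ⟨∅, by simp [Next, Ne.symm h], fun φ => by simp [sliceOp, capOp_cons, h]⟩
  · induction i generalizing s with
    | succ i ih => exact step (piece (cross o) i) ih s
    | zero =>
      rcases s with _ | ⟨a, _ | ⟨b, s⟩⟩
      · exact ⟨∅, by simp [Next], fun φ => rfl⟩
      · exact ⟨∅, by simp [Next], fun φ => rfl⟩
      · refine ⟨{b :: a :: s}, fun s' => ?_, fun φ => by simp [sliceOp, swapOp_cons]⟩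
        simp only [Finset.mem_singleton, Next, List.length_eq_zero_iff]
        constructor
        · rintro rfl; exact ⟨[], s, a, b, rfl, rfl, rfl⟩
        · rintro ⟨p, r, a', b', rfl, h1, rfl⟩
          simp at h1; simp [h1]
  · induction i generalizing s with
    | succ i ih => exact step (tieEnd i k) ih s
    | zero =>
      rcases s with _ | ⟨a, s⟩
      · exact ⟨∅, by simp [Next], fun φ => rfl⟩
      · exact ⟨{a :: s}, by simp [Next], fun φ => by simp [sliceOp, weightOp_cons]⟩

/-- Labellings of a word above a given row. -/
def Labelling (w : List (Slice Unit)) (s : List K) : Type :=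
  -- Rows beyond the top are fixed to be empty, so that a labelling is determined by finitely many
  -- rows.
  {F : ℕ → List K // F 0 = s ∧ Follows (fun _ _ => True) w F ∧ ∀ j, w.length < j → F j = []}

def labellingCons (l : Slice Unit) (w : List (Slice Unit)) (s : List K) :
    Labelling (l :: w) s ≃ (s' : {s' // Next (fun _ _ => True) l s s'}) × Labelling w s'.1 where
  toFun F := ⟨⟨F.1 1, by have := (follows_cons.mp F.2.2.1).1; rwa [F.2.1] at this⟩,
    ⟨fun j => F.1 (j + 1), rfl, (follows_cons.mp F.2.2.1).2,
      fun j hj => F.2.2.2 (j + 1) (by simpa using hj)⟩⟩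
  invFun G := ⟨fun j => Nat.casesOn j s G.2.1, rfl,
    follows_cons_mk (by rw [G.2.2.1]; exact G.1.2) G.2.2.2.1, fun j hj => by
      rcases j with _ | j
      · simp at hj
      · exact G.2.2.2.2 j (by simpa using hj)⟩
  left_inv F := by
    apply Subtype.ext
    funext j
    rcases j with _ | j
    · exact F.2.1.symm
    · rfl
  right_inv := by
    rintro ⟨⟨s', hs⟩, ⟨G, h1, h2⟩⟩
    change G 0 = s' at h1
    subst h1
    rfl

theorem card_labelling (w : List (Slice Unit)) (s : List K) :
    Finite (Labelling w s) ∧ countOp w (fun _ => 1) s = Nat.card (Labelling w s) := by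
  induction w generalizing s with
  | nil =>
    have : Unique (Labelling ([] : List (Slice Unit)) s) :=
      { default := ⟨fun j => Nat.casesOn j s fun _ => [], rfl, follows_nil _, fun j hj => by
          rcases j with _ | j
          · simp at hj
          · rfl⟩
        uniq := by
          rintro ⟨F, h1, h2, h3⟩
          apply Subtype.ext
          funext j
          rcases j with _ | j
          · exact h1
          · exact h3 _ (by simp) }
    exact ⟨inferInstance, by simp [countOp, wordOp_nil]⟩
  | cons l w ih =>
    obtain ⟨t, h1, h2⟩ := exists_successors l s
    have e : {s' // Next (fun _ _ => True) l s s'} ≃ t :=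
      Equiv.subtypeEquivRight fun s' => (h1 s').symm
    have : Fintype {s' // Next (fun _ _ => True) l s s'} := Fintype.ofEquiv _ e.symm
    have hfin : ∀ s', Finite (Labelling w s') := fun s' => (ih s').1
    refine ⟨Finite.of_equiv _ (labellingCons l w s).symm, ?_⟩
    rw [Nat.card_congr (labellingCons l w s), Nat.card_sigma]
    rw [countOp, wordOp_cons_apply, h2, Nat.cast_sum]
    rw [← Finset.sum_coe_sort t]
    symm
    exact Fintype.sum_equiv (Equiv.subtypeEquivRight fun s' => (h1 s').symm) _ _
      fun s' => ((ih s'.1).2).symm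

theorem heightAt_of_length_lt {w : List (Slice Unit)} (hw : heightRun w 0 = some 0) {j : ℕ}
    (hj : w.length ≤ j) : heightAt w j = 0 := by
  rw [heightAt, List.take_of_length_le hj, hw]; rfl

theorem finite_points {w : List (Slice Unit)} (hw : heightRun w 0 = some 0) :
    Finite {x // IsPoint w x} := by
  have h : ∀ x : {x // IsPoint w x}, x.1.1 < w.length := by
    intro x
    by_contra hx
    have := (isPoint_iff _ _).mp x.2
    rw [heightAt_of_length_lt hw (by omega)] at this
    omega
  refine Finite.of_injective
    (fun x => (⟨⟨x.1.1, h x⟩, ⟨x.1.2, (isPoint_iff _ _).mp x.2⟩⟩ :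
      (j : Fin w.length) × Fin (heightAt w j))) ?_
  rintro ⟨⟨j, p⟩, hx⟩ ⟨⟨j', p'⟩, hy⟩ hxy
  simp only [Sigma.mk.injEq, Fin.mk.injEq] at hxy
  obtain ⟨rfl, h2⟩ := hxy
  simpa using h2

theorem length_follows {τ : ℕ → K → Prop} {w : List (Slice Unit)} {F : ℕ → List K}
    (h0 : F 0 = []) (hF : Follows τ w F) {j : ℕ} (hj : j ≤ w.length) :
    (F j).length = heightAt w j := by
  have h1 : Follows τ (w.take j ++ w.drop j) F := by simpa using hF
  have := follows_heightRun (follows_append.mp h1).1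
  rw [h0, List.length_take, min_eq_left hj] at this
  simp only [List.length_nil] at this
  simp [heightAt, this]

/-- A labelling is constant along arcs, hence the same thing as a function on the set of components.
-/
theorem card_labelling_closed [Nonempty K] {w : List (Slice Unit)}
    (hw : heightRun w 0 = some 0) :
    Nat.card (Labelling (K := K) w []) = Nat.card K ^ componentCount w := by
  classical
  have := finite_points hw
  let Q := Quot fun x y : {x // IsPoint w x} => Joined w x.1 y.1
  have : Finite Q := Finite.of_surjective _ Quot.mk_surjective
  rw [componentCount, ← Nat.card_fun]
  symm
  -- The value away from the diagram is irrelevant, since rows contain points only.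
  let ext (h : Q → K) (x : ℕ × ℕ) : K :=
    if hx : IsPoint w x then h (Quot.mk _ ⟨x, hx⟩) else Classical.arbitrary K
  have hext : ∀ h x (hx : IsPoint w x), ext h x = h (Quot.mk _ ⟨x, hx⟩) := fun h x hx => dif_pos hx
  let G (h : Q → K) : Labelling (K := K) w [] := ⟨rowsOf w (ext h), by
      simp [rowsOf, heightAt, heightRun], by
      refine follows_rowsOf hw _ (fun x y hxy hx hy => ?_) fun _ _ _ => trivial
      rw [hext h x hx, hext h y hy]
      exact congrArg h (Quot.sound hxy), fun j hj => by
      simp [rowsOf, heightAt_of_length_lt hw hj.le]⟩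
  refine Nat.card_congr (Equiv.ofBijective G ⟨?_, ?_⟩)
  · intro h h' hh
    funext q
    obtain ⟨⟨x, hx⟩, rfl⟩ := Quot.exists_rep q
    have h1 := congrArg (fun F : Labelling (K := K) w [] => (F.1 x.1)[x.2]?) hh
    simp only [G, getElem?_rowsOf _ ((isPoint_iff _ _).mp hx), Option.some.injEq] at h1
    rwa [hext h x hx, hext h' x hx] at h1
  · rintro ⟨F, h0, hF, hlast⟩
    have hlen : ∀ j, (F j).length = heightAt w j := by
      intro j
      rcases le_or_gt j w.length with hj | hj
      · exact length_follows h0 hF hj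
      · rw [hlast j hj, heightAt_of_length_lt hw hj.le]; rfl
    let f (x : {x // IsPoint w x}) : K := (F x.1.1)[x.1.2]'(by
      rw [hlen]; exact (isPoint_iff _ _).mp x.2)
    have hf : ∀ x : {x // IsPoint w x}, (F x.1.1)[x.1.2]? = some (f x) := fun x => by simp [f]
    refine ⟨Quot.lift f fun x y hxy => ?_, ?_⟩
    · have := follows_joined hF hxy
      rw [hf x, hf y] at this
      simpa using this
    · apply Subtype.ext
      funext j
      apply List.ext_getElem?
      intro p
      simp only [G]
      rcases lt_or_ge p (heightAt w j) with hp | hp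
      · have hx := (isPoint_iff w (j, p)).mpr hp
        rw [getElem?_rowsOf _ hp, hext _ _ hx, hf ⟨(j, p), hx⟩]
      · rw [List.getElem?_eq_none (by rwa [length_rowsOf]),
          List.getElem?_eq_none (by rwa [hlen])]

theorem countOp_closed [Nonempty K] {w : List (Slice Unit)} (hw : heightRun w 0 = some 0) :
    countOp w (fun _ : List K => 1) [] = (Fintype.card K : ℂ) ^ componentCount w := by
  rw [(card_labelling w []).2, card_labelling_closed hw]
  simp

theorem exists_cup_of_closed {w : List (Slice Unit)} (h0 : w ≠ [])
    (hw : heightRun w 0 = some 0) : ∃ d v, w = piece (cup d) 0 :: v := by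
  rcases w with _ | ⟨⟨e | _ | o, i⟩ | ⟨i, k⟩, v⟩
  · exact absurd rfl h0
  · by_cases hi : i = 0
    · exact ⟨e, v, by rw [hi]⟩
    · simp [heightRun, heightStep, hi] at hw
  all_goals simp [heightRun, heightStep] at hw

/-- This makes the truncated exponent `componentCount - 1` of the state sum a true difference. -/
theorem componentCount_pos {w : List (Slice Unit)} (h0 : w ≠ []) (hw : heightRun w 0 = some 0) :
    0 < componentCount w := by
  obtain ⟨d, v, rfl⟩ := exists_cup_of_closed h0 hw
  have := finite_points hw
  have : Finite (Quot fun x y : {x // IsPoint (piece (cup d) 0 :: v) x} =>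
    Joined (piece (cup d) 0 :: v) x.1 y.1) := Finite.of_surjective _ Quot.mk_surjective
  have hx : IsPoint (piece (cup d) 0 :: v) (1, 0) := by
    rw [isPoint_iff]; simp [heightAt, heightRun, heightStep]
  have : Nonempty (Quot fun x y : {x // IsPoint (piece (cup d) 0 :: v) x} =>
    Joined (piece (cup d) 0 :: v) x.1 y.1) := ⟨Quot.mk _ ⟨_, hx⟩⟩
  exact Nat.card_pos

end
end TiedLink

/-! ### Invariance of the coloured state sum under regular isotopy. -/

namespace TiedLink
open Piece Slice Direction

/-! ### The coloured state sum -/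

section
variable {C S : Type} [Fintype C] [LinearOrder C] [Fintype S] [DecidableEq S]

/-- The operator of a tied word, where `g` gives the colours of the ties. -/
noncomputable def bracketOp (S : Type) [Fintype S] [DecidableEq S] (α : ℂ) (g : ℕ → C)
    (w : List (Slice Unit)) : Op (C × S) :=
  wordOp (crossOp α) (fun k => tieOp S (g k)) w

/-- Smoothings occur only between equal colours and keep that colour, so colours are carried along
the strands of the original diagram although spins are not. Only rows with compatible colours enter
the value. -/
theorem bracketSlice_congr (α : ℂ) (g : ℕ → C) (l : Slice Unit) {φ ψ : List (C × S) → ℂ}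
    {s : List (C × S)} (h : ∀ s' : List (C × S),
      Next (fun k a => a = g k) l (s.map Prod.fst) (s'.map Prod.fst) → φ s' = ψ s') :
    sliceOp (crossOp α) (fun k => tieOp S (g k)) l φ s =
      sliceOp (crossOp α) (fun k => tieOp S (g k)) l ψ s := by
  have step : ∀ l : Slice Unit, (∀ (φ ψ : List (C × S) → ℂ) (s : List (C × S)),
      (∀ s' : List (C × S),
        Next (fun k a => a = g k) l (s.map Prod.fst) (s'.map Prod.fst) → φ s' = ψ s') →
      sliceOp (crossOp α) (fun k => tieOp S (g k)) l φ s =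
        sliceOp (crossOp α) (fun k => tieOp S (g k)) l ψ s) →
      ∀ (φ ψ : List (C × S) → ℂ) (s : List (C × S)), (∀ s' : List (C × S),
        Next (fun k a => a = g k) l.shift (s.map Prod.fst) (s'.map Prod.fst) → φ s' = ψ s') →
      sliceOp (crossOp α) (fun k => tieOp S (g k)) l.shift φ s =
        sliceOp (crossOp α) (fun k => tieOp S (g k)) l.shift ψ s := by
    intro l hl φ ψ s h
    rw [sliceOp_shift]
    rcases s with _ | ⟨x, s⟩
    · rfl
    · rw [shiftOp_cons, shiftOp_cons]
      exact hl _ _ _ fun s' hs' => h (x :: s') (next_shift _ hs')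
  rcases l with ⟨e | _ | o, i⟩ | ⟨i, k⟩
  · induction i generalizing φ ψ s with
    | succ i ih => exact step (piece (cup e) i) (fun _ _ _ h => ih h) _ _ _ h
    | zero => exact Finset.sum_congr rfl fun a _ => h _ ⟨[], s.map Prod.fst, a.1, rfl, rfl, rfl⟩
  · induction i generalizing φ ψ s with
    | succ i ih => exact step (piece cap i) (fun _ _ _ h => ih h) _ _ _ h
    | zero =>
      rcases s with _ | ⟨a, _ | ⟨b, s⟩⟩
      · rfl
      · rfl
      · simp only [sliceOp, Function.iterate_zero, id, capOp_cons]
        split_ifs with hab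
        · subst hab
          exact h _ ⟨[], s.map Prod.fst, a.1, rfl, rfl, rfl⟩
        · rfl
  · induction i generalizing φ ψ s with
    | succ i ih => exact step (piece (cross o) i) (fun _ _ _ h => ih h) _ _ _ h
    | zero =>
      rcases s with _ | ⟨⟨a, x⟩, _ | ⟨⟨b, y⟩, s⟩⟩
      · rfl
      · rfl
      · have h' : ∀ s', s'.map Prod.fst = b :: a :: s.map Prod.fst → φ s' = ψ s' :=
          fun s' hs' => h s' ⟨[], s.map Prod.fst, a, b, rfl, rfl, hs'⟩
        simp only [sliceOp, Function.iterate_zero, id, crossOp_cons]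
        by_cases hab : a = b
        · subst hab
          simp only [if_true]
          rw [h' _ rfl]
          simp_rw [h' _ (show ((a, _) :: (a, _) :: s).map Prod.fst = _ from rfl)]
        · simp only [hab, if_false]
          rw [h' _ rfl]
  · induction i generalizing φ ψ s with
    | succ i ih => exact step (tieEnd i k) (fun _ _ _ h => ih h) _ _ _ h
    | zero =>
      rcases s with _ | ⟨a, s⟩
      · rfl
      · simp only [sliceOp, Function.iterate_zero, id, tieOp_cons]
        split_ifs with ha
        · exact h _ ⟨rfl, a.1, rfl, ha⟩
        · rfl

theorem bracketOp_congr (α : ℂ) (g : ℕ → C) (u : List (Slice Unit)) {φ ψ : List (C × S) → ℂ}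
    {s : List (C × S)} (h : ∀ F, Follows (fun k a => a = g k) u F → F 0 = s.map Prod.fst →
      ∀ s' : List (C × S), s'.map Prod.fst = F u.length → φ s' = ψ s') :
    bracketOp S α g u φ s = bracketOp S α g u ψ s := by
  induction u generalizing s with
  | nil => exact h (fun _ => s.map Prod.fst) (follows_nil _) rfl s rfl
  | cons l u ih =>
    rw [bracketOp, wordOp_cons_apply, wordOp_cons_apply]
    refine bracketSlice_congr α g l fun s' hs' => ih fun F hF h0 s'' hs'' => ?_
    refine h (fun j => Nat.casesOn j (s.map Prod.fst) F) ?_ rfl s'' hs''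
    exact follows_cons_mk (by rwa [h0]) hF

theorem bracketOp_congr_length (α : ℂ) (g : ℕ → C) (u : List (Slice Unit))
    {φ ψ : List (C × S) → ℂ} {s : List (C × S)}
    (h : ∀ s' : List (C × S), heightRun u s.length = some s'.length → φ s' = ψ s') :
    bracketOp S α g u φ s = bracketOp S α g u ψ s := by
  refine bracketOp_congr α g u fun F hF h0 s' hs' => h s' ?_
  have h1 := follows_heightRun hF
  rw [h0, ← hs'] at h1
  simpa using h1

/-- Without a consistent colouring the function at the top may be replaced by 0. -/
theorem bracketOp_ne_zero {α : ℂ} {g : ℕ → C} {v : List (Slice Unit)} {φ : List (C × S) → ℂ}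
    {s : List (C × S)} (h : bracketOp S α g v φ s ≠ 0) :
    ∃ F, Follows (fun k a => a = g k) v F ∧ F 0 = s.map Prod.fst := by
  by_contra hF
  push Not at hF
  apply h
  rw [bracketOp_congr α g v (ψ := 0) fun F h1 h2 => absurd h2 (hF F h1), map_zero]
  rfl

theorem bracketOp_append (α : ℂ) (g : ℕ → C) (u v : List (Slice Unit))
    (φ : List (C × S) → ℂ) :
    bracketOp S α g (u ++ v) φ = bracketOp S α g u (bracketOp S α g v φ) :=
  wordOp_append_apply _ _ _ _ _

theorem bracketOp_cons (α : ℂ) (g : ℕ → C) (l : Slice Unit) (v : List (Slice Unit))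
    (φ : List (C × S) → ℂ) :
    bracketOp S α g (l :: v) φ = bracketOp S α g [l] (bracketOp S α g v φ) :=
  bracketOp_append α g [l] v φ

theorem bracketOp_pair (α : ℂ) (g : ℕ → C) (l l' : Slice Unit) : bracketOp S α g [l, l'] =
    sliceOp (crossOp α) (fun k => tieOp S (g k)) l *
      sliceOp (crossOp α) (fun k => tieOp S (g k)) l' := by simp [bracketOp, wordOp]

theorem bracketOp_triple (α : ℂ) (g : ℕ → C) (l l' l'' : Slice Unit) :
    bracketOp S α g [l, l', l''] =
    sliceOp (crossOp α) (fun k => tieOp S (g k)) l *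
      sliceOp (crossOp α) (fun k => tieOp S (g k)) l' *
      sliceOp (crossOp α) (fun k => tieOp S (g k)) l'' := by simp [bracketOp, wordOp, mul_assoc]

theorem bracketOp_planarMove (α : ℂ) (g : ℕ → C) {m m' : List (Slice Unit)}
    (h : PlanarMove m m') {φ : List (C × S) → ℂ} {s : List (C × S)}
    (hm : (heightRun m s.length).isSome) : bracketOp S α g m φ s = bracketOp S α g m' φ s := by
  cases h with
  | exchange e f i k =>
    rw [bracketOp_pair, bracketOp_pair]
    refine congrFun (LinearMap.congr_fun ?_ φ) s
    obtain ⟨P, hP⟩ : ∃ P : Op (C × S), ∀ j,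
        sliceOp (crossOp α) (fun k => tieOp S (g k)) (piece f j) = shiftOp^[j] P := by
      rcases f with d | _ | o <;> exact ⟨_, fun _ => rfl⟩
    have hshift : ∀ j, shiftOp^[i + 2 + j] P = shiftOp^[i] (shiftOp (shiftOp (shiftOp^[j] P))) := by
      intro j
      rw [show i + 2 + j = i + (j + 1 + 1) by omega, Function.iterate_add_apply _ i,
        Function.iterate_succ_apply', Function.iterate_succ_apply']
    have hshift' : ∀ j, shiftOp^[i + 0 + j] P = shiftOp^[i] (shiftOp^[j] P) :=
      fun j => Function.iterate_add_apply _ i j P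
    rw [hP, hP]
    rcases e with d | _ | o <;> simp only [sliceOp, Piece.ins, Piece.outs, hshift, hshift'] <;>
      rw [← shiftOp_iterate_mul, ← shiftOp_iterate_mul]
    · rw [cupOp_comm]
    · rw [capOp_comm]
    · rw [crossOp_comm]
  | zigzag d i =>
    have hs : i + 1 ≤ s.length := by
      simp only [heightRun, heightStep] at hm
      split_ifs at hm with h1
      · exact h1
      · simp at hm
    rw [bracketOp_pair]
    simp only [sliceOp]
    rw [Function.iterate_succ_apply, ← shiftOp_iterate_mul,
      shiftOp_iterate_congr (fun φ s hs => zigzagOp φ s hs) i φ s hs,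
      shiftOp_iterate_one i φ s (by omega)]
    rfl
  | zagzig d i =>
    have hs : i + 1 ≤ s.length := by
      simp only [heightRun, heightStep] at hm
      split_ifs at hm with h1
      · simp at hm
        omega
      · simp at hm
    rw [bracketOp_pair]
    simp only [sliceOp]
    rw [Function.iterate_succ_apply, ← shiftOp_iterate_mul,
      shiftOp_iterate_congr (fun φ s hs => zagzigOp φ s hs) i φ s hs,
      shiftOp_iterate_one i φ s (by omega)]
    rfl
  | slideCup d o i =>
    rw [bracketOp_pair, bracketOp_pair]
    simp only [sliceOp]
    rw [Function.iterate_succ_apply, Function.iterate_succ_apply, ← shiftOp_iterate_mul,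
      ← shiftOp_iterate_mul, slideCupOp]
  | slideCap o i =>
    rw [bracketOp_pair, bracketOp_pair]
    simp only [sliceOp]
    rw [Function.iterate_succ_apply, Function.iterate_succ_apply, ← shiftOp_iterate_mul,
      ← shiftOp_iterate_mul, slideCapOp]

/-- Local identities are needed only on rows on which `m` fits, and the rows reached above `u` are
of this kind because the whole word runs. -/
theorem bracketOp_context (α : ℂ) (g : ℕ → C) {u m m' v : List (Slice Unit)} {n : ℕ}
    (hw : heightRun (u ++ m ++ v) 0 = some n)
    (h : ∀ (φ : List (C × S) → ℂ) (s : List (C × S)), (heightRun m s.length).isSome →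
      bracketOp S α g m φ s = bracketOp S α g m' φ s) (φ : List (C × S) → ℂ) :
    bracketOp S α g (u ++ m ++ v) φ [] = bracketOp S α g (u ++ m' ++ v) φ [] := by
  rw [List.append_assoc] at hw ⊢
  rw [List.append_assoc]
  simp only [bracketOp_append]
  refine bracketOp_congr_length α g u fun s' hs' => h _ _ ?_
  obtain ⟨k, h1, h2⟩ := heightRun_append_eq hw
  simp only [List.length_nil] at hs'
  rw [hs', Option.some.injEq] at h1
  rw [h1]
  obtain ⟨k', h3, -⟩ := heightRun_append_eq h2
  simp [h3]

/-- Strands on the right of a tangle do not matter. -/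
theorem bracketOp_append_right (α : ℂ) (g : ℕ → C) (w : List (Slice Unit))
    (φ : List (C × S) → ℂ) (s r : List (C × S)) (hw : (heightRun w s.length).isSome) :
    bracketOp S α g w φ (s ++ r) = bracketOp S α g w (fun t => φ (t ++ r)) s := by
  have slice : ∀ (l : Slice Unit) (φ : List (C × S) → ℂ) (s : List (C × S)),
      (heightStep l s.length).isSome →
      sliceOp (crossOp α) (fun k => tieOp S (g k)) l φ (s ++ r) =
      sliceOp (crossOp α) (fun k => tieOp S (g k)) l (fun t => φ (t ++ r)) s := by
    have step : ∀ (i : ℕ) (L : Op (C × S)) (b : ℕ),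
        (∀ (φ : List (C × S) → ℂ) (s : List (C × S)), b ≤ s.length →
          L φ (s ++ r) = L (fun t => φ (t ++ r)) s) →
        ∀ (φ : List (C × S) → ℂ) (s : List (C × S)), i + b ≤ s.length →
          (shiftOp^[i] L) φ (s ++ r) = (shiftOp^[i] L) (fun t => φ (t ++ r)) s := by
      intro i L b hL
      induction i with
      | zero => intro φ s hs; exact hL φ s (by omega)
      | succ i ih =>
        intro φ s hs
        rcases s with _ | ⟨x, s⟩
        · simp at hs
        · rw [Function.iterate_succ_apply', List.cons_append, shiftOp_cons, shiftOp_cons]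
          exact ih _ _ (by simp at hs; omega)
    intro l φ s hl
    rcases l with ⟨e | _ | o, i⟩ | ⟨i, k⟩ <;> simp only [heightStep, Option.isSome_ite] at hl
    · exact step i _ 0 (fun φ s _ => rfl) φ s hl
    · refine step i _ 2 (fun φ s hs => ?_) φ s hl
      rcases s with _ | ⟨a, _ | ⟨b, s⟩⟩ <;> simp at hs
      rfl
    · refine step i _ 2 (fun φ s hs => ?_) φ s hl
      rcases s with _ | ⟨a, _ | ⟨b, s⟩⟩ <;> simp at hs
      rfl
    · refine step i _ 1 (fun φ s hs => ?_) φ s hl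
      rcases s with _ | ⟨a, s⟩ <;> simp at hs
      rfl
  induction w generalizing s with
  | nil => rfl
  | cons l w ih =>
    simp only [heightRun] at hw
    cases hl : heightStep l s.length with
    | none => simp [hl] at hw
    | some n =>
      simp only [hl, Option.bind_some] at hw
      rw [bracketOp, wordOp_cons_apply, wordOp_cons_apply, slice l _ s (by simp [hl])]
      refine bracketSlice_congr α g l fun s' hs' => ih s' ?_
      have h1 := next_heightStep hs'
      simp only [List.length_map] at h1
      rw [hl, Option.some.injEq] at h1
      rwa [← h1]

theorem bracketOp_regularMove {α : ℂ} (hα : α ≠ 0)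
    (hM : α ^ 2 + α ^ (-2 : ℤ) = -(Fintype.card S : ℂ)) (g : ℕ → C) {w w' : List (Slice Unit)}
    (h : RegularMove w w') (hw : heightRun w 0 = some 0) :
    bracketOp S α g w (fun _ => 1) [] = bracketOp S α g w' (fun _ => 1) [] := by
  cases h with
  | planar u v m m' h =>
    exact bracketOp_context α g hw (fun φ s hs => bracketOp_planarMove α g h hs) _
  | two u v m m' h =>
    obtain ⟨o, i⟩ := h
    refine bracketOp_context α g hw (fun φ s hs => ?_) _
    have hi : i + 2 ≤ s.length := by
      simp only [heightRun, heightStep] at hs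
      split_ifs at hs with h1
      · exact h1
      · simp at hs
    rw [bracketOp_pair]
    simp only [sliceOp]
    rw [← shiftOp_iterate_mul,
      shiftOp_iterate_congr (fun φ s hs => reidemeisterTwoOp hα hM o φ s hs) i φ s hi,
      shiftOp_iterate_one i φ s (by omega)]
    rfl
  | three u v m m' h =>
    obtain ⟨a, b, c, i, h⟩ := h
    refine bracketOp_context α g hw (fun φ s hs => ?_) _
    rw [bracketOp_triple, bracketOp_triple]
    simp only [sliceOp]
    rw [Function.iterate_succ_apply, Function.iterate_succ_apply, Function.iterate_succ_apply,
      ← shiftOp_iterate_mul, ← shiftOp_iterate_mul, ← shiftOp_iterate_mul, ← shiftOp_iterate_mul,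
      reidemeisterThreeOp hα hM a b c h]
  | infinity T d h =>
    -- Both closures sum the diagonal matrix entries of the tangle T over the label of the closing
    -- strand, which is a spectator on the left in one case and on the right in the other.
    have hT := heightRun_of_run h
    simp only [List.length_cons, List.length_nil, zero_add] at hT
    have hcup : ∀ (d : Unit) (φ : List (C × S) → ℂ), bracketOp S α g [piece (cup d) 0] φ [] =
        ∑ a, φ [a, a] := by
      intro d φ
      simp [bracketOp, wordOp, sliceOp, cupOp_apply]
    have hcap : ∀ (a b : C × S), bracketOp S α g [piece cap 0] (fun _ => (1 : ℂ)) [a, b] =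
        if a = b then 1 else 0 := by
      intro a b
      simp [bracketOp, wordOp, sliceOp, capOp_cons]
    rw [bracketOp_cons α g (piece (cup d) 0) (T.map Slice.shift ++ [piece cap 0]), hcup,
      bracketOp_cons α g (piece (cup (opp d)) 0) (T ++ [piece cap 0]), hcup]
    refine Finset.sum_congr rfl fun a _ => ?_
    rw [bracketOp_append, bracketOp_append]
    rw [show ([a, a] : List (C × S)) = [a] ++ [a] from rfl, bracketOp_append_right α g T _ _ _
      (by simp [hT])]
    rw [List.singleton_append, bracketOp, wordOp_shift]
    refine bracketOp_congr_length α g T fun s' hs' => ?_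
    simp only [List.length_singleton, hT, Option.some.injEq] at hs'
    obtain ⟨b, rfl⟩ := List.length_eq_one_iff.mp hs'.symm
    rw [List.singleton_append, hcap, hcap]
    simp [eq_comm]

end
end TiedLink

/-! ### The model with one colour, and evaluations that determine Laurent polynomials. -/

namespace TiedLink
open Piece Slice Direction

/-! ### The Kauffman bracket by transfer operators -/

section
variable {C S : Type} [Fintype C] [LinearOrder C] [Fintype S] [DecidableEq S]

theorem bracketOp_length_slice (α : ℂ) (g : ℕ → C) (l : Slice Unit) (v : List (Slice Unit))
    {φ : List (C × S) → ℂ} {ψ : List (C × S) → ℂ} {s : List (C × S)} {n : ℕ}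
    (hl : heightStep l s.length = some n)
    (h : ∀ s' : List (C × S), s'.length = n → bracketOp S α g v φ s' = ψ s') :
    bracketOp S α g (l :: v) φ s = sliceOp (crossOp α) (fun k => tieOp S (g k)) l ψ s := by
  rw [bracketOp, wordOp_cons_apply]
  refine bracketSlice_congr α g l fun s' hs' => h s' ?_
  have := next_heightStep hs'
  simp only [List.length_map] at this
  rw [hl, Option.some.injEq] at this
  exact this.symm

theorem crossOp_of_subsingleton [Subsingleton C] (α : ℂ) (o : Bool) (φ : List (C × S) → ℂ)
    (s : List (C × S)) (hs : 2 ≤ s.length) : crossOp α o φ s =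
      (α ^ eps o • (1 : Op (C × S)) + α ^ (-eps o) • (capOp (C × S) * cupOp (C × S))) φ s := by
  rcases s with _ | ⟨⟨a, x⟩, _ | ⟨⟨b, y⟩, s⟩⟩
  · simp at hs
  · simp at hs
  · obtain rfl := Subsingleton.elim a b
    have : Unique C := { default := a, uniq := fun c => Subsingleton.elim c a }
    obtain rfl := Subsingleton.elim a default
    simp [crossOp_cons, capOp_cons, cupOp_apply, Fintype.sum_prod_type]

theorem tieOp_of_subsingleton [Subsingleton C] (c : C) (φ : List (C × S) → ℂ)
    (s : List (C × S)) (hs : 1 ≤ s.length) : tieOp S c φ s = (1 : Op (C × S)) φ s := by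
  rcases s with _ | ⟨a, s⟩
  · simp at hs
  · simp [tieOp_cons, Subsingleton.elim a.1 c]

theorem heightRun_of_mem_states {w : List (Slice Unit)} {n m : ℕ} (hw : heightRun w n = some m)
    {x : ℤ × List (Slice Unit)} (hx : x ∈ states w) : heightRun x.2 n = some m := by
  induction w generalizing n x with
  | nil => simp only [states, List.mem_singleton] at hx; rw [hx]; exact hw
  | cons l w ih =>
    simp only [heightRun] at hw
    obtain ⟨k, hl, hw'⟩ := Option.bind_eq_some_iff.mp hw
    rcases l with ⟨d | _ | o, i⟩ | ⟨i, j⟩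
    · simp only [states, List.mem_map] at hx
      obtain ⟨y, hy, rfl⟩ := hx
      simp [heightRun, hl, ih hw' hy]
    · simp only [states, List.mem_map] at hx
      obtain ⟨y, hy, rfl⟩ := hx
      simp [heightRun, hl, ih hw' hy]
    · simp only [states, List.mem_append, List.mem_map] at hx
      simp only [heightStep] at hl
      split_ifs at hl with hi
      simp only [Option.some.injEq] at hl
      subst hl
      rcases hx with ⟨y, hy, rfl⟩ | ⟨y, hy, rfl⟩
      · exact ih (x := y) hw' hy
      · simp only [heightRun, heightStep, if_pos hi, Option.bind_some]
        rw [if_pos (by omega), Option.bind_some, show n - 2 + 2 = n by omega]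
        exact ih (x := y) hw' hy
    · simp only [states] at hx
      simp only [heightStep] at hl
      split_ifs at hl with hi
      simp only [Option.some.injEq] at hl
      subst hl
      exact ih hw' hx

/-- With a single colour the operator of a word is the sum of the operators of its states. -/
theorem bracketOp_states [Subsingleton C] (α : ℂ) (hα : α ≠ 0) (g : ℕ → C)
    (w : List (Slice Unit)) (φ : List (C × S) → ℂ) (s : List (C × S)) {n : ℕ}
    (hw : heightRun w s.length = some n) : bracketOp S α g w φ s =
      ((states w).map fun x => α ^ x.1 * countOp x.2 φ s).sum := by
  have key : ∀ (L : Op (C × S)) (l : List (ℤ × List (Slice Unit))) (s : List (C × S)),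
      L (fun s => (l.map fun x => α ^ x.1 * countOp x.2 φ s).sum) s =
        (l.map fun x => α ^ x.1 * L (countOp x.2 φ) s).sum := by
    intro L l s
    induction l with
    | nil => exact congrFun (map_zero L) s
    | cons x l ih =>
      simp only [List.map_cons, List.sum_cons]
      rw [← ih]
      have : (fun s => α ^ x.1 * countOp x.2 φ s +
          (l.map fun x => α ^ x.1 * countOp x.2 φ s).sum) =
          α ^ x.1 • countOp x.2 φ + fun s => (l.map fun x => α ^ x.1 * countOp x.2 φ s).sum := rfl
      rw [this, map_add, map_smul]
      rfl
  have hsum : ∀ (c : ℂ) (l : List (ℤ × List (Slice Unit))) (f : ℤ × List (Slice Unit) → ℂ),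
      c * (l.map f).sum = (l.map fun x => c * f x).sum := fun c l f =>
    (List.sum_map_mul_left ..).symm
  induction w generalizing s with
  | nil => simp [bracketOp, states, countOp, wordOp_nil]
  | cons l w ih =>
    simp only [heightRun] at hw
    obtain ⟨m, hl, hw⟩ := Option.bind_eq_some_iff.mp hw
    rw [bracketOp_length_slice α g l w hl fun s' hs' => ih s' (by rwa [hs'])]
    rcases l with ⟨d | _ | o, i⟩ | ⟨i, k⟩
    · rw [key]
      simp only [states, List.map_map, Function.comp_def, countOp, wordOp_cons_apply]
      rfl
    · rw [key]
      simp only [states, List.map_map, Function.comp_def, countOp, wordOp_cons_apply]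
      rfl
    · have hi : i + 2 ≤ s.length := by
        simp only [heightStep] at hl
        split_ifs at hl with hi
        exact hi
      simp only [sliceOp]
      rw [shiftOp_iterate_congr (fun φ s hs => crossOp_of_subsingleton α o φ s hs) i _ s hi,
        shiftOp_iterate_add, shiftOp_iterate_smul, shiftOp_iterate_smul, LinearMap.add_apply,
        Pi.add_apply, LinearMap.smul_apply, LinearMap.smul_apply, Pi.smul_apply, Pi.smul_apply,
        shiftOp_iterate_one i _ s (by omega), key, smul_eq_mul, smul_eq_mul, hsum, hsum]
      simp only [states, List.map_append, List.sum_append, List.map_map, Function.comp_def,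
        zpow_add₀ hα, sub_eq_add_neg, countOp, wordOp_cons_apply, shiftOp_iterate_mul,
        Module.End.mul_apply, sliceOp, mul_comm, mul_left_comm, mul_assoc]
    · have hi : i + 1 ≤ s.length := by
        simp only [heightStep] at hl
        split_ifs at hl with hi
        exact hi
      simp only [sliceOp]
      rw [shiftOp_iterate_congr (fun φ s hs => tieOp_of_subsingleton (g k) φ s hs) i _ s hi,
        shiftOp_iterate_one i _ s (by omega)]
      rfl

end

/-! ### Evaluations -/

/-- It suffices to solve y² + (M+1)y + 1 = 0 and to take a square root α of y; the constant term 1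
shows y ≠ 0, and division by y gives y + y⁻¹ = -(M+1). -/
theorem exists_loopRoot (M : ℕ) : ∃ α : ℂˣ,
    (α : ℂ) ^ 2 + (α : ℂ) ^ (-2 : ℤ) = -(Fintype.card (Fin (M + 1)) : ℂ) := by
  obtain ⟨d, hd⟩ := IsAlgClosed.exists_eq_mul_self ((M + 1 : ℂ) ^ 2 - 4)
  have hy : ((-(M + 1 : ℂ) + d) / 2) ^ 2 + (M + 1) * ((-(M + 1 : ℂ) + d) / 2) + 1 = 0 := by
    linear_combination -hd / 4
  obtain ⟨α, hα⟩ := IsAlgClosed.exists_eq_mul_self ((-(M + 1 : ℂ) + d) / 2)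
  rw [hα] at hy
  have h0 : α ≠ 0 := by
    rintro rfl
    simp at hy
  refine ⟨Units.mk0 α h0, ?_⟩
  simp only [Units.val_mk0, Fintype.card_fin, zpow_neg]
  have : α ^ (2 : ℤ) = α ^ 2 := by norm_cast
  rw [this]
  field_simp
  push_cast
  linear_combination hy

/-- A number `α` with `-α² - α⁻² = M + 1`. -/
noncomputable def loopRoot (M : ℕ) : ℂˣ := (exists_loopRoot M).choose

theorem loopRoot_spec (M : ℕ) : (loopRoot M : ℂ) ^ 2 + (loopRoot M : ℂ) ^ (-2 : ℤ) =
    -(Fintype.card (Fin (M + 1)) : ℂ) := (exists_loopRoot M).choose_spec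

noncomputable def evalA (M : ℕ) : RingA →+* ℂ :=
  LaurentPolynomial.eval₂ (Int.castRingHom ℂ) (loopRoot M)

theorem evalA_A (M : ℕ) (n : ℤ) : evalA M (A n) = (loopRoot M : ℂ) ^ n := by
  rw [evalA, A, LaurentPolynomial.eval₂_T, Units.val_zpow_eq_zpow_val]

theorem evalA_loop (M : ℕ) : evalA M (-(A 2 + A (-2))) = (M : ℂ) + 1 := by
  rw [map_neg, map_add, evalA_A, evalA_A]
  have := loopRoot_spec M
  simp only [Fintype.card_fin, Nat.cast_add, Nat.cast_one] at this
  rw [show (loopRoot M : ℂ) ^ (2 : ℤ) = (loopRoot M : ℂ) ^ 2 by norm_cast, this, neg_neg]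

/-- The loop value recovers M from α. -/
theorem loopRoot_injective : Function.Injective fun M => (loopRoot M : ℂ) := by
  intro M N h
  have h1 := loopRoot_spec M
  simp only at h
  rw [h, loopRoot_spec N] at h1
  simp only [Fintype.card_fin, neg_inj, Nat.cast_inj] at h1
  omega

/-- After multiplication by a power of A the element is a polynomial with infinitely many roots. -/
theorem evalA_injective {p : RingA} (h : ∀ M, evalA M p = 0) : p = 0 := by
  obtain ⟨n, q, hq⟩ := p.exists_T_pow
  have h1 : ∀ M, (q.map (Int.castRingHom ℂ)).eval (loopRoot M : ℂ) = 0 := by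
    intro M
    have := congrArg (evalA M) hq
    rw [map_mul, h M, zero_mul, evalA, LaurentPolynomial.eval₂_toLaurent] at this
    rwa [Polynomial.eval_map]
  have h2 : q.map (Int.castRingHom ℂ) = 0 :=
    Polynomial.eq_zero_of_infinite_isRoot _
      (Set.infinite_of_injective_forall_mem loopRoot_injective h1)
  have h3 : q = 0 := by
    have hinj : Function.Injective (Int.castRingHom ℂ) := Int.cast_injective
    exact (Polynomial.map_eq_zero_iff hinj).mp h2
  rw [h3, map_zero] at hq
  have h4 : p * LaurentPolynomial.T n * LaurentPolynomial.T (-n) = 0 := by rw [← hq, zero_mul]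
  rwa [mul_assoc, ← LaurentPolynomial.T_add, add_neg_cancel, LaurentPolynomial.T_zero,
    mul_one] at h4

theorem evalA_ext {p q : RingA} (h : ∀ M, evalA M p = evalA M q) : p = q :=
  sub_eq_zero.mp (evalA_injective fun M => by rw [map_sub, h, sub_self])

/-- The variable c goes to the number of labels, which is the value of an untied circle. -/
noncomputable def evalAc (N M : ℕ) : RingAc →+* ℂ :=
  Polynomial.eval₂RingHom (evalA M) ((N + 1) * (M + 1))

theorem evalAc_C (N M : ℕ) (p : RingA) : evalAc N M (Polynomial.C p) = evalA M p := by
  simp [evalAc]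

theorem evalAc_X (N M : ℕ) : evalAc N M Polynomial.X = (N + 1) * (M + 1) := by
  simp [evalAc]

/-- For fixed M the values of c are infinitely many as N varies, so every coefficient vanishes at
every `loopRoot M`. -/
theorem evalAc_injective {p : RingAc} (h : ∀ N M, evalAc N M p = 0) : p = 0 := by
  ext1 n
  rw [Polynomial.coeff_zero]
  refine evalA_injective fun M => ?_
  have h1 : p.map (evalA M) = 0 := by
    refine Polynomial.eq_zero_of_infinite_isRoot _
      (Set.infinite_of_injective_forall_mem (f := fun N : ℕ => ((N : ℂ) + 1) * (M + 1)) ?_ ?_)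
    · intro N N' hN
      have h0 : (M + 1 : ℂ) ≠ 0 := by exact_mod_cast Nat.succ_ne_zero M
      have := mul_right_cancel₀ h0 hN
      simpa using this
    · intro N
      have := h N M
      simpa [evalAc, Polynomial.eval_map] using this
  rw [← Polynomial.coeff_map, h1, Polynomial.coeff_zero]

theorem evalAc_ext {p q : RingAc} (h : ∀ N M, evalAc N M p = evalAc N M q) : p = q :=
  sub_eq_zero.mp (evalAc_injective fun N M => by rw [map_sub, h, sub_self])

theorem cast_succ_ne_zero (M : ℕ) : (M + 1 : ℂ) ≠ 0 := by exact_mod_cast Nat.succ_ne_zero M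

/-- The Kauffman bracket at `loopRoot M`. -/
theorem evalA_kauffmanBracket (M : ℕ) {w : List (Slice Unit)} (h0 : w ≠ [])
    (hw : heightRun w 0 = some 0) : (M + 1) * evalA M (kauffmanBracket w) =
      bracketOp (Fin (M + 1)) (loopRoot M : ℂ) (fun _ => (0 : Fin 1)) w (fun _ => 1) [] := by
  rw [bracketOp_states _ (loopRoot M).ne_zero _ _ _ [] hw, kauffmanBracket,
    map_list_sum, List.map_map, ← List.sum_map_mul_left]
  congr 1
  refine List.map_congr_left fun x hx => ?_
  have hx' := heightRun_of_mem_states hw hx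
  -- A closed word begins with a minimum, and this survives in every state.
  have hne : x.2 ≠ [] := by
    obtain ⟨d, v, rfl⟩ := exists_cup_of_closed h0 hw
    simp only [states, List.mem_map] at hx
    obtain ⟨y, -, rfl⟩ := hx
    simp
  rw [countOp_closed hx']
  simp only [Function.comp_apply, map_mul, evalA_A, map_pow, evalA_loop, Fintype.card_prod,
    Fintype.card_fin, one_mul, Nat.cast_add, Nat.cast_one]
  obtain ⟨e, he⟩ := Nat.exists_eq_add_of_lt (componentCount_pos hne hx')
  rw [he]
  simp
  ring

end TiedLink

/-! ### Sums of symmetric weights as polynomials in the number of colours. -/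

namespace TiedLink
open Piece Slice Direction

/-! ### Sums over lists -/

section
variable {K R : Type} [CommRing R]

/-- The sum of `F` over all lists of length `n` with elements in `T`. -/
def sumLists (T : Finset K) : ℕ → (List K → R) → R
  | 0, F => F []
  | n + 1, F => ∑ a ∈ T, sumLists T n fun s => F (a :: s)

theorem sumLists_congr (T : Finset K) {n : ℕ} {F G : List K → R}
    (h : ∀ s, s.length = n → F s = G s) : sumLists T n F = sumLists T n G := by
  induction n generalizing F G with
  | zero => exact h [] rfl
  | succ n ih => exact Finset.sum_congr rfl fun a _ => ih fun s hs => h _ (by simp [hs])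

theorem sumLists_mul (T : Finset K) (n : ℕ) (c : R) (F : List K → R) :
    sumLists T n (fun s => c * F s) = c * sumLists T n F := by
  induction n generalizing F with
  | zero => rfl
  | succ n ih => simp only [sumLists, ih, Finset.mul_sum]

theorem sumLists_map {K' : Type} (T : Finset K) (T' : Finset K') (f : K → K')
    (hf : Function.Injective f) (hT : ∀ b, b ∈ T' ↔ ∃ a ∈ T, f a = b) (n : ℕ)
    (F : List K' → R) : sumLists T n (fun s => F (s.map f)) = sumLists T' n F := by
  classical
  have : T' = T.image f := by ext b; simp [hT]
  induction n generalizing F with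
  | zero => rfl
  | succ n ih =>
    simp only [sumLists, List.map_cons]
    rw [this, Finset.sum_image hf.injOn, ← this]
    exact Finset.sum_congr rfl fun a _ => ih fun s => F (f a :: s)

theorem sumLists_prod {C S : Type} [Fintype C] [Fintype S] (n : ℕ) (F : List C → R)
    (G : List S → R) : sumLists (Finset.univ : Finset (C × S)) n
      (fun s => F (s.map Prod.fst) * G (s.map Prod.snd)) =
      sumLists Finset.univ n F * sumLists Finset.univ n G := by
  induction n generalizing F G with
  | zero => rfl
  | succ n ih =>
    simp only [sumLists, List.map_cons, Finset.sum_mul_sum, Fintype.sum_prod_type]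
    exact Finset.sum_congr rfl fun a _ => Finset.sum_congr rfl fun b _ =>
      ih (fun s => F (a :: s)) fun s => G (b :: s)

theorem sumLists_add (T : Finset K) (m n : ℕ) (F : List K → R) :
    sumLists T (m + n) F = sumLists T m fun s => sumLists T n fun t => F (s ++ t) := by
  induction m generalizing F with
  | zero => simp [sumLists]
  | succ m ih =>
    rw [Nat.add_right_comm]
    simp only [sumLists, ih, List.cons_append]

theorem sumLists_eq_sum_ofFn [Fintype K] (n : ℕ) (F : List K → R) :
    sumLists Finset.univ n F = ∑ f : Fin n → K, F (List.ofFn f) := by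
  induction n generalizing F with
  | zero => simp [sumLists]
  | succ n ih =>
    rw [← (Fin.consEquiv fun _ => K).sum_comp, Fintype.sum_prod_type]
    simp only [sumLists, ih, Fin.consEquiv, Equiv.coe_fn_mk]
    simp [List.ofFn_succ]

end

/-- If `k` colours occur in the list `p`, the two-valued functions on these colours yield 2^k
different lists of weight 1. Later this bounds the number of colours by the number of components. -/
theorem two_pow_le_sumLists {n k : ℕ} (G : List Bool → ℤ) (hG : ∀ s, 0 ≤ G s) {p : List ℕ}
    (hp : p.length = n) (hk : ∀ c < k, c ∈ p) (h1 : ∀ θ : ℕ → Bool, G (p.map θ) = 1) :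
    (2 : ℤ) ^ k ≤ sumLists Finset.univ n G := by
  subst hp
  rw [sumLists_eq_sum_ofFn]
  let ext (θ : Fin k → Bool) (c : ℕ) : Bool := if h : c < k then θ ⟨c, h⟩ else false
  let Φ (θ : Fin k → Bool) (j : Fin p.length) : Bool := ext θ p[j]
  have hΦ : Function.Injective Φ := by
    intro θ θ' h
    funext c
    obtain ⟨j, hj, hjc⟩ := List.mem_iff_getElem.mp (hk c c.2)
    have := congrFun h ⟨j, hj⟩
    simpa [Φ, ext, hjc] using this
  have hval : ∀ θ, G (List.ofFn (Φ θ)) = 1 := by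
    intro θ
    rw [← h1 (ext θ)]
    congr 1
    apply List.ext_getElem <;> simp [Φ]
  calc (2 : ℤ) ^ k = ∑ θ : Fin k → Bool, G (List.ofFn (Φ θ)) := by simp [hval]
    _ = ∑ f ∈ Finset.univ.image Φ, G (List.ofFn f) := by
        rw [Finset.sum_image hΦ.injOn]
    _ ≤ _ := Finset.sum_le_sum_of_subset_of_nonneg (Finset.subset_univ _) fun _ _ _ => hG _

/-! ### Polynomials from symmetric weights -/

/-- The prefix `p` uses exactly the colours below `k`. The next letter is one of these or a new one,
and by symmetry each of the N+1-k new colours contributes as much as the colour `k`. The factor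
N+1-k together with one factor M+1 is c - k(M+1), a value of a polynomial. The powers of M+1 suffice
because a nonzero weight has at most `e` colours. -/
theorem exists_polynomial_of_prefix {W : List ℕ → ℤ} {e n : ℕ}
    (hsymm : ∀ s, s.length = n → ∀ π : Equiv.Perm ℕ, W (s.map π) = W s)
    (hbound : ∀ s k, s.length = n → W s ≠ 0 → (∀ c < k, c ∈ s) → k ≤ e) (m k : ℕ)
    (p : List ℕ) (hp : p.length + m = n) (h1 : ∀ c ∈ p, c < k) (h2 : ∀ c < k, c ∈ p) :
    ∃ q : RingAc, ∀ N M : ℕ, k ≤ N + 1 →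
      (M + 1 : ℂ) ^ e *
        ((sumLists (Finset.range (N + 1)) m fun s => W (p ++ s) : ℤ) : ℂ) =
      (M + 1 : ℂ) ^ k * evalAc N M q := by
  induction m generalizing k p with
  | zero =>
    simp only [add_zero] at hp
    by_cases hW : W p = 0
    · exact ⟨0, fun N M _ => by simp [sumLists, hW]⟩
    · have hk := hbound p k hp hW h2
      -- The powers of M+1 not used up by new colours remain as powers of the loop value.
      refine ⟨Polynomial.C ((W p : RingA) * (-(A 2 + A (-2))) ^ (e - k)), fun N M _ => ?_⟩
      rw [evalAc_C, map_mul, map_pow, evalA_loop, map_intCast]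
      simp only [sumLists, List.append_nil]
      rw [mul_left_comm, ← pow_add, Nat.add_sub_cancel' hk, mul_comm]
  | succ m ih =>
    have hold : ∀ a, ∃ q : RingAc, a < k → ∀ N M : ℕ, k ≤ N + 1 →
        (M + 1 : ℂ) ^ e *
          ((sumLists (Finset.range (N + 1)) m fun s => W (p ++ [a] ++ s) : ℤ) : ℂ) =
        (M + 1 : ℂ) ^ k * evalAc N M q := by
      intro a
      by_cases ha : a < k
      · obtain ⟨q, hq⟩ := ih k (p ++ [a]) (by simp; omega)
          (by simp only [List.mem_append, List.mem_singleton]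
              rintro c (hc | rfl)
              · exact h1 c hc
              · exact ha) fun c hc => List.mem_append_left _ (h2 c hc)
        exact ⟨q, fun _ => hq⟩
      · exact ⟨0, fun h => absurd h ha⟩
    choose q hq using hold
    obtain ⟨r, hr⟩ := ih (k + 1) (p ++ [k]) (by simp; omega)
      (by simp only [List.mem_append, List.mem_singleton]
          rintro c (hc | rfl)
          · exact (h1 c hc).trans (Nat.lt_succ_self _)
          · exact Nat.lt_succ_self _)
      (by intro c hc
          rcases Nat.lt_succ_iff_lt_or_eq.mp hc with hc | rfl
          · exact List.mem_append_left _ (h2 c hc)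
          · simp)
    refine ⟨∑ a ∈ Finset.range k, q a +
      (Polynomial.X - Polynomial.C ((k : RingA) * -(A 2 + A (-2)))) * r, fun N M hk => ?_⟩
    have hnew : ∀ a ∈ Finset.Ico k (N + 1),
        sumLists (Finset.range (N + 1)) m (fun s => W (p ++ [a] ++ s)) =
        sumLists (Finset.range (N + 1)) m fun s => W (p ++ [k] ++ s) := by
      intro a ha
      rw [Finset.mem_Ico] at ha
      rw [← sumLists_map (Finset.range (N + 1)) (Finset.range (N + 1)) (Equiv.swap a k)
        (Equiv.injective _) ?_ m fun s => W (p ++ [k] ++ s)]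
      · refine sumLists_congr _ fun s hs => ?_
        rw [← hsymm (p ++ [a] ++ s) (by simp [hs]; omega) (Equiv.swap a k)]
        have : p.map (Equiv.swap a k) = p := by
          conv_rhs => rw [← List.map_id p]
          refine List.map_congr_left fun c hc => ?_
          have := h1 c hc
          exact Equiv.swap_apply_of_ne_of_ne (by omega) (by omega)
        simp [this]
      · intro b
        simp only [Finset.mem_range]
        constructor
        · intro hb
          refine ⟨Equiv.swap a k b, ?_, by simp⟩
          rw [Equiv.swap_apply_def]; split_ifs <;> omega
        · rintro ⟨c, hc, rfl⟩
          rw [Equiv.swap_apply_def]; split_ifs <;> omega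
    have hsum : sumLists (Finset.range (N + 1)) (m + 1) (fun s => W (p ++ s)) =
        ∑ a ∈ Finset.range k, sumLists (Finset.range (N + 1)) m (fun s => W (p ++ [a] ++ s)) +
        ((N : ℤ) + 1 - k) *
          sumLists (Finset.range (N + 1)) m fun s => W (p ++ [k] ++ s) := by
      have h3 : sumLists (Finset.range (N + 1)) (m + 1) (fun s => W (p ++ s)) =
          ∑ a ∈ Finset.range (N + 1),
            sumLists (Finset.range (N + 1)) m (fun s => W (p ++ [a] ++ s)) := by
        simp [sumLists]
      rw [h3, ← Finset.sum_range_add_sum_Ico _ hk, Finset.sum_congr rfl hnew]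
      simp [Nat.cast_sub hk]
    rw [hsum, map_add, map_sum, map_mul, map_sub, evalAc_X, evalAc_C, map_mul, evalA_loop,
      map_natCast]
    push_cast
    rw [mul_add, mul_add, Finset.mul_sum, Finset.mul_sum]
    congr 1
    · exact Finset.sum_congr rfl fun a ha => hq a (Finset.mem_range.mp ha) N M hk
    · rcases Nat.lt_or_ge k (N + 1) with hk' | hk'
      · have := hr N M hk'
        linear_combination ((N : ℂ) + 1 - k) * this
      -- All colours are already in use: the induction hypothesis for `k + 1` is not available, but
      -- the factor c - k(M+1) vanishes.
      · obtain rfl : k = N + 1 := le_antisymm hk hk'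
        push_cast
        ring

/-- The first letter can be taken to be 0 at the price of a factor N+1, and the prefix `[0]` yields
the factor M+1. This is the factor c by which the state sum is divided. -/
theorem exists_polynomial_of_symmetric {W : List ℕ → ℤ} {e n : ℕ} (hn : 0 < n)
    (hsymm : ∀ s, s.length = n → ∀ π : Equiv.Perm ℕ, W (s.map π) = W s)
    (hbound : ∀ s k, s.length = n → W s ≠ 0 → (∀ c < k, c ∈ s) → k ≤ e) :
    ∃ P : RingAc, ∀ N M : ℕ, (N + 1) * (M + 1) * evalAc N M P =
      (M + 1 : ℂ) ^ e * ((sumLists (Finset.range (N + 1)) n W : ℤ) : ℂ) := by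
  obtain ⟨m, rfl⟩ : ∃ m, n = m + 1 := ⟨n - 1, by omega⟩
  obtain ⟨q, hq⟩ := exists_polynomial_of_prefix hsymm hbound m 1 [0] (by simp; omega)
    (by simp) (by simp)
  refine ⟨q, fun N M => ?_⟩
  have hall : ∀ a ∈ Finset.range (N + 1),
      sumLists (Finset.range (N + 1)) m (fun s => W (a :: s)) =
      sumLists (Finset.range (N + 1)) m fun s => W ([0] ++ s) := by
    intro a ha
    rw [Finset.mem_range] at ha
    rw [← sumLists_map (Finset.range (N + 1)) (Finset.range (N + 1)) (Equiv.swap a 0)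
      (Equiv.injective _) ?_ m fun s => W ([0] ++ s)]
    · refine sumLists_congr _ fun s hs => ?_
      rw [← hsymm (a :: s) (by simp [hs]) (Equiv.swap a 0)]
      simp
    · intro b
      simp only [Finset.mem_range]
      constructor
      · intro hb
        refine ⟨Equiv.swap a 0 b, ?_, by simp⟩
        rw [Equiv.swap_apply_def]; split_ifs <;> omega
      · rintro ⟨c, hc, rfl⟩
        rw [Equiv.swap_apply_def]; split_ifs <;> omega
  have := hq N M (by omega)
  rw [pow_one] at this
  simp only [sumLists]
  rw [Finset.sum_congr rfl hall]
  simp only [Finset.sum_const, Finset.card_range, nsmul_eq_mul]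
  push_cast
  linear_combination -((N : ℂ) + 1) * this

end TiedLink

/-! ### Weights of colours, weights of spins, and the effect of recolouring. -/

namespace TiedLink
open Piece Slice Direction

/-! ### Weights of labellings

A word whose crossings and ties have weights. The labels of the strands are determined by the
labels of the minima. -/

section
variable {K : Type}

def shiftAct (f : List K → ℤ × List K) : List K → ℤ × List K
  | [] => (0, [])
  | x :: s => ((f s).1, x :: (f s).2)

def capAct [DecidableEq K] : List K → ℤ × List K
  | a :: b :: s => (if a = b then 1 else 0, s)
  | _ => (0, [])

def swapAct (ω : Bool → K → K → ℤ) (o : Bool) : List K → ℤ × List K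
  | a :: b :: s => (ω o a b, b :: a :: s)
  | _ => (0, [])

def tieAct (τ : ℕ → K → List K → ℤ) (k : ℕ) : List K → ℤ × List K
  | a :: s => (τ k a s, a :: s)
  | [] => (0, [])

/-- The weight of a slice and the labels above it; a minimum gets the label `c`. -/
def sliceAct [DecidableEq K] (ω : Bool → K → K → ℤ) (τ : ℕ → K → List K → ℤ) (c : K) :
    Slice Unit → List K → ℤ × List K
  | piece (cup _) i => shiftAct^[i] fun s => (1, c :: c :: s)
  | piece cap i => shiftAct^[i] capAct
  | piece (cross o) i => shiftAct^[i] (swapAct ω o)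
  | tieEnd i k => shiftAct^[i] (tieAct τ k)

/-- The weight of a word above the labels `s`, where `env` contains the labels of the minima. -/
def weight [DecidableEq K] [Inhabited K] (ω : Bool → K → K → ℤ) (τ : ℕ → K → List K → ℤ) :
    List (Slice Unit) → List K → List K → ℤ
  | [], _, _ => 1
  | piece (cup d) i :: w, c :: env, s =>
      (sliceAct ω τ c (piece (cup d) i) s).1 *
        weight ω τ w env (sliceAct ω τ c (piece (cup d) i) s).2
  | piece (cup _) _ :: _, [], _ => 0
  | piece cap i :: w, env, s =>
      (sliceAct ω τ default (piece cap i) s).1 *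
        weight ω τ w env (sliceAct ω τ default (piece cap i) s).2
  | piece (cross o) i :: w, env, s =>
      (sliceAct ω τ default (piece (cross o) i) s).1 *
        weight ω τ w env (sliceAct ω τ default (piece (cross o) i) s).2
  | tieEnd i k :: w, env, s =>
      (sliceAct ω τ default (tieEnd i k) s).1 *
        weight ω τ w env (sliceAct ω τ default (tieEnd i k) s).2

def Slice.isCup : Slice Unit → Bool
  | piece (cup _) _ => true
  | _ => false

def cupCount (w : List (Slice Unit)) : ℕ := w.countP Slice.isCup

theorem weight_cons_of_not_cup [DecidableEq K] [Inhabited K] (ω : Bool → K → K → ℤ)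
    (τ : ℕ → K → List K → ℤ) {l : Slice Unit} (hl : l.isCup = false) (w : List (Slice Unit))
    (env s : List K) : weight ω τ (l :: w) env s =
      (sliceAct ω τ default l s).1 * weight ω τ w env (sliceAct ω τ default l s).2 := by
  rcases l with ⟨d | _ | o, i⟩ | ⟨i, k⟩
  · simp [Slice.isCup] at hl
  · rw [weight]
  · rw [weight]
  · rw [weight]

theorem weight_cons_of_cup [DecidableEq K] [Inhabited K] (ω : Bool → K → K → ℤ)
    (τ : ℕ → K → List K → ℤ) {l : Slice Unit} (hl : l.isCup = true) (w : List (Slice Unit))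
    (c : K) (env s : List K) : weight ω τ (l :: w) (c :: env) s =
      (sliceAct ω τ c l s).1 * weight ω τ w env (sliceAct ω τ c l s).2 := by
  rcases l with ⟨d | _ | o, i⟩ | ⟨i, k⟩
  · rw [weight]
  all_goals simp [Slice.isCup] at hl

theorem weight_cons_of_cup_nil [DecidableEq K] [Inhabited K] (ω : Bool → K → K → ℤ)
    (τ : ℕ → K → List K → ℤ) {l : Slice Unit} (hl : l.isCup = true) (w : List (Slice Unit))
    (s : List K) : weight ω τ (l :: w) [] s = 0 := by
  rcases l with ⟨d | _ | o, i⟩ | ⟨i, k⟩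
  · rw [weight]
  all_goals simp [Slice.isCup] at hl

/-- Induction principle for properties of a single slice that are stable under adding a strand on
the left. -/
theorem slice_induction {motive : Slice Unit → Prop} (hcup : ∀ d, motive (piece (cup d) 0))
    (hcap : motive (piece cap 0)) (hcross : ∀ o, motive (piece (cross o) 0))
    (htie : ∀ k, motive (tieEnd 0 k)) (hshift : ∀ l, motive l → motive l.shift)
    (l : Slice Unit) : motive l := by
  rcases l with ⟨d | _ | o, i⟩ | ⟨i, k⟩
  · induction i with
    | zero => exact hcup d
    | succ i ih => exact hshift _ ih
  · induction i with
    | zero => exact hcap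
    | succ i ih => exact hshift _ ih
  · induction i with
    | zero => exact hcross o
    | succ i ih => exact hshift _ ih
  · induction i with
    | zero => exact htie k
    | succ i ih => exact hshift _ ih

theorem isCup_shift (l : Slice Unit) : l.shift.isCup = l.isCup := by
  rcases l with ⟨d | _ | o, i⟩ | ⟨i, k⟩ <;> rfl

section
variable [DecidableEq K]

theorem sliceAct_shift (ω : Bool → K → K → ℤ) (τ : ℕ → K → List K → ℤ) (c : K)
    (l : Slice Unit) : sliceAct ω τ c l.shift = shiftAct (sliceAct ω τ c l) := by
  rcases l with ⟨d | _ | o, i⟩ | ⟨i, k⟩ <;> exact Function.iterate_succ_apply' _ _ _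

theorem heightStep_shift (l : Slice Unit) (n : ℕ) :
    heightStep l.shift (n + 1) = (heightStep l n).map (· + 1) := by
  rcases l with ⟨d | _ | o, i⟩ | ⟨i, k⟩ <;> simp only [Slice.shift, heightStep] <;>
    split_ifs <;> first | omega | simp <;> omega

theorem sliceAct_length (ω : Bool → K → K → ℤ) (τ : ℕ → K → List K → ℤ) (c : K)
    (l : Slice Unit) {s : List K} {n : ℕ} (h : heightStep l s.length = some n) :
    (sliceAct ω τ c l s).2.length = n := by
  induction l using slice_induction generalizing s n with
  | hcup d => simp [heightStep] at h; simp [sliceAct, h]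
  | hcap =>
    rcases s with _ | ⟨a, _ | ⟨b, s⟩⟩ <;> simp [heightStep] at h
    simp [sliceAct, capAct, h]
  | hcross o =>
    rcases s with _ | ⟨a, _ | ⟨b, s⟩⟩ <;> simp [heightStep] at h
    simp [sliceAct, swapAct, h]
  | htie k =>
    rcases s with _ | ⟨a, s⟩ <;> simp [heightStep] at h
    simp [sliceAct, tieAct, h]
  | hshift l ih =>
    rw [sliceAct_shift]
    rcases s with _ | ⟨x, s⟩
    · rcases l with ⟨d | _ | o, i⟩ | ⟨i, k⟩ <;> simp [Slice.shift, heightStep] at h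
    · rw [List.length_cons, heightStep_shift] at h
      obtain ⟨m, hm, rfl⟩ := Option.map_eq_some_iff.mp h
      simp [shiftAct, ih hm]

theorem sliceAct_mem (ω : Bool → K → K → ℤ) (τ : ℕ → K → List K → ℤ) (c : K)
    (l : Slice Unit) {s : List K} {a : K} (h : a ∈ (sliceAct ω τ c l s).2) :
    a ∈ s ∨ (l.isCup = true ∧ a = c) := by
  induction l using slice_induction generalizing s with
  | hcup d =>
    simp [sliceAct] at h
    simp only [Slice.isCup]; tauto
  | hcap =>
    rcases s with _ | ⟨x, _ | ⟨b, s⟩⟩ <;> simp [sliceAct, capAct] at h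
    simp [h]
  | hcross o =>
    rcases s with _ | ⟨x, _ | ⟨b, s⟩⟩ <;> simp [sliceAct, swapAct] at h
    simp only [List.mem_cons]; tauto
  | htie k =>
    rcases s with _ | ⟨x, s⟩ <;> simp [sliceAct, tieAct] at h
    simp [h]
  | hshift l ih =>
    rw [sliceAct_shift] at h
    rcases s with _ | ⟨x, s⟩ <;> simp [shiftAct] at h
    rw [isCup_shift]
    rcases h with rfl | h
    · simp
    · rcases ih h with h | h <;> simp [h]

section
variable [Fintype K]

theorem sliceOp_of_not_cup (ω : Bool → K → K → ℤ) (τ : ℕ → K → List K → ℤ) (c : K)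
    {l : Slice Unit} (hl : l.isCup = false) (φ : List K → ℂ) (s : List K) :
    sliceOp (swapOp ω) (weightOp τ) l φ s =
      (sliceAct ω τ c l s).1 * φ (sliceAct ω τ c l s).2 := by
  induction l using slice_induction generalizing φ s with
  | hcup d => simp [Slice.isCup] at hl
  | hcap =>
    rcases s with _ | ⟨x, _ | ⟨b, s⟩⟩ <;> simp [sliceAct, sliceOp, capAct, capOp_nil, capOp_single,
      capOp_cons]
  | hcross o =>
    rcases s with _ | ⟨x, _ | ⟨b, s⟩⟩ <;> simp [sliceAct, sliceOp, swapAct, swapOp_nil,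
      swapOp_single, swapOp_cons]
  | htie k =>
    rcases s with _ | ⟨x, s⟩ <;> simp [sliceAct, sliceOp, tieAct, weightOp_nil, weightOp_cons]
  | hshift l ih =>
    rw [isCup_shift] at hl
    rw [sliceAct_shift, sliceOp_shift]
    rcases s with _ | ⟨x, s⟩
    · simp [shiftAct, shiftOp_nil]
    · rw [shiftOp_cons, ih hl]; rfl

theorem sliceOp_of_cup (ω : Bool → K → K → ℤ) (τ : ℕ → K → List K → ℤ)
    {l : Slice Unit} (hl : l.isCup = true) (φ : List K → ℂ) (s : List K) :
    sliceOp (swapOp ω) (weightOp τ) l φ s =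
      ∑ c, (sliceAct ω τ c l s).1 * φ (sliceAct ω τ c l s).2 := by
  induction l using slice_induction generalizing φ s with
  | hcup d => simp [sliceAct, sliceOp, cupOp_apply]
  | hcap => simp [Slice.isCup] at hl
  | hcross o => simp [Slice.isCup] at hl
  | htie k => simp [Slice.isCup] at hl
  | hshift l ih =>
    rw [isCup_shift] at hl
    rw [sliceOp_shift]
    simp only [sliceAct_shift]
    rcases s with _ | ⟨x, s⟩
    · simp [shiftAct, shiftOp_nil]
    · rw [shiftOp_cons, ih hl]; rfl

/-- Only minima introduce a free label; every other slice determines the labels above it. -/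
theorem wordOp_eq_sumLists [Inhabited K] (ω : Bool → K → K → ℤ) (τ : ℕ → K → List K → ℤ)
    (w : List (Slice Unit)) (s : List K) : wordOp (swapOp ω) (weightOp τ) w (fun _ => 1) s =
      ((sumLists Finset.univ (cupCount w) fun env => weight ω τ w env s : ℤ) : ℂ) := by
  induction w generalizing s with
  | nil => simp [wordOp_nil, cupCount, sumLists, weight]
  | cons l w ih =>
    rw [wordOp_cons_apply]
    cases hl : l.isCup with
    | false =>
      rw [sliceOp_of_not_cup ω τ default hl, ih]
      simp only [weight_cons_of_not_cup ω τ hl, sumLists_mul, cupCount, List.countP_cons, hl]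
      push_cast
      rfl
    | true =>
      rw [sliceOp_of_cup ω τ hl]
      simp only [cupCount, List.countP_cons, hl, if_true, sumLists, ih,
        weight_cons_of_cup ω τ hl, sumLists_mul]
      push_cast
      rfl

end
end
end

/-! ### Colours and spins -/

section
variable {C S : Type} [LinearOrder C] [DecidableEq S] [Inhabited C] [Inhabited S]

/-- It vanishes for equal colours because that case is accounted for by the two smoothings. -/
def colourCross (o : Bool) (a b : C) : ℤ := if a = b then 0 else colourSign o a b

/-- Tie `k + 1` has colour `g k`. Tie `0` requires that two neighbouring strands have the same
colour. -/
def colourTie (g : ℕ → C) : ℕ → C → List C → ℤ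
  | 0, a, s => if s.head? = some a then 1 else 0
  | k + 1, a, _ => if a = g k then 1 else 0

def colourWeight (g : ℕ → C) : List (Slice Unit) → List C → List C → ℤ :=
  weight colourCross (colourTie g)

def plainWeight (w : List (Slice Unit)) (env s : List S) : ℤ :=
  weight (fun _ _ _ => 1) (fun _ _ _ => 1) w env s

def jointCross (o : Bool) (a b : C × S) : ℤ := colourCross o a.1 b.1

def jointTie (S : Type) (g : ℕ → C) (k : ℕ) (a : C × S) (s : List (C × S)) : ℤ :=
  colourTie g k a.1 (s.map Prod.fst)

theorem sliceAct_joint (g : ℕ → C) (c : C × S) (l : Slice Unit) (s : List (C × S)) :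
    (sliceAct jointCross (jointTie S g) c l s).1 =
      (sliceAct colourCross (colourTie g) c.1 l (s.map Prod.fst)).1 *
      (sliceAct (fun _ _ _ => 1) (fun _ _ _ => 1) c.2 l (s.map Prod.snd)).1 ∧
    (sliceAct jointCross (jointTie S g) c l s).2.map Prod.fst =
      (sliceAct colourCross (colourTie g) c.1 l (s.map Prod.fst)).2 ∧
    (sliceAct jointCross (jointTie S g) c l s).2.map Prod.snd =
      (sliceAct (fun _ _ _ => 1) (fun _ _ _ => 1) c.2 l (s.map Prod.snd)).2 := by
  induction l using slice_induction generalizing s with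
  | hcup d => simp [sliceAct]
  | hcap =>
    rcases s with _ | ⟨⟨x, x'⟩, _ | ⟨⟨b, b'⟩, s⟩⟩ <;> simp [sliceAct, capAct, ← ite_and, and_comm]
  | hcross o =>
    rcases s with _ | ⟨x, _ | ⟨b, s⟩⟩ <;> simp [sliceAct, swapAct, jointCross]
  | htie k =>
    rcases s with _ | ⟨x, s⟩ <;> simp [sliceAct, tieAct, jointTie]
  | hshift l ih =>
    simp only [sliceAct_shift]
    rcases s with _ | ⟨x, s⟩
    · simp [shiftAct]
    · obtain ⟨h1, h2, h3⟩ := ih s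
      simp [shiftAct, h1, h2, h3]

/-- Crossings and ties look at colours only, and at a maximum equality of labels is equality of
colours and of spins. Hence the sums over spins and over colours separate. -/
theorem weight_joint (g : ℕ → C) (w : List (Slice Unit)) (env s : List (C × S)) :
    weight jointCross (jointTie S g) w env s =
      colourWeight g w (env.map Prod.fst) (s.map Prod.fst) *
        plainWeight w (env.map Prod.snd) (s.map Prod.snd) := by
  unfold colourWeight plainWeight
  induction w generalizing env s with
  | nil => simp [weight]
  | cons l w ih =>
    cases hl : l.isCup with
    | false =>
      obtain ⟨h1, h2, h3⟩ := sliceAct_joint g (default : C × S) l s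
      simp only [weight_cons_of_not_cup _ _ hl, ih, h1, h2, h3]
      rw [show (default : C × S).1 = default from rfl, show (default : C × S).2 = default from rfl]
      ring
    | true =>
      rcases env with _ | ⟨c, env⟩
      · simp [weight_cons_of_cup_nil _ _ hl]
      · obtain ⟨h1, h2, h3⟩ := sliceAct_joint g c l s
        simp only [List.map_cons, weight_cons_of_cup _ _ hl, ih, h1, h2, h3]
        ring

theorem plainWeight_nonneg (w : List (Slice Unit)) (env s : List S) :
    0 ≤ plainWeight w env s := by
  have slice : ∀ (c : S) (l : Slice Unit) (s : List S),
      0 ≤ (sliceAct (fun _ _ _ => 1) (fun _ _ _ => 1) c l s).1 := by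
    intro c l
    induction l using slice_induction with
    | hcup d => intro s; simp [sliceAct]
    | hcap =>
      rintro (_ | ⟨x, _ | ⟨b, s⟩⟩) <;> simp [sliceAct, capAct]
      split_ifs <;> simp
    | hcross o => rintro (_ | ⟨x, _ | ⟨b, s⟩⟩) <;> simp [sliceAct, swapAct]
    | htie k => rintro (_ | ⟨x, s⟩) <;> simp [sliceAct, tieAct]
    | hshift l ih =>
      rw [sliceAct_shift]
      rintro (_ | ⟨x, s⟩)
      · simp [shiftAct]
      · exact ih s
  unfold plainWeight
  induction w generalizing env s with
  | nil => simp [weight]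
  | cons l w ih =>
    cases hl : l.isCup with
    | false =>
      rw [weight_cons_of_not_cup _ _ hl]
      exact mul_nonneg (slice _ _ _) (ih _ _)
    | true =>
      rcases env with _ | ⟨c, env⟩
      · simp [weight_cons_of_cup_nil _ _ hl]
      · rw [weight_cons_of_cup _ _ hl]
        exact mul_nonneg (slice _ _ _) (ih _ _)

/-- A nonzero weight means that the colours match at all maxima, and any function of the colours
then matches too. -/
theorem plainWeight_map {g : ℕ → C} {w : List (Slice Unit)} {env s : List C}
    (h : colourWeight g w env s ≠ 0) (θ : C → S) :
    plainWeight w (env.map θ) (s.map θ) = 1 := by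
  have slice : ∀ (c : C) (c' : S) (l : Slice Unit), (l.isCup = true → c' = θ c) →
      ∀ s : List C, (sliceAct colourCross (colourTie g) c l s).1 ≠ 0 →
      sliceAct (fun _ _ _ => 1) (fun _ _ _ => 1) c' l (s.map θ) =
        (1, (sliceAct colourCross (colourTie g) c l s).2.map θ) := by
    intro c c' l
    induction l using slice_induction with
    | hcup d => intro hc s; simp [sliceAct, hc rfl]
    | hcap =>
      rintro - (_ | ⟨x, _ | ⟨b, s⟩⟩) <;> simp [sliceAct, capAct]
      intro h; simp [h]
    | hcross o => rintro - (_ | ⟨x, _ | ⟨b, s⟩⟩) <;> simp [sliceAct, swapAct]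
    | htie k => rintro - (_ | ⟨x, s⟩) <;> simp [sliceAct, tieAct]
    | hshift l ih =>
      rw [isCup_shift]
      intro hc
      simp only [sliceAct_shift]
      rintro (_ | ⟨x, s⟩)
      · simp [shiftAct]
      · intro h
        simp only [List.map_cons, shiftAct] at h ⊢
        rw [ih hc s h]
  unfold plainWeight
  unfold colourWeight at h
  induction w generalizing env s with
  | nil => simp [weight]
  | cons l w ih =>
    cases hl : l.isCup with
    | false =>
      rw [weight_cons_of_not_cup _ _ hl] at h ⊢
      rw [slice default default l (by simp [hl]) s (left_ne_zero_of_mul h)]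
      simpa using ih (right_ne_zero_of_mul h)
    | true =>
      rcases env with _ | ⟨c, env⟩
      · simp [weight_cons_of_cup_nil _ _ hl] at h
      · rw [List.map_cons]
        rw [weight_cons_of_cup _ _ hl] at h ⊢
        rw [slice c (θ c) l (fun _ => rfl) s (left_ne_zero_of_mul h)]
        simpa using ih (right_ne_zero_of_mul h)

/-! ### Recolouring -/

section
variable {C' : Type} [LinearOrder C'] [Inhabited C']

/-- `-1` if `π` inverts the order of `a < b`. -/
def inversionSign (π : C → C') (a b : C) : ℤ := if a < b ∧ π b < π a then -1 else 1

def columnSign (π : C → C') (a : C) (s : List C) : ℤ := (s.map (inversionSign π a)).prod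

def rowSign (π : C → C') : List C → ℤ
  | [] => 1
  | a :: s => columnSign π a s * rowSign π s

theorem inversionSign_sq (π : C → C') (a b : C) :
    inversionSign π a b * inversionSign π a b = 1 := by
  unfold inversionSign; split_ifs <;> simp

theorem columnSign_sq (π : C → C') (a : C) (s : List C) :
    columnSign π a s * columnSign π a s = 1 := by
  induction s with
  | nil => simp [columnSign]
  | cons b s ih =>
    simp only [columnSign, List.map_cons, List.prod_cons] at ih ⊢
    rw [mul_mul_mul_comm, ih, inversionSign_sq, one_mul]

theorem rowSign_ne_zero (π : C → C') (s : List C) : rowSign π s ≠ 0 := by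
  induction s with
  | nil => simp [rowSign]
  | cons a s ih =>
    refine mul_ne_zero (fun h => ?_) ih
    have := columnSign_sq π a s
    simp [h] at this

/-- Two neighbouring strands of equal colour contribute the same sign against any third strand, so
they leave no trace. -/
theorem rowSign_pair (π : C → C') (a : C) (s : List C) :
    rowSign π (a :: a :: s) = rowSign π s := by
  have h := columnSign_sq π a s
  simp only [rowSign]
  have h2 : columnSign π a (a :: s) = columnSign π a s := by
    simp [columnSign, inversionSign]
  rw [h2, ← mul_assoc, h, one_mul]

theorem columnSign_pair (π : C → C') (x a : C) (s : List C) :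
    columnSign π x (a :: a :: s) = columnSign π x s := by
  simp only [columnSign, List.map_cons, List.prod_cons]
  rw [← mul_assoc, inversionSign_sq, one_mul]

/-- The sign at the crossing changes exactly if π inverts the order of the two colours; transposing
these colours changes the row sign under the same condition. -/
theorem rowSign_swap {π : C → C'} (hπ : Function.Injective π) (o : Bool) (a b : C) (s : List C) :
    colourCross o (π a) (π b) * rowSign π (b :: a :: s) =
      rowSign π (a :: b :: s) * colourCross o a b := by
  by_cases hab : a = b
  · subst hab; simp [colourCross]
  · have h : colourSign o (π a) (π b) * inversionSign π b a =
        inversionSign π a b * colourSign o a b := by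
      have hab' : π a ≠ π b := hπ.ne hab
      unfold colourSign inversionSign
      rcases lt_or_gt_of_ne hab with h1 | h1 <;> rcases lt_or_gt_of_ne hab' with h2 | h2 <;>
        cases o <;> simp [h1, h2, h1.not_gt, h2.not_gt]
    simp only [colourCross, hab, hπ.ne hab, if_false, rowSign, columnSign, List.map_cons,
      List.prod_cons]
    linear_combination (s.map (inversionSign π b)).prod * (s.map (inversionSign π a)).prod *
      rowSign π s * h

/-- The third clause carries the induction on the position of the slice: a further strand on the
left multiplies row signs by column signs, and these must agree below and above the slice. -/
theorem sliceAct_recolour {π : C → C'} (hπ : Function.Injective π) (g : ℕ → C) (c : C)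
    (c' : C') (l : Slice Unit) (hc : l.isCup = true → c' = π c) (s : List C) :
    (sliceAct colourCross (colourTie (π ∘ g)) c' l (s.map π)).2 =
      (sliceAct colourCross (colourTie g) c l s).2.map π ∧
    (sliceAct colourCross (colourTie (π ∘ g)) c' l (s.map π)).1 *
      rowSign π (sliceAct colourCross (colourTie g) c l s).2 =
      rowSign π s * (sliceAct colourCross (colourTie g) c l s).1 ∧
    ((sliceAct colourCross (colourTie g) c l s).1 ≠ 0 → ∀ x,
      columnSign π x (sliceAct colourCross (colourTie g) c l s).2 = columnSign π x s) := by
  induction l using slice_induction generalizing s with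
  | hcup d => simp [sliceAct, hc rfl, rowSign_pair, columnSign_pair]
  | hcap =>
    rcases s with _ | ⟨a, _ | ⟨b, s⟩⟩ <;> simp [sliceAct, capAct, hπ.eq_iff]
    by_cases h : a = b
    · subst h; simp [rowSign_pair, columnSign_pair]
    · simp [h]
  | hcross o =>
    rcases s with _ | ⟨a, _ | ⟨b, s⟩⟩ <;> simp [sliceAct, swapAct]
    refine ⟨rowSign_swap hπ o a b s, fun _ x => ?_⟩
    simp only [columnSign, List.map_cons, List.prod_cons]
    ring
  | htie k =>
    rcases s with _ | ⟨a, s⟩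
    · simp [sliceAct, tieAct]
    · rcases k with _ | k
      · have : (s.map π).head? = some (π a) ↔ s.head? = some a := by
          cases s <;> simp [hπ.eq_iff]
        simp only [sliceAct, Function.iterate_zero, id, tieAct, colourTie, List.map_cons, this]
        simp [mul_comm]
      · simp [sliceAct, tieAct, colourTie, hπ.eq_iff, mul_comm]
  | hshift l ih =>
    rw [isCup_shift] at hc
    simp only [sliceAct_shift]
    rcases s with _ | ⟨x, s⟩
    · simp [shiftAct]
    · obtain ⟨h1, h2, h3⟩ := ih hc s
      simp only [List.map_cons, shiftAct, h1, rowSign]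
      refine ⟨trivial, ?_, ?_⟩
      · by_cases h0 : (sliceAct colourCross (colourTie g) c l s).1 = 0
        · rw [h0, mul_zero] at h2
          have := (mul_eq_zero.mp h2).resolve_right (rowSign_ne_zero π _)
          rw [this, h0]; ring
        · rw [h3 h0 x]
          linear_combination columnSign π x s * h2
      · intro h0 y
        have := h3 h0 y
        simp only [columnSign, List.map_cons, List.prod_cons] at this ⊢
        rw [this]

/-- The changes of the row sign telescope from bottom to top, where the row is empty and has sign 1.
-/
theorem colourWeight_recolour {π : C → C'} (hπ : Function.Injective π) (g : ℕ → C)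
    {w : List (Slice Unit)} (env s : List C) (hw : heightRun w s.length = some 0) :
    colourWeight (π ∘ g) w (env.map π) (s.map π) = rowSign π s * colourWeight g w env s := by
  unfold colourWeight
  induction w generalizing env s with
  | nil =>
    simp only [heightRun, Option.some.injEq, List.length_eq_zero_iff] at hw
    simp [weight, hw, rowSign]
  | cons l w ih =>
    simp only [heightRun] at hw
    obtain ⟨m, hl', hw'⟩ := Option.bind_eq_some_iff.mp hw
    cases hl : l.isCup with
    | false =>
      obtain ⟨h1, h2, -⟩ := sliceAct_recolour hπ g default default l (by simp [hl]) s
      rw [weight_cons_of_not_cup _ _ hl, weight_cons_of_not_cup _ _ hl, h1, ih _ _ (by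
        rwa [sliceAct_length _ _ _ _ hl']), ← mul_assoc, h2, mul_assoc]
    | true =>
      rcases env with _ | ⟨c, env⟩
      · simp [weight_cons_of_cup_nil _ _ hl]
      · obtain ⟨h1, h2, -⟩ := sliceAct_recolour hπ g c (π c) l (fun _ => rfl) s
        rw [List.map_cons, weight_cons_of_cup _ _ hl, weight_cons_of_cup _ _ hl, h1, ih _ _ (by
          rwa [sliceAct_length _ _ _ _ hl']), ← mul_assoc, h2, mul_assoc]

end
end
end TiedLink

/-! ### Polynomiality of the coloured state sum. -/

namespace TiedLink
open Piece Slice Direction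

/-! ### Expanding the crossings -/

section
variable {C S : Type} [Fintype C] [LinearOrder C] [Fintype S] [DecidableEq S]

/-- In the second smoothing the minimum is created to the right of the two strands before the
maximum closes them. In this order the old and the new strand are neighbours for a moment, so that
tie 0 can force the new arc to have the old colour. -/
theorem crossOp_eq (α : ℂ) (o : Bool) (g : ℕ → C) : (crossOp α o : Op (C × S)) =
    α ^ eps o • weightOp (jointTie S g) 0 +
      α ^ (-eps o) • (shiftOp (shiftOp (cupOp (C × S))) * shiftOp (weightOp (jointTie S g) 0) *
        capOp (C × S)) + swapOp jointCross o := by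
  ext φ s
  rcases s with _ | ⟨⟨a, x⟩, _ | ⟨⟨b, y⟩, s⟩⟩
  · simp [crossOp_nil, weightOp_nil, swapOp_nil, shiftOp_nil]
  · simp [crossOp_single, weightOp_cons, swapOp_single, shiftOp_nil, shiftOp_cons, jointTie,
      colourTie]
  · simp only [crossOp_cons, LinearMap.add_apply, LinearMap.smul_apply, Pi.add_apply,
      Pi.smul_apply, weightOp_cons, swapOp_cons, Module.End.mul_apply, shiftOp_cons, cupOp_apply,
      capOp_cons, smul_eq_mul, jointTie, colourTie, jointCross, colourCross, List.map_cons,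
      List.head?_cons, Option.some.injEq, Fintype.sum_prod_type, Prod.mk.injEq]
    by_cases hab : a = b
    · subst hab
      by_cases hxy : x = y
      · subst hxy; simp
      · simp [hxy]
    · simp [hab, Ne.symm hab]

/-- The words obtained by replacing every crossing by one of its two smoothings with equal colours
of the strands, or keeping it as a crossing of strands of different colours, and the exponents
of `A` that they contribute. Tie `0` is the requirement of equal colours. -/
def expand : List (Slice Unit) → List (ℤ × List (Slice Unit))
  | [] => [(0, [])]
  | piece (cross o) i :: w =>
      (expand w).map (fun x => (x.1 + eps o, tieEnd i 0 :: x.2)) ++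
      (expand w).map (fun x =>
        (x.1 - eps o, piece (cup ()) (i + 2) :: tieEnd (i + 1) 0 :: piece cap i :: x.2)) ++
      (expand w).map (fun x => (x.1, piece (cross o) i :: x.2))
  -- Raising the names of the given ties keeps the name 0 free for the test of equal colours.
  | tieEnd i k :: w => (expand w).map fun x => (x.1, tieEnd i (k + 1) :: x.2)
  | piece e i :: w => (expand w).map fun x => (x.1, piece e i :: x.2)

theorem bracketOp_expand (α : ℂ) (hα : α ≠ 0) (g : ℕ → C) (w : List (Slice Unit))
    (φ : List (C × S) → ℂ) (s : List (C × S)) : bracketOp S α g w φ s =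
      ((expand w).map fun x =>
        α ^ x.1 * wordOp (swapOp jointCross) (weightOp (jointTie S g)) x.2 φ s).sum := by
  have key : ∀ (L : Op (C × S)) (l : List (ℤ × List (Slice Unit))) (s : List (C × S)),
      L (fun s => (l.map fun x =>
        α ^ x.1 * wordOp (swapOp jointCross) (weightOp (jointTie S g)) x.2 φ s).sum) s =
        (l.map fun x =>
          α ^ x.1 * L (wordOp (swapOp jointCross) (weightOp (jointTie S g)) x.2 φ) s).sum := by
    intro L l s
    induction l with
    | nil => exact congrFun (map_zero L) s
    | cons x l ih =>
      simp only [List.map_cons, List.sum_cons]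
      rw [← ih]
      have : (fun s =>
          α ^ x.1 * wordOp (swapOp jointCross) (weightOp (jointTie S g)) x.2 φ s +
          (l.map fun x =>
            α ^ x.1 * wordOp (swapOp jointCross) (weightOp (jointTie S g)) x.2 φ s).sum) =
          α ^ x.1 • wordOp (swapOp jointCross) (weightOp (jointTie S g)) x.2 φ + fun s =>
            (l.map fun x =>
              α ^ x.1 * wordOp (swapOp jointCross) (weightOp (jointTie S g)) x.2 φ s).sum := rfl
      rw [this, map_add, map_smul]
      rfl
  have hsum : ∀ (c : ℂ) (l : List (ℤ × List (Slice Unit))) (f : ℤ × List (Slice Unit) → ℂ),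
      c * (l.map f).sum = (l.map fun x => c * f x).sum := fun c l f =>
    (List.sum_map_mul_left ..).symm
  induction w generalizing s with
  | nil => simp [bracketOp, expand, wordOp_nil]
  | cons l w ih =>
    rw [bracketOp, wordOp_cons_apply, ← bracketOp, funext ih]
    rcases l with ⟨d | _ | o, i⟩ | ⟨i, k⟩
    · rw [key]
      simp only [expand, List.map_map, Function.comp_def, wordOp_cons_apply]
      rfl
    · rw [key]
      simp only [expand, List.map_map, Function.comp_def, wordOp_cons_apply]
      rfl
    · simp only [sliceOp]
      rw [crossOp_eq α o g, shiftOp_iterate_add, shiftOp_iterate_add, shiftOp_iterate_smul,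
        shiftOp_iterate_smul, shiftOp_iterate_mul, shiftOp_iterate_mul, LinearMap.add_apply,
        LinearMap.add_apply, Pi.add_apply, Pi.add_apply,
        LinearMap.smul_apply, LinearMap.smul_apply, Pi.smul_apply, Pi.smul_apply,
        key, key, key, smul_eq_mul, smul_eq_mul, hsum, hsum]
      simp only [expand, List.map_append, List.sum_append, List.map_map, Function.comp_def,
        zpow_add₀ hα, sub_eq_add_neg, wordOp_cons_apply,
        Module.End.mul_apply, sliceOp, mul_comm, mul_left_comm, mul_assoc,
        Function.iterate_add_apply, Function.iterate_one, Function.iterate_succ_apply,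
        Function.iterate_zero, id]
    · have hT : tieOp S (g k) = weightOp (jointTie S g) (k + 1) := by
        ext φ s
        rcases s with _ | ⟨a, s⟩ <;> simp [tieOp_cons, weightOp_cons, tieOp_nil, weightOp_nil,
          jointTie, colourTie]
      rw [key]
      simp only [expand, List.map_map, Function.comp_def, wordOp_cons_apply, sliceOp, hT]

end

theorem heightRun_of_mem_expand {w : List (Slice Unit)} {n m : ℕ} (hw : heightRun w n = some m)
    {x : ℤ × List (Slice Unit)} (hx : x ∈ expand w) : heightRun x.2 n = some m := by
  induction w generalizing n x with
  | nil => simp only [expand, List.mem_singleton] at hx; rw [hx]; exact hw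
  | cons l w ih =>
    simp only [heightRun] at hw
    obtain ⟨k, hl, hw'⟩ := Option.bind_eq_some_iff.mp hw
    rcases l with ⟨d | _ | o, i⟩ | ⟨i, j⟩
    · simp only [expand, List.mem_map] at hx
      obtain ⟨y, hy, rfl⟩ := hx
      simp [heightRun, hl, ih hw' hy]
    · simp only [expand, List.mem_map] at hx
      obtain ⟨y, hy, rfl⟩ := hx
      simp [heightRun, hl, ih hw' hy]
    · simp only [expand, List.mem_append, List.mem_map] at hx
      simp only [heightStep] at hl
      split_ifs at hl with hi
      simp only [Option.some.injEq] at hl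
      subst hl
      rcases hx with (⟨y, hy, rfl⟩ | ⟨y, hy, rfl⟩) | ⟨y, hy, rfl⟩
      · have := ih (x := y) hw' hy
        simpa [heightRun, heightStep, show i < n by omega] using this
      · have := ih (x := y) hw' hy
        simpa [heightRun, heightStep, hi, show i + 1 < n + 2 by omega,
          show i + 2 ≤ n + 2 by omega] using this
      · have := ih (x := y) hw' hy
        simpa [heightRun, heightStep, hi] using this
    · simp only [expand, List.mem_map] at hx
      obtain ⟨y, hy, rfl⟩ := hx
      have := ih hw' hy
      simp only [heightStep] at hl
      split_ifs at hl with hi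
      simp only [Option.some.injEq] at hl
      subst hl
      simpa [heightRun, heightStep, hi] using this

theorem tieOccurs_of_mem_expand {w : List (Slice Unit)} {x : ℤ × List (Slice Unit)}
    (hx : x ∈ expand w) (k : ℕ) : TieOccurs x.2 (k + 1) ↔ TieOccurs w k := by
  induction w generalizing x with
  | nil => simp only [expand, List.mem_singleton] at hx; simp [hx, TieOccurs]
  | cons l w ih =>
    unfold TieOccurs at ih ⊢
    rcases l with ⟨d | _ | o, i⟩ | ⟨i, j⟩ <;>
      simp only [expand, List.mem_map, List.mem_append] at hx
    · obtain ⟨y, hy, rfl⟩ := hx; simpa using ih hy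
    · obtain ⟨y, hy, rfl⟩ := hx; simpa using ih hy
    · rcases hx with (⟨y, hy, rfl⟩ | ⟨y, hy, rfl⟩) | ⟨y, hy, rfl⟩ <;> simpa using ih hy
    · obtain ⟨y, hy, rfl⟩ := hx
      simp only [List.mem_cons, tieEnd.injEq, exists_or, ih hy]
      simp

/-! ### Colours of the ties -/

section
variable {C : Type}

/-- Gives the colours `cs` to the ties with names `ks`. -/
def assign : List ℕ → List C → (ℕ → C) → ℕ → C
  | k :: ks, c :: cs, g => assign ks cs (Function.update g k c)
  | _, _, g => g

theorem comp_assign {C' : Type} (π : C → C') (ks : List ℕ) (cs : List C) (g : ℕ → C) :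
    π ∘ assign ks cs g = assign ks (cs.map π) (π ∘ g) := by
  induction ks generalizing cs g with
  | nil => rfl
  | cons k ks ih =>
    rcases cs with _ | ⟨c, cs⟩
    · rfl
    · simp [assign, ih, Function.comp_update]

theorem assign_apply_of_notMem {ks : List ℕ} (cs : List C) (g : ℕ → C) {k : ℕ} (hk : k ∉ ks) :
    assign ks cs g k = g k := by
  induction ks generalizing cs g with
  | nil => rfl
  | cons l ks ih =>
    simp only [List.mem_cons, not_or] at hk
    rcases cs with _ | ⟨c, cs⟩
    · rfl
    · simp [assign, ih _ _ hk.2, hk.1]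

theorem assign_congr {ks : List ℕ} {cs : List C} (h : cs.length = ks.length) {g g' : ℕ → C}
    {k : ℕ} (hk : k ∈ ks ∨ g k = g' k) : assign ks cs g k = assign ks cs g' k := by
  induction ks generalizing cs g g' with
  | nil => simpa [assign] using hk
  | cons l ks ih =>
    rcases cs with _ | ⟨c, cs⟩
    · simp at h
    · refine ih (by simpa using h) ?_
      by_cases hl : k = l
      · subst hl; simp
      · simpa [hl] using hk

theorem exists_assign_eq {ks : List ℕ} (hks : ks.Nodup) {cs : List C}
    (h : cs.length = ks.length) (g : ℕ → C) {c : C} (hc : c ∈ cs) :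
    ∃ k ∈ ks, assign ks cs g k = c := by
  induction ks generalizing cs g with
  | nil => simp at h; simp [h] at hc
  | cons l ks ih =>
    rcases cs with _ | ⟨c', cs⟩
    · simp at hc
    · rw [List.nodup_cons] at hks
      rcases List.mem_cons.mp hc with rfl | hc
      · exact ⟨l, by simp, by simp [assign, assign_apply_of_notMem _ _ hks.1]⟩
      · obtain ⟨k, hk, h⟩ := ih hks.2 (by simpa using h) (Function.update g l c') hc
        exact ⟨k, by simp [hk], h⟩

variable [LinearOrder C] [Inhabited C]

theorem sliceAct_colour_congr {g g' : ℕ → C} (c : C) (l : Slice Unit)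
    (h : ∀ i k, l = tieEnd i (k + 1) → g k = g' k) (s : List C) :
    sliceAct colourCross (colourTie g) c l s = sliceAct colourCross (colourTie g') c l s := by
  rcases l with ⟨d | _ | o, i⟩ | ⟨i, k⟩
  · rfl
  · rfl
  · rfl
  · have : tieAct (colourTie g) k = tieAct (colourTie g') k := by
      rcases k with _ | k
      · rfl
      · funext s
        rcases s with _ | ⟨a, s⟩
        · rfl
        · simp [tieAct, colourTie, h i k rfl]
    simp only [sliceAct, this]

theorem colourWeight_congr {g g' : ℕ → C} {w : List (Slice Unit)}
    (h : ∀ k, TieOccurs w (k + 1) → g k = g' k) (env s : List C) :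
    colourWeight g w env s = colourWeight g' w env s := by
  unfold colourWeight
  induction w generalizing env s with
  | nil => rfl
  | cons l w ih =>
    have h1 := fun c => sliceAct_colour_congr (g := g) (g' := g') c l (fun i k hl => h k ⟨i, by simp [hl]⟩)
    have h2 := fun k (hk : TieOccurs w (k + 1)) => h k (by
      obtain ⟨i, hi⟩ := hk; exact ⟨i, by simp [hi]⟩)
    cases hl : l.isCup with
    | false => rw [weight_cons_of_not_cup _ _ hl, weight_cons_of_not_cup _ _ hl, h1, ih h2]
    | true =>
      rcases env with _ | ⟨c, env⟩
      · simp [weight_cons_of_cup_nil _ _ hl]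
      · rw [weight_cons_of_cup _ _ hl, weight_cons_of_cup _ _ hl, h1, ih h2]

/-- In a labelling of nonzero weight the ties have colours of strands. -/
theorem mem_of_colourWeight_ne_zero {g : ℕ → C} {w : List (Slice Unit)} {env s : List C}
    (h : colourWeight g w env s ≠ 0) {k : ℕ} (hk : TieOccurs w (k + 1)) :
    g k ∈ env ∨ g k ∈ s := by
  have slice : ∀ (i : ℕ) (s : List C),
      (shiftAct^[i] (tieAct (colourTie g) (k + 1)) s).1 ≠ 0 → g k ∈ s := by
    intro i
    induction i with
    | zero =>
      rintro (_ | ⟨a, s⟩) <;> simp [tieAct, colourTie]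
      rintro rfl; simp
    | succ i ih =>
      rw [Function.iterate_succ_apply']
      rintro (_ | ⟨a, s⟩)
      · simp [shiftAct]
      · intro h; exact List.mem_cons_of_mem _ (ih s h)
  unfold colourWeight at h
  induction w generalizing env s with
  | nil => obtain ⟨i, hi⟩ := hk; simp at hi
  | cons l w ih =>
    obtain ⟨i, hi⟩ := hk
    rcases List.mem_cons.mp hi with rfl | hi
    · rw [weight_cons_of_not_cup _ _ rfl] at h
      exact Or.inr (slice i s (left_ne_zero_of_mul h))
    · cases hl : l.isCup with
      | false =>
        rw [weight_cons_of_not_cup _ _ hl] at h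
        refine (ih (right_ne_zero_of_mul h) ⟨i, hi⟩).imp_right fun h => ?_
        simpa [hl] using sliceAct_mem _ _ _ _ h
      | true =>
        rcases env with _ | ⟨c, env⟩
        · simp [weight_cons_of_cup_nil _ _ hl] at h
        · rw [weight_cons_of_cup _ _ hl] at h
          rcases ih (right_ne_zero_of_mul h) ⟨i, hi⟩ with h | h
          · simp [h]
          · rcases sliceAct_mem _ _ _ _ h with h | ⟨-, h⟩ <;> simp [h]

end

/-! ### Sums over the colours of the ties -/

section
variable {C R : Type} [Fintype C] [CommRing R]

/-- This frees sums over tie colours from the arbitrary enumeration of the names. -/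
theorem sumLists_assign_perm {ks ks' : List ℕ} (h : ks.Perm ks') (F : (ℕ → C) → R) (g : ℕ → C) :
    sumLists Finset.univ ks.length (fun cs => F (assign ks cs g)) =
      sumLists Finset.univ ks'.length fun cs => F (assign ks' cs g) := by
  induction h generalizing g with
  | nil => rfl
  | cons k _ ih => exact Finset.sum_congr rfl fun c _ => ih _
  | swap k l ks =>
    simp only [List.length_cons, sumLists, assign]
    by_cases h : k = l
    · subst h; rfl
    · rw [Finset.sum_comm]
      simp only [Function.update_comm h]
  | trans _ _ ih1 ih2 => rw [ih1, ih2]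

def Slice.tieName : Slice Unit → Option ℕ
  | tieEnd _ k => some k
  | _ => none

def tieNames (w : List (Slice Unit)) : Finset ℕ := (w.filterMap Slice.tieName).toFinset

theorem mem_tieNames {w : List (Slice Unit)} {k : ℕ} : k ∈ tieNames w ↔ TieOccurs w k := by
  simp only [tieNames, List.mem_toFinset, List.mem_filterMap, TieOccurs]
  constructor
  · rintro ⟨⟨e, i⟩ | ⟨i, k⟩, hl, h⟩
    · simp [Slice.tieName] at h
    · simp only [Slice.tieName, Option.some.injEq] at h; subst h; exact ⟨i, hl⟩
  · rintro ⟨i, h⟩; exact ⟨_, h, rfl⟩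

variable [Inhabited C]

/-- The sum of `F g` over all ways `g` of giving colours to the ties with names in `ks`. -/
noncomputable def colourSum (ks : Finset ℕ) (F : (ℕ → C) → R) : R :=
  sumLists Finset.univ ks.toList.length fun cs => F (assign ks.toList cs fun _ => default)

theorem colourSum_congr (ks : Finset ℕ) {F G : (ℕ → C) → R} (h : ∀ g, F g = G g) :
    colourSum ks F = colourSum ks G := by
  rw [funext h]

theorem colourSum_mul (ks : Finset ℕ) (c : R) (F : (ℕ → C) → R) :
    colourSum ks (fun g => c * F g) = c * colourSum ks F := sumLists_mul ..

theorem colourSum_add (ks : Finset ℕ) (F G : (ℕ → C) → R) :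
    colourSum ks (fun g => F g + G g) = colourSum ks F + colourSum ks G := by
  unfold colourSum
  generalize (fun _ => default : ℕ → C) = g
  generalize ks.toList = l
  induction l generalizing g with
  | nil => rfl
  | cons k l ih => simp only [List.length_cons, sumLists, assign, ih, Finset.sum_add_distrib]

/-- A fresh tie contributes one further summation, over its own colour. Rule 6 and the creation of a
new tie rest on this. -/
theorem colourSum_insert {ks : Finset ℕ} {k : ℕ} (hk : k ∉ ks) (F : (ℕ → C) → R) :
    colourSum (insert k ks) F = colourSum ks fun g => ∑ c, F (Function.update g k c) := by
  have h : ∀ (l : List ℕ) (g : ℕ → C), k ∉ l → ∑ c, sumLists Finset.univ l.length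
      (fun cs => F (assign l cs (Function.update g k c))) =
      sumLists Finset.univ l.length fun cs => ∑ c, F (Function.update (assign l cs g) k c) := by
    intro l
    induction l with
    | nil => intro g _; rfl
    | cons j l ih =>
      intro g hj
      simp only [List.mem_cons, not_or] at hj
      simp only [List.length_cons, sumLists, assign]
      rw [Finset.sum_comm]
      simp only [Function.update_comm hj.1, ih _ hj.2]
  unfold colourSum
  rw [sumLists_assign_perm (Finset.toList_insert hk)]
  exact h _ _ (by simpa using hk)

end

/-- The coloured state sum of a closed word. -/
noncomputable def stateSum (N M : ℕ) (w : List (Slice Unit)) : ℂ :=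
  colourSum (tieNames w) fun g : ℕ → Fin (N + 1) =>
    bracketOp (Fin (M + 1)) (loopRoot M : ℂ) g w (fun _ => 1) []

theorem plainWeight_sum (S : Type) [Fintype S] [DecidableEq S] [Inhabited S]
    {w : List (Slice Unit)} (hw : heightRun w 0 = some 0) :
    sumLists Finset.univ (cupCount w) (fun env : List S => plainWeight w env []) =
      (Fintype.card S : ℤ) ^ componentCount w := by
  have h := wordOp_eq_sumLists (fun _ (_ _ : S) => 1) (fun _ _ _ => 1) w []
  have h2 := countOp_closed (K := S) hw
  rw [countOp, h] at h2
  unfold plainWeight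
  exact_mod_cast h2

theorem exists_polynomial_of_word {w : List (Slice Unit)} (hw : heightRun w 0 = some 0)
    (h0 : 0 < cupCount w) {ks : Finset ℕ} (hks : ∀ k, TieOccurs w (k + 1) ↔ k ∈ ks) :
    ∃ P : RingAc, ∀ N M : ℕ, (N + 1) * (M + 1) * evalAc N M P =
      colourSum ks fun g : ℕ → Fin (N + 1) => wordOp (swapOp jointCross)
        (weightOp (jointTie (Fin (M + 1)) g)) w (fun _ => 1) [] := by
  have hlist : ∀ k, TieOccurs w (k + 1) → k ∈ ks.toList := fun k hk =>
    Finset.mem_toList.mpr ((hks k).mp hk)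
  set l := ks.toList with hl
  have hnd : l.Nodup := Finset.nodup_toList ks
  have recolour : ∀ {C C' : Type} [LinearOrder C] [LinearOrder C'] [Inhabited C] [Inhabited C']
      (π : C → C'), Function.Injective π → ∀ (cs env : List C), cs.length = l.length →
      colourWeight (assign l (cs.map π) fun _ => default) w (env.map π) [] =
        colourWeight (assign l cs fun _ => default) w env [] := by
    intro C C' _ _ _ _ π hπ cs env hcs
    have := colourWeight_recolour hπ (assign l cs fun _ => default) env [] hw
    rw [comp_assign] at this
    simp only [rowSign, one_mul, List.map_nil] at this
    rw [← this]
    -- The injection need not preserve the default colour, but names that do not occur in the word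
    -- have no influence.
    exact colourWeight_congr (fun k hk => assign_congr (by simpa using hcs)
      (Or.inl (hlist k hk))) _ _
  -- Natural numbers as colours give one weight for all N. The first entries of the list colour the
  -- ties, the remaining ones the minima.
  set W : List ℕ → ℤ := fun s =>
    colourWeight (assign l (s.take l.length) fun _ => default) w (s.drop l.length) [] with hWdef
  have hsymm : ∀ s, s.length = l.length + cupCount w → ∀ π : Equiv.Perm ℕ,
      W (s.map π) = W s := by
    intro s hs π
    simp only [hWdef, ← List.map_take, ← List.map_drop]
    exact recolour π π.injective _ _ (by simp [hs])
  have hbound : ∀ s k, s.length = l.length + cupCount w → W s ≠ 0 → (∀ c < k, c ∈ s) →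
      k ≤ componentCount w := by
    intro s k hs hW hk
    -- When the weight is nonzero, the colour of a tie is also the colour of a strand, so ties do
    -- not add to the number of colours.
    have hmem : ∀ c < k, c ∈ s.drop l.length := by
      intro c hc
      have := hk c hc
      rw [← List.take_append_drop l.length s] at this
      rcases List.mem_append.mp this with h | h
      · obtain ⟨j, hj, h⟩ := exists_assign_eq hnd (by simp [hs]) (fun _ => default) h
        have := mem_of_colourWeight_ne_zero hW ((hks j).mpr (Finset.mem_toList.mp hj))
        rw [h] at this
        simpa using this
      · exact h
    -- There are 2^e two-valued labellings of the e components, and `k` colours produce 2^k of them.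
    have h2 := two_pow_le_sumLists (n := cupCount w) (fun env => plainWeight w env [])
      (fun env => plainWeight_nonneg _ _ _) (p := s.drop l.length) (by simp [hs]) hmem
      fun θ => plainWeight_map (S := Bool) hW θ
    rw [plainWeight_sum Bool hw] at h2
    exact (Nat.pow_le_pow_iff_right (by norm_num : 1 < 2)).mp (by exact_mod_cast h2)
  obtain ⟨P, hP⟩ := exists_polynomial_of_symmetric (by omega) hsymm hbound
  refine ⟨P, fun N M => ?_⟩
  rw [hP, ← sumLists_map Finset.univ (Finset.range (N + 1)) (Fin.val : Fin (N + 1) → ℕ)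
    Fin.val_injective (fun b => by simp [Fin.exists_iff]) , sumLists_add]
  have h1 : ∀ g : ℕ → Fin (N + 1), wordOp (swapOp jointCross)
      (weightOp (jointTie (Fin (M + 1)) g)) w (fun _ => 1) [] = (M + 1 : ℂ) ^ componentCount w *
      ((sumLists Finset.univ (cupCount w) fun env => colourWeight g w env [] : ℤ) : ℂ) := by
    intro g
    rw [wordOp_eq_sumLists]
    simp only [weight_joint, List.map_nil]
    rw [sumLists_prod (F := fun env => colourWeight g w env [])
      (G := fun env => plainWeight w env []), plainWeight_sum _ hw]
    push_cast
    simp [mul_comm]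
  simp only [h1]
  rw [colourSum_mul]
  congr 1
  have hcast : ∀ (n : ℕ) (F : List (Fin (N + 1)) → ℤ),
      ((sumLists Finset.univ n F : ℤ) : ℂ) = sumLists Finset.univ n fun s => (F s : ℂ) := by
    intro n
    induction n with
    | zero => intro F; rfl
    | succ n ih => intro F; simp only [sumLists, Int.cast_sum, ih]
  rw [hcast, colourSum]
  refine sumLists_congr _ fun cs hcs => ?_
  congr 1
  refine sumLists_congr _ fun env henv => ?_
  simp only [List.map_append]
  simp only [hWdef]
  rw [List.take_left' (by simpa using hcs), List.drop_left' (by simpa using hcs)]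
  exact recolour _ Fin.val_injective cs env hcs

theorem exists_polynomial_stateSum {w : List (Slice Unit)} (hw : heightRun w 0 = some 0)
    (h0 : w ≠ []) :
    ∃ P : RingAc, ∀ N M : ℕ, (N + 1) * (M + 1) * evalAc N M P = stateSum N M w := by
  have key : ∀ l : List (ℤ × List (Slice Unit)), (∀ x ∈ l, x ∈ expand w) →
      ∃ P : RingAc, ∀ N M : ℕ, (N + 1) * (M + 1) * evalAc N M P =
        colourSum (tieNames w) fun g : ℕ → Fin (N + 1) => (l.map fun x =>
          (loopRoot M : ℂ) ^ x.1 * wordOp (swapOp jointCross)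
            (weightOp (jointTie (Fin (M + 1)) g)) x.2 (fun _ => 1) []).sum := by
    intro l
    induction l with
    | nil =>
      refine fun _ => ⟨0, fun N M => ?_⟩
      have := colourSum_mul (tieNames w) (0 : ℂ) fun g : ℕ → Fin (N + 1) => 1
      simp only [zero_mul] at this
      simpa using this.symm
    | cons x l ih =>
      intro hl
      obtain ⟨P, hP⟩ := ih fun x hx => hl x (by simp [hx])
      have hx := hl x (by simp)
      obtain ⟨Q, hQ⟩ := exists_polynomial_of_word (heightRun_of_mem_expand hw hx) (by
          obtain ⟨d, v, rfl⟩ := exists_cup_of_closed h0 hw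
          simp only [expand, List.mem_map] at hx
          obtain ⟨y, -, rfl⟩ := hx
          simp [cupCount, Slice.isCup])
        (ks := tieNames w) fun k => by rw [mem_tieNames, tieOccurs_of_mem_expand hx]
      refine ⟨Polynomial.C (A x.1) * Q + P, fun N M => ?_⟩
      simp only [List.map_cons, List.sum_cons]
      rw [colourSum_add, colourSum_mul, ← hP, ← hQ, map_add, map_mul, evalAc_C, evalA_A]
      ring
  obtain ⟨P, hP⟩ := key (expand w) fun x hx => hx
  refine ⟨P, fun N M => ?_⟩
  rw [hP, stateSum]
  exact colourSum_congr _ fun g => (bracketOp_expand _ (loopRoot M).ne_zero _ _ _ _).symm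

end TiedLink

/-! ### The rules 1–6 for the constructed bracket. -/

namespace TiedLink
open Piece Slice Direction

/-! ### The bracket polynomial for tied links -/

theorem tieOccurs_append {u v : List (Slice Unit)} {k : ℕ} :
    TieOccurs (u ++ v) k ↔ TieOccurs u k ∨ TieOccurs v k := by
  simp [TieOccurs, exists_or]

theorem tieOccurs_cons_tieEnd {v : List (Slice Unit)} {i j k : ℕ} :
    TieOccurs (tieEnd i j :: v) k ↔ k = j ∨ TieOccurs v k := by
  simp [TieOccurs, exists_or]

theorem tieOccurs_cons_piece {v : List (Slice Unit)} {e : Piece Unit} {i k : ℕ} :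
    TieOccurs (piece e i :: v) k ↔ TieOccurs v k := by
  simp [TieOccurs]

theorem tieOccurs_nil {k : ℕ} : ¬ TieOccurs ([] : List (Slice Unit)) k := by
  simp [TieOccurs]

theorem tieOccurs_map_shift {v : List (Slice Unit)} {k : ℕ} :
    TieOccurs (v.map Slice.shift) k ↔ TieOccurs v k := by
  induction v with
  | nil => rfl
  | cons l v ih =>
    rcases l with ⟨e, i⟩ | ⟨i, j⟩
    · simp [Slice.shift, tieOccurs_cons_piece, ih]
    · simp [Slice.shift, tieOccurs_cons_tieEnd, ih]

theorem tieNames_congr {w w' : List (Slice Unit)} (h : ∀ k, TieOccurs w k ↔ TieOccurs w' k) :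
    tieNames w = tieNames w' := by
  ext k; rw [mem_tieNames, mem_tieNames, h]

theorem tieNames_regularMove {w w' : List (Slice Unit)} (h : RegularMove w w') :
    tieNames w = tieNames w' := by
  refine tieNames_congr fun k => ?_
  rcases h with ⟨u, v, _, _, h⟩ | ⟨u, v, _, _, h⟩ | ⟨u, v, _, _, h⟩ | ⟨T, d, h⟩
  · cases h <;> simp [tieOccurs_append, tieOccurs_cons_piece]
  · cases h; simp [tieOccurs_append, tieOccurs_cons_piece]
  · cases h; simp [tieOccurs_append, tieOccurs_cons_piece]
  · simp [tieOccurs_append, tieOccurs_cons_piece, tieOccurs_map_shift]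

section
variable {C S : Type} [Fintype C] [LinearOrder C] [Fintype S] [DecidableEq S]

theorem bracketOp_colours (α : ℂ) {g g' : ℕ → C} {w : List (Slice Unit)}
    (h : ∀ k, TieOccurs w k → g k = g' k) : bracketOp S α g w = bracketOp S α g' w := by
  unfold bracketOp
  induction w with
  | nil => rfl
  | cons l w ih =>
    rw [wordOp_cons, wordOp_cons, ih fun k hk => h k (by
      obtain ⟨i, hi⟩ := hk; exact ⟨i, by simp [hi]⟩)]
    rcases l with ⟨d | _ | o, i⟩ | ⟨i, k⟩
    · rfl
    · rfl
    · rfl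
    · simp only [sliceOp, h k ⟨i, by simp⟩]

theorem bracketOp_combination {α : ℂ} {g : ℕ → C} {u m m₁ m₂ v : List (Slice Unit)} {n : ℕ}
    (hu : heightRun u 0 = some n) (c₁ c₂ : ℂ)
    (h : ∀ (φ : List (C × S) → ℂ) (s : List (C × S)), s.length = n → bracketOp S α g m φ s =
      c₁ * bracketOp S α g m₁ φ s + c₂ * bracketOp S α g m₂ φ s) (φ : List (C × S) → ℂ) :
    bracketOp S α g (u ++ m ++ v) φ [] = c₁ * bracketOp S α g (u ++ m₁ ++ v) φ [] +
      c₂ * bracketOp S α g (u ++ m₂ ++ v) φ [] := by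
  simp only [List.append_assoc, bracketOp_append]
  rw [bracketOp_congr_length α g u (ψ := c₁ • bracketOp S α g m₁ (bracketOp S α g v φ) +
    c₂ • bracketOp S α g m₂ (bracketOp S α g v φ)), map_add, map_smul, map_smul]
  · rfl
  · intro s' hs'
    simp only [List.length_nil, hu, Option.some.injEq] at hs'
    exact h _ s' hs'.symm

theorem bracketOp_circle (α : ℂ) (g : ℕ → C) (d : Unit) (i : ℕ) (φ : List (C × S) → ℂ)
    (s : List (C × S)) (hs : i ≤ s.length) : bracketOp S α g [piece (cup d) i, piece cap i] φ s =
      (Fintype.card C * Fintype.card S : ℂ) * φ s := by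
  rw [bracketOp_pair]
  simp only [sliceOp]
  rw [← shiftOp_iterate_mul, circleOp, shiftOp_iterate_smul, LinearMap.smul_apply, Pi.smul_apply,
    shiftOp_iterate_one i φ s hs]
  simp

theorem sum_sum_ite_eq (c : C) (f : C → S → ℂ) :
    (∑ x, ∑ y, if x = c then f x y else 0) = ∑ y, f c y := by
  rw [Finset.sum_comm]; simp

/-- The tie fixes the colour of the circle and only its spin remains free. -/
theorem bracketOp_tiedCircle (α : ℂ) (g : ℕ → C) (d : Unit) (i k : ℕ) (φ : List (C × S) → ℂ)
    (s : List (C × S)) (hs : i ≤ s.length) :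
    bracketOp S α g [piece (cup d) i, tieEnd i k, piece cap i] φ s =
      (Fintype.card S : ℂ) * φ s := by
  rw [bracketOp_triple]
  simp only [sliceOp]
  have : cupOp (C × S) * (tieOp S (g k) * capOp (C × S)) =
      (Fintype.card S : ℂ) • (1 : Op (C × S)) := by
    ext φ s
    simp [cupOp_apply, tieOp_cons, capOp_cons, Fintype.sum_prod_type, sum_sum_ite_eq]
  rw [← mul_assoc] at this
  rw [← shiftOp_iterate_mul, ← shiftOp_iterate_mul, this, shiftOp_iterate_smul, LinearMap.smul_apply,
    Pi.smul_apply, shiftOp_iterate_one i φ s hs]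
  simp

theorem bracketOp_tieEnd (α : ℂ) (g : ℕ → C) (i k : ℕ) (φ : List (C × S) → ℂ)
    (s : List (C × S)) : bracketOp S α g [tieEnd i k] φ s =
      if (s.map Prod.fst)[i]? = some (g k) then φ s else 0 := by
  have : bracketOp S α g [tieEnd i k] = shiftOp^[i] (tieOp S (g k)) := by
    simp [bracketOp, wordOp, sliceOp]
  rw [this]
  clear this
  induction i generalizing φ s with
  | zero => rcases s with _ | ⟨a, s⟩ <;> simp [tieOp_cons, tieOp_nil]
  | succ i ih =>
    rw [Function.iterate_succ_apply']
    rcases s with _ | ⟨a, s⟩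
    · simp [shiftOp_nil]
    · rw [shiftOp_cons, ih]; simp

theorem bracketOp_tiedCrossing (α : ℂ) (g : ℕ → C) (o : Bool) (i k : ℕ) (φ : List (C × S) → ℂ) (s : List (C × S)) :
    bracketOp S α g [tieEnd i k, tieEnd (i + 1) k, piece (cross o) i] φ s =
      α ^ eps o * bracketOp S α g [tieEnd i k, tieEnd (i + 1) k] φ s +
      α ^ (-eps o) * bracketOp S α g [tieEnd i k, tieEnd (i + 1) k,
        piece cap i, piece (cup ()) i, tieEnd i k] φ s := by
  have key : tieOp S (g k) * shiftOp (tieOp S (g k)) * crossOp α o =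
      α ^ eps o • (tieOp S (g k) * shiftOp (tieOp S (g k))) +
      α ^ (-eps o) • (tieOp S (g k) * shiftOp (tieOp S (g k)) * capOp (C × S) * cupOp (C × S) *
        tieOp S (g k)) := by
    ext φ s
    rcases s with _ | ⟨⟨a, x⟩, _ | ⟨⟨b, y⟩, s⟩⟩
    · simp [tieOp_nil]
    · simp [tieOp_cons, shiftOp_nil, shiftOp_cons, tieOp_nil]
    · simp only [Module.End.mul_apply, LinearMap.add_apply, LinearMap.smul_apply, Pi.add_apply,
        Pi.smul_apply, tieOp_cons, shiftOp_cons, crossOp_cons, capOp_cons, cupOp_apply,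
        smul_eq_mul, Fintype.sum_prod_type]
      by_cases ha : a = g k
      · by_cases hb : b = g k
        · subst ha hb; by_cases hxy : x = y <;> simp [hxy, sum_sum_ite_eq]
        · simp [hb]
      · simp [ha]
  have h1 : bracketOp S α g [tieEnd i k, tieEnd (i + 1) k, piece (cross o) i] =
      shiftOp^[i] (tieOp S (g k) * shiftOp (tieOp S (g k)) * crossOp α o) := by
    simp [bracketOp, wordOp, sliceOp, shiftOp_iterate_mul, mul_assoc]
  have h2 : bracketOp S α g [tieEnd i k, tieEnd (i + 1) k] =
      shiftOp^[i] (tieOp S (g k) * shiftOp (tieOp S (g k))) := by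
    simp [bracketOp, wordOp, sliceOp, shiftOp_iterate_mul, mul_assoc]
  have h3 : bracketOp S α g [tieEnd i k, tieEnd (i + 1) k,
        piece cap i, piece (cup ()) i, tieEnd i k] =
      shiftOp^[i] (tieOp S (g k) * shiftOp (tieOp S (g k)) * capOp (C × S) * cupOp (C × S) *
        tieOp S (g k)) := by
    simp [bracketOp, wordOp, sliceOp, shiftOp_iterate_mul, mul_assoc]
  rw [h1, h2, h3, key, shiftOp_iterate_add, shiftOp_iterate_smul, shiftOp_iterate_smul]
  rfl

/-- The skein relation for a new tie `k`. -/
theorem bracketOp_crossing (α : ℂ) (g : ℕ → C) (i k : ℕ) :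
    bracketOp S α g [piece (cross true) i] + bracketOp S α g [piece (cross false) i] =
      (α + α⁻¹) • ∑ c, (bracketOp S α (Function.update g k c) [tieEnd i k, tieEnd (i + 1) k] +
        bracketOp S α (Function.update g k c)
          [tieEnd i k, piece cap i, piece (cup ()) i, tieEnd i k]) := by
  have key : crossOp α true + crossOp α false = (α + α⁻¹) • ∑ c : C,
      (tieOp S c * shiftOp (tieOp S c) + tieOp S c * capOp (C × S) * cupOp (C × S) *
        tieOp S c) := by
    ext φ s
    rcases s with _ | ⟨⟨a, x⟩, _ | ⟨⟨b, y⟩, s⟩⟩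
    · simp [tieOp_nil, crossOp_nil]
    · simp [tieOp_cons, shiftOp_nil, shiftOp_cons, tieOp_nil, crossOp_single, capOp_single]
    · simp only [Module.End.mul_apply, LinearMap.add_apply, LinearMap.smul_apply, Pi.add_apply,
        Pi.smul_apply, tieOp_cons, shiftOp_cons, crossOp_cons, capOp_cons, cupOp_apply,
        smul_eq_mul, Fintype.sum_prod_type, LinearMap.sum_apply, Finset.sum_apply]
      by_cases hab : a = b
      · subst hab
        by_cases hxy : x = y
        · subst hxy
          simp [eps, Finset.sum_add_distrib, sum_sum_ite_eq]
          ring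
        · simp [hxy, eps]
          ring
      -- On the left the opposite signs cancel. On the right nothing remains either, since strands
      -- of different colours cannot both have the colour of the tie.
      · have h0 : (colourSign true a b : ℂ) + colourSign false a b = 0 := by
          unfold colourSign
          rcases lt_or_gt_of_ne hab with h | h <;> simp [h, h.not_gt]
        have h1 : ∀ c, (if a = c then if b = c then φ ((a, x) :: (b, y) :: s) else 0 else 0) = 0 := by
          intro c
          by_cases h : a = c
          · subst h; simp [Ne.symm hab]
          · simp [h]
        simp only [hab, if_false, h1, Prod.mk.injEq, false_and, ite_self, add_zero,
          Finset.sum_const_zero, mul_zero]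
        linear_combination φ ((b, y) :: (a, x) :: s) * h0
  have h1 : ∀ o, bracketOp S α g [piece (cross o) i] = shiftOp^[i] (crossOp α o) := by
    intro o; simp [bracketOp, wordOp, sliceOp]
  have h2 : ∀ c, bracketOp S α (Function.update g k c) [tieEnd i k, tieEnd (i + 1) k] =
      shiftOp^[i] (tieOp S c * shiftOp (tieOp S c)) := by
    intro c; simp [bracketOp, wordOp, sliceOp, shiftOp_iterate_mul]
  have h3 : ∀ c, bracketOp S α (Function.update g k c)
      [tieEnd i k, piece cap i, piece (cup ()) i, tieEnd i k] =
      shiftOp^[i] (tieOp S c * capOp (C × S) * cupOp (C × S) * tieOp S c) := by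
    intro c; simp [bracketOp, wordOp, sliceOp, shiftOp_iterate_mul, mul_assoc]
  rw [h1, h1, ← shiftOp_iterate_add, key, shiftOp_iterate_smul, shiftOp_iterate_sum]
  simp only [shiftOp_iterate_add, h2, h3]

end

theorem exists_tiedBracket (D : TiedDiagram Unit) : ∃ P : RingAc, ∀ N M : ℕ,
    (N + 1) * (M + 1) * evalAc N M P = stateSum N M D.word :=
  exists_polynomial_stateSum ((closed_iff _).mp D.closed) D.nonempty

/-- The choice is harmless, because the values at all N and M determine the polynomial. -/
noncomputable def tiedBracket (D : TiedDiagram Unit) : RingAc := (exists_tiedBracket D).choose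

theorem tiedBracket_spec (D : TiedDiagram Unit) (N M : ℕ) :
    (N + 1) * (M + 1) * evalAc N M (tiedBracket D) = stateSum N M D.word :=
  (exists_tiedBracket D).choose_spec N M

theorem evalAc_ext_mul {p q : RingAc} (h : ∀ N M : ℕ, ((N : ℂ) + 1) * (M + 1) * evalAc N M p =
    (N + 1) * (M + 1) * evalAc N M q) : p = q :=
  evalAc_ext fun N M => mul_left_cancel₀
    (mul_ne_zero (cast_succ_ne_zero N) (cast_succ_ne_zero M)) (h N M)

theorem tiedBracket_congr {D D' : TiedDiagram Unit}
    (h : ∀ N M, stateSum N M D.word = stateSum N M D'.word) : tiedBracket D = tiedBracket D' :=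
  evalAc_ext_mul fun N M => by rw [tiedBracket_spec, tiedBracket_spec, h]

theorem TiedDiagram.heightRun_word (D : TiedDiagram Unit) : heightRun D.word 0 = some 0 :=
  (closed_iff _).mp D.closed

theorem stateSum_tieMove (N M : ℕ) {w w' : List (Slice Unit)} (hw : heightRun w' 0 = some 0)
    (h : TieMove w w') : stateSum N M w = stateSum N M w' := by
  obtain ⟨u, v, i, k, h⟩ := h
  obtain ⟨n, hu, hv⟩ := heightRun_append_eq hw
  have hi : i < n := by
    simp only [heightRun, heightStep] at hv
    by_contra hi
    simp [hi] at hv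
  have hlen : ∀ (C S : Type) (g : ℕ → C) (s' : List (C × S)),
      heightRun u ([] : List (C × S)).length = some s'.length → i < s'.length := by
    intro C S g s' hs'
    simp only [List.length_nil, hu, Option.some.injEq] at hs'
    omega
  -- If the name is already in use, the new condition on colours is redundant: wherever the summand
  -- is nonzero, it follows from the labels being constant on the tied class.
  by_cases hk : TieOccurs (u ++ v) k
  · unfold stateSum
    rw [tieNames_congr (w := u ++ v) (w' := u ++ tieEnd i k :: v) fun j => by
      rw [tieOccurs_append, tieOccurs_append, tieOccurs_cons_tieEnd, or_left_comm,
        ← tieOccurs_append]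
      exact ⟨Or.inr, fun h => h.elim (fun h => h ▸ hk) id⟩]
    refine colourSum_congr _ fun g => ?_
    rw [bracketOp_append, bracketOp_append]
    refine bracketOp_congr _ _ u fun F hF h0 s' hs' => ?_
    rw [bracketOp_cons, bracketOp_tieEnd]
    split_ifs with hc
    · rfl
    · by_contra hne
      obtain ⟨G, hG, hG0⟩ := bracketOp_ne_zero hne
      obtain ⟨H, hH, -, hHu⟩ := follows_append_mk hF hG (by rw [hG0, ← hs'])
      obtain ⟨p, hp⟩ := hk
      obtain ⟨j, hj⟩ := List.mem_iff_getElem?.mp hp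
      have h1 := follows_tiedTogether hH (h (j, p) hj)
      obtain ⟨a, h2, rfl⟩ := follows_tieEnd hH (x := (j, p)) hj
      rw [h2] at h1
      simp only [hHu, hG0] at h1
      exact hc h1
  -- A fresh name has only this one end, and exactly one colour of the new tie agrees with the
  -- strand.
  · unfold stateSum
    have hkn : k ∉ tieNames (u ++ v) := by rwa [mem_tieNames]
    have hns : tieNames (u ++ tieEnd i k :: v) = insert k (tieNames (u ++ v)) := by
      ext j
      rw [Finset.mem_insert, mem_tieNames, mem_tieNames, tieOccurs_append, tieOccurs_append,
        tieOccurs_cons_tieEnd, or_left_comm]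
    rw [hns, colourSum_insert hkn]
    rw [tieOccurs_append, not_or] at hk
    refine colourSum_congr _ fun g => ?_
    have hupd : ∀ (w : List (Slice Unit)), ¬ TieOccurs w k → ∀ c,
        bracketOp (Fin (M + 1)) (loopRoot M : ℂ) (Function.update g k c) w =
          bracketOp (Fin (M + 1)) (loopRoot M : ℂ) g w := by
      intro w hw c
      refine bracketOp_colours _ fun j hj => Function.update_of_ne ?_ _ _
      rintro rfl
      exact hw hj
    have h1 : ∀ c, bracketOp (Fin (M + 1)) (loopRoot M : ℂ) (Function.update g k c)
        (u ++ tieEnd i k :: v) (fun _ => 1) [] = bracketOp (Fin (M + 1)) (loopRoot M : ℂ) g u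
          (bracketOp (Fin (M + 1)) (loopRoot M : ℂ) (Function.update g k c) [tieEnd i k]
            (bracketOp (Fin (M + 1)) (loopRoot M : ℂ) g v fun _ => 1)) [] := by
      intro c
      rw [bracketOp_append, bracketOp_cons, hupd u hk.1, hupd v hk.2]
    simp only [h1]
    rw [← Finset.sum_apply, ← map_sum, bracketOp_append]
    refine bracketOp_congr_length _ _ u fun s' hs' => ?_
    have hi' := hlen _ _ g s' hs'
    rw [Finset.sum_apply]
    simp [bracketOp_tieEnd, hi']

theorem isTiedBracket_tiedBracket : IsTiedBracket tiedBracket where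
  circle D hD := evalAc_ext_mul fun N M => by
    have hn : tieNames [piece (cup ()) 0, piece cap 0] = ∅ := by
      ext k; simp [mem_tieNames, tieOccurs_cons_piece, tieOccurs_nil]
    rw [tiedBracket_spec, hD, stateSum, hn, colourSum]
    simp [sumLists, bracketOp_circle]
  union D D' u v i hD hD' := evalAc_ext_mul fun N M => by
    have hw := D'.heightRun_word
    rw [hD', List.append_assoc] at hw
    obtain ⟨n, hu, hv⟩ := heightRun_append_eq hw
    have hi : i ≤ n := by
      by_contra hi
      simp [heightRun, heightStep, hi] at hv
    rw [map_mul, mul_left_comm, tiedBracket_spec, tiedBracket_spec, hD, hD', evalAc_X, stateSum,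
      stateSum, ← colourSum_mul]
    rw [tieNames_congr (w' := u ++ v) fun k => by
      simp [tieOccurs_append, tieOccurs_cons_piece, tieOccurs_nil]]
    refine colourSum_congr _ fun g => ?_
    -- A relation with a single term is obtained from the two-term version with second coefficient
    -- 0.
    rw [bracketOp_combination (m₁ := []) (m₂ := []) hu ((N + 1) * (M + 1)) 0 fun φ s hs => ?_]
    · simp
    · rw [bracketOp_circle _ _ _ _ _ _ (by omega)]
      simp [bracketOp, wordOp_nil]
  tiedUnion D D' u v i k hD hk hD' := evalAc_ext_mul fun N M => by
    have hw := D'.heightRun_word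
    rw [hD', List.append_assoc] at hw
    obtain ⟨n, hu, hv⟩ := heightRun_append_eq hw
    have hi : i ≤ n := by
      by_contra hi
      simp [heightRun, heightStep, hi] at hv
    rw [map_mul, mul_left_comm, tiedBracket_spec, tiedBracket_spec, hD, hD', evalAc_C, evalA_loop,
      stateSum, stateSum, ← colourSum_mul]
    rw [hD, tieOccurs_append] at hk
    rw [tieNames_congr (w' := u ++ v) fun j => by
      simp only [tieOccurs_append, tieOccurs_cons_piece, tieOccurs_nil, tieOccurs_cons_tieEnd]
      constructor
      · rintro ((h | rfl | h) | h) <;> tauto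
      · tauto]
    refine colourSum_congr _ fun g => ?_
    rw [bracketOp_combination (m₁ := []) (m₂ := []) hu (M + 1) 0 fun φ s hs => ?_]
    · simp
    · rw [bracketOp_tiedCircle _ _ _ _ _ _ _ (by omega)]
      simp [bracketOp, wordOp_nil]
  regular D D' h := tiedBracket_congr fun N M => by
    rw [stateSum, stateSum, tieNames_regularMove h]
    exact colourSum_congr _ fun g =>
      bracketOp_regularMove (loopRoot M).ne_zero (loopRoot_spec M) g h D.heightRun_word
  ties D D' h := tiedBracket_congr fun N M => stateSum_tieMove N M D'.heightRun_word h
  tiedCrossing D De Df u v o i k hD hDe hDf := evalAc_ext_mul fun N M => by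
    have hw := D.heightRun_word
    rw [hD, List.append_assoc] at hw
    obtain ⟨n, hu, -⟩ := heightRun_append_eq hw
    suffices h : stateSum N M D.word = (loopRoot M : ℂ) ^ eps o * stateSum N M De.word +
        (loopRoot M : ℂ) ^ (-eps o) * stateSum N M Df.word by
      rw [← tiedBracket_spec, ← tiedBracket_spec, ← tiedBracket_spec] at h
      rw [map_add, map_mul, map_mul, evalAc_C, evalAc_C, evalA_A, evalA_A]
      linear_combination h
    rw [hD, hDe, hDf, stateSum, stateSum, stateSum]
    rw [tieNames_congr (w' := u ++ [tieEnd i k, tieEnd (i + 1) k] ++ v)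
        (w := u ++ [tieEnd i k, tieEnd (i + 1) k, piece (cross o) i] ++ v) fun j => by
      simp [tieOccurs_append, tieOccurs_cons_piece, tieOccurs_nil, tieOccurs_cons_tieEnd],
      tieNames_congr (w' := u ++ [tieEnd i k, tieEnd (i + 1) k] ++ v)
        (w := u ++ [tieEnd i k, tieEnd (i + 1) k, piece cap i, piece (cup ()) i, tieEnd i k] ++ v)
        fun j => by
      simp [tieOccurs_append, tieOccurs_cons_piece, tieOccurs_nil, tieOccurs_cons_tieEnd],
      ← colourSum_mul, ← colourSum_mul, ← colourSum_add]
    exact colourSum_congr _ fun g => bracketOp_combination hu _ _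
      (fun φ s _ => bracketOp_tiedCrossing _ g o i k φ s) _
  crossing Dp Dm De Df u v i k hk hp hm he hf := evalAc_ext_mul fun N M => by
    suffices h : stateSum N M Dp.word + stateSum N M Dm.word =
        ((loopRoot M : ℂ) + (loopRoot M : ℂ)⁻¹) * (stateSum N M De.word + stateSum N M Df.word) by
      rw [← tiedBracket_spec, ← tiedBracket_spec, ← tiedBracket_spec, ← tiedBracket_spec] at h
      simp only [map_mul, map_add, evalAc_C, evalA_A, zpow_one, zpow_neg_one]
      linear_combination h
    rw [hp, hm, he, hf, stateSum, stateSum, stateSum, stateSum]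
    have hkn : k ∉ tieNames (u ++ v) := by rwa [mem_tieNames]
    rw [tieNames_congr (w' := u ++ v) (w := u ++ [piece (cross true) i] ++ v) fun j => by
        simp [tieOccurs_append, tieOccurs_cons_piece, tieOccurs_nil],
      tieNames_congr (w' := u ++ v) (w := u ++ [piece (cross false) i] ++ v) fun j => by
        simp [tieOccurs_append, tieOccurs_cons_piece, tieOccurs_nil],
      show tieNames (u ++ [tieEnd i k, tieEnd (i + 1) k] ++ v) = insert k (tieNames (u ++ v)) by
        ext j
        simp only [Finset.mem_insert, mem_tieNames, tieOccurs_append, tieOccurs_cons_tieEnd,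
          tieOccurs_nil]
        tauto,
      show tieNames (u ++ [tieEnd i k, piece cap i, piece (cup ()) i, tieEnd i k] ++ v) =
          insert k (tieNames (u ++ v)) by
        ext j
        simp only [Finset.mem_insert, mem_tieNames, tieOccurs_append, tieOccurs_cons_tieEnd,
          tieOccurs_nil, tieOccurs_cons_piece]
        tauto,
      colourSum_insert hkn, colourSum_insert hkn, ← colourSum_add, ← colourSum_add,
      ← colourSum_mul]
    rw [tieOccurs_append, not_or] at hk
    refine colourSum_congr _ fun g => ?_
    have hupd : ∀ (w : List (Slice Unit)), ¬ TieOccurs w k → ∀ c,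
        bracketOp (Fin (M + 1)) (loopRoot M : ℂ) (Function.update g k c) w =
          bracketOp (Fin (M + 1)) (loopRoot M : ℂ) g w := by
      intro w hw c
      refine bracketOp_colours _ fun j hj => Function.update_of_ne ?_ _ _
      rintro rfl
      exact hw hj
    have h1 : ∀ (m : List (Slice Unit)) c,
        bracketOp (Fin (M + 1)) (loopRoot M : ℂ) (Function.update g k c) (u ++ m ++ v)
          (fun _ => 1) [] = bracketOp (Fin (M + 1)) (loopRoot M : ℂ) g u
          (bracketOp (Fin (M + 1)) (loopRoot M : ℂ) (Function.update g k c) m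
            (bracketOp (Fin (M + 1)) (loopRoot M : ℂ) g v fun _ => 1)) [] := by
      intro m c
      rw [bracketOp_append, bracketOp_append, hupd u hk.1, hupd v hk.2]
    simp only [h1]
    rw [bracketOp_append, bracketOp_append, bracketOp_append, bracketOp_append, ← Pi.add_apply,
      ← map_add, ← LinearMap.add_apply, bracketOp_crossing _ g i k]
    simp only [LinearMap.smul_apply, LinearMap.sum_apply, LinearMap.add_apply, map_smul, map_sum,
      map_add, Pi.smul_apply, Finset.sum_apply, Pi.add_apply, smul_eq_mul,
      Finset.sum_add_distrib]

end TiedLink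

/-! ### Local rules of Kauffman's state sum. -/

namespace TiedLink
open Piece Slice Direction

/-! ### Rules of the Kauffman bracket -/

/-- Components of states are not compared directly. A linear relation between operators of the
one-colour model, valid for all M, already implies the relation in ℤ[A^{±1}]. -/
theorem kauffmanBracket_combination {u m m₁ m₂ v : List (Slice Unit)} (p₁ p₂ : RingA)
    (hw : heightRun (u ++ m ++ v) 0 = some 0) (h0 : u ++ m ++ v ≠ [])
    (hw₁ : heightRun (u ++ m₁ ++ v) 0 = some 0) (h0₁ : u ++ m₁ ++ v ≠ [])
    (hw₂ : heightRun (u ++ m₂ ++ v) 0 = some 0) (h0₂ : u ++ m₂ ++ v ≠ [])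
    (h : ∀ (M : ℕ) (φ : List (Fin 1 × Fin (M + 1)) → ℂ) (s : List (Fin 1 × Fin (M + 1))),
      (heightRun m s.length).isSome →
      bracketOp (Fin (M + 1)) (loopRoot M : ℂ) (fun _ => (0 : Fin 1)) m φ s =
      evalA M p₁ * bracketOp (Fin (M + 1)) (loopRoot M : ℂ) (fun _ => (0 : Fin 1)) m₁ φ s +
      evalA M p₂ * bracketOp (Fin (M + 1)) (loopRoot M : ℂ) (fun _ => (0 : Fin 1)) m₂ φ s) :
    kauffmanBracket (u ++ m ++ v) =
      p₁ * kauffmanBracket (u ++ m₁ ++ v) + p₂ * kauffmanBracket (u ++ m₂ ++ v) := by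
  refine evalA_ext fun M => mul_left_cancel₀ (cast_succ_ne_zero M) ?_
  have hw0 := hw
  rw [List.append_assoc] at hw0
  obtain ⟨n, hu, hv⟩ := heightRun_append_eq hw0
  obtain ⟨n', hm, -⟩ := heightRun_append_eq hv
  rw [map_add, map_mul, map_mul, mul_add, mul_left_comm, mul_left_comm _ (evalA M p₂),
    evalA_kauffmanBracket M h0 hw, evalA_kauffmanBracket M h0₁ hw₁,
    evalA_kauffmanBracket M h0₂ hw₂]
  exact bracketOp_combination hu _ _ (fun φ s hs => h M φ s (by rw [hs, hm]; rfl)) _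

theorem kauffmanBracket_regularMove {w w' : List (Slice Unit)} (h : RegularMove w w')
    (hw : heightRun w 0 = some 0) (h0 : w ≠ []) (hw' : heightRun w' 0 = some 0) (h0' : w' ≠ []) :
    kauffmanBracket w = kauffmanBracket w' := by
  refine evalA_ext fun M => mul_left_cancel₀ (cast_succ_ne_zero M) ?_
  rw [evalA_kauffmanBracket M h0 hw, evalA_kauffmanBracket M h0' hw',
    bracketOp_regularMove (loopRoot M).ne_zero (loopRoot_spec M) _ h hw]

theorem kauffmanBracket_circle :
    kauffmanBracket [piece (cup ()) 0, piece cap 0] = 1 := by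
  refine evalA_ext fun M => mul_left_cancel₀ (cast_succ_ne_zero M) ?_
  rw [evalA_kauffmanBracket M (by simp) (by rfl), bracketOp_circle _ _ _ _ _ _ (by simp)]
  simp

theorem kauffmanBracket_union {u v : List (Slice Unit)} {i : ℕ}
    (hw : heightRun (u ++ [piece (cup ()) i, piece cap i] ++ v) 0 = some 0)
    (hw' : heightRun (u ++ v) 0 = some 0) (h0 : u ++ v ≠ []) :
    kauffmanBracket (u ++ [piece (cup ()) i, piece cap i] ++ v) =
      -(A 2 + A (-2)) * kauffmanBracket (u ++ v) := by
  have h := kauffmanBracket_combination (u := u) (m := [piece (cup ()) i, piece cap i]) (m₁ := [])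
    (m₂ := []) (v := v) (-(A 2 + A (-2))) 0 hw (by simp) (by simpa using hw') (by simpa using h0)
    (by simpa using hw') (by simpa using h0) fun M φ s hs => by
      have hi : i ≤ s.length := by
        by_contra hi
        simp [heightRun, heightStep, hi] at hs
      rw [bracketOp_circle _ _ _ _ _ _ hi, evalA_loop]
      simp [bracketOp, wordOp_nil]
  simpa using h

theorem kauffmanBracket_crossing {u v : List (Slice Unit)} {o : Bool} {i : ℕ}
    (hw : heightRun (u ++ [piece (cross o) i] ++ v) 0 = some 0) (h0 : u ++ v ≠ []) :
    kauffmanBracket (u ++ [piece (cross o) i] ++ v) = A (eps o) * kauffmanBracket (u ++ v) +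
      A (-eps o) * kauffmanBracket (u ++ [piece cap i, piece (cup ()) i] ++ v) := by
  have hw0 := hw
  rw [List.append_assoc] at hw0
  obtain ⟨n, hu, hv⟩ := heightRun_append_eq hw0
  have hi : i + 2 ≤ n := by
    by_contra hi
    simp [heightRun, heightStep, hi] at hv
  have hv' : heightRun v n = some 0 := by simpa [heightRun, heightStep, hi] using hv
  have h1 : heightRun (u ++ v) 0 = some 0 := by rw [heightRun_append, hu]; exact hv'
  have h2 : heightRun (u ++ [piece cap i, piece (cup ()) i] ++ v) 0 = some 0 := by
    rw [List.append_assoc, heightRun_append, hu]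
    simp [heightRun, heightStep, hi, show i ≤ n - 2 by omega, show n - 2 + 2 = n by omega, hv']
  have h := kauffmanBracket_combination (u := u) (m := [piece (cross o) i]) (m₁ := [])
    (m₂ := [piece cap i, piece (cup ()) i]) (v := v) (A (eps o)) (A (-eps o)) hw (by simp)
    (by simpa using h1) (by simpa using h0) h2 (by simp) fun M φ s hs => by
      have hi : i + 2 ≤ s.length := by
        by_contra hi
        simp [heightRun, heightStep, hi] at hs
      rw [bracketOp_pair, evalA_A, evalA_A]
      simp only [bracketOp, wordOp_cons, wordOp_nil, mul_one, sliceOp]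
      rw [shiftOp_iterate_congr (fun φ s hs => crossOp_of_subsingleton _ o φ s hs) i _ s hi,
        shiftOp_iterate_add, shiftOp_iterate_smul, shiftOp_iterate_smul, LinearMap.add_apply,
        Pi.add_apply, LinearMap.smul_apply, LinearMap.smul_apply, Pi.smul_apply, Pi.smul_apply,
        shiftOp_iterate_one i _ s (by omega), shiftOp_iterate_mul]
      rfl
  simpa using h

theorem kauffmanBracket_reidemeisterI {u m v : List (Slice Unit)} {o : Bool} {i : ℕ}
    (hm : m = [piece (cup ()) (i + 1), piece (cross o) i, piece cap (i + 1)] ∨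
      m = [piece (cup ()) i, piece (cross o) (i + 1), piece cap i])
    (hw : heightRun (u ++ m ++ v) 0 = some 0) (hw' : heightRun (u ++ v) 0 = some 0)
    (h0 : u ++ v ≠ []) :
    kauffmanBracket (u ++ m ++ v) = -A (3 * eps o) * kauffmanBracket (u ++ v) := by
  have hne : m ≠ [] := by rcases hm with rfl | rfl <;> simp
  have h := kauffmanBracket_combination (u := u) (m := m) (m₁ := [])
    (m₂ := []) (v := v) (-A (3 * eps o)) 0 hw (by simp [hne])
    (by simpa using hw') (by simpa using h0) (by simpa using hw') (by simpa using h0)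
    fun M φ s hs => by
      have hi : i + 1 ≤ s.length := by
        by_contra hi
        rcases hm with rfl | rfl
        · simp [heightRun, heightStep, hi] at hs
        · simp only [heightRun, heightStep] at hs
          split_ifs at hs with h1
          · simp [show ¬ (i + 1 + 2 ≤ s.length + 2) by omega] at hs
          · simp at hs
      have hsp := loopRoot_spec M
      simp only [Fintype.card_fin] at hsp
      have hα := (loopRoot M).ne_zero
      set α := (loopRoot M : ℂ)
      -- One smoothing of the curl splits off a loop, the other one is a straight strand.
      have hcoef : α ^ eps o * (((M + 1 : ℕ) : ℂ)) + α ^ (-eps o) = -α ^ (3 * eps o) := by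
        have hD : ((M + 1 : ℕ) : ℂ) = -(α ^ 2 + (α ^ 2)⁻¹) := by
          rw [zpow_neg] at hsp
          exact neg_eq_iff_eq_neg.mp hsp.symm
        rw [hD]
        cases o
        · have h3 : α ^ (3 * eps false) = (α ^ 3)⁻¹ := by rw [← zpow_natCast, ← zpow_neg]; rfl
          have h1 : α ^ eps false = α⁻¹ := zpow_neg_one α
          have h2 : α ^ (-eps false) = α := zpow_one α
          rw [h1, h2, h3]
          field_simp
          ring
        · have h3 : α ^ (3 * eps true) = α ^ 3 := by rw [← zpow_natCast]; rfl
          have h1 : α ^ eps true = α := zpow_one α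
          have h2 : α ^ (-eps true) = α⁻¹ := zpow_neg_one α
          rw [h1, h2, h3]
          field_simp
          ring
      have key : ∀ (φ : List (Fin 1 × Fin (M + 1)) → ℂ) s, 1 ≤ s.length →
          (shiftOp (cupOp (Fin 1 × Fin (M + 1))) * crossOp α o * shiftOp (capOp _) :
              Op (Fin 1 × Fin (M + 1))) φ s =
            ((-α ^ (3 * eps o)) • (1 : Op (Fin 1 × Fin (M + 1)))) φ s := by
        rintro φ (_ | ⟨⟨a, x⟩, s⟩) hs
        · simp at hs
        · obtain rfl := Subsingleton.elim a 0
          rw [← hcoef]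
          simp [Module.End.mul_apply, shiftOp_cons, cupOp_apply, crossOp_cons, capOp_cons,
            Fintype.sum_prod_type, Finset.sum_add_distrib]
          ring
      have key' : ∀ (φ : List (Fin 1 × Fin (M + 1)) → ℂ) s, 1 ≤ s.length →
          (cupOp (Fin 1 × Fin (M + 1)) * shiftOp (crossOp α o) * capOp _ :
              Op (Fin 1 × Fin (M + 1))) φ s =
            ((-α ^ (3 * eps o)) • (1 : Op (Fin 1 × Fin (M + 1)))) φ s := by
        rintro φ (_ | ⟨⟨a, x⟩, s⟩) hs
        · simp at hs
        · obtain rfl := Subsingleton.elim a 0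
          rw [← hcoef]
          simp [Module.End.mul_apply, shiftOp_cons, cupOp_apply, crossOp_cons, capOp_cons,
            Fintype.sum_prod_type, Finset.sum_add_distrib]
          ring
      rw [map_neg, evalA_A]
      have h1 : bracketOp (Fin (M + 1)) α (fun _ => (0 : Fin 1)) [] φ s = φ s := by
        simp [bracketOp, wordOp_nil]
      rw [h1, map_zero, zero_mul, add_zero]
      rcases hm with rfl | rfl
      · rw [bracketOp_triple]
        simp only [sliceOp]
        rw [Function.iterate_succ_apply, Function.iterate_succ_apply, ← shiftOp_iterate_mul,
          ← shiftOp_iterate_mul, shiftOp_iterate_congr key i φ s hi, shiftOp_iterate_smul,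
          LinearMap.smul_apply, Pi.smul_apply, shiftOp_iterate_one i φ s (by omega), smul_eq_mul]
      · rw [bracketOp_triple]
        simp only [sliceOp]
        rw [Function.iterate_succ_apply, ← shiftOp_iterate_mul,
          ← shiftOp_iterate_mul, shiftOp_iterate_congr key' i φ s hi, shiftOp_iterate_smul,
          LinearMap.smul_apply, Pi.smul_apply, shiftOp_iterate_one i φ s (by omega), smul_eq_mul]
  simpa using h

theorem states_filter (w : List (Slice Unit)) :
    states (w.filter fun l => ¬ l.IsTieEnd) = states w := by
  induction w with
  | nil => rfl
  | cons l w ih =>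
    rcases l with ⟨d | _ | o, i⟩ | ⟨i, k⟩ <;>
      simp [List.filter_cons, Slice.IsTieEnd, states, ← ih]

theorem kauffmanBracket_filter (w : List (Slice Unit)) :
    kauffmanBracket (w.filter fun l => ¬ l.IsTieEnd) = kauffmanBracket w := by
  rw [kauffmanBracket, states_filter, kauffmanBracket]

end TiedLink

/-! ### Change of the writhe under the moves. -/

namespace TiedLink
open Piece Slice Direction

/-! ### The writhe -/

theorem step_shift {δ : Type} [Direction δ] (l : Slice δ) (x : δ) (s : List δ) :
    l.shift.step (x :: s) = (l.step s).map (x :: ·) := by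
  rcases l with ⟨d | _ | o, i⟩ | ⟨i, k⟩
  · simp only [Slice.shift, Slice.step, List.length_cons, Nat.add_le_add_iff_right]
    split_ifs <;> simp
  · simp only [Slice.shift, Slice.step, List.drop_succ_cons]
    split
    · split_ifs <;> simp
    · rfl
  · simp only [Slice.shift, Slice.step, List.drop_succ_cons]
    split <;> simp
  · simp only [Slice.shift, Slice.step, List.length_cons, Nat.add_lt_add_iff_right]
    split_ifs <;> simp

theorem step_shift_nil {δ : Type} [Direction δ] (l : Slice δ) : l.shift.step [] = none := by
  rcases l with ⟨d | _ | o, i⟩ | ⟨i, k⟩ <;> simp [Slice.shift, Slice.step]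

theorem run_shift {δ : Type} [Direction δ] (w : List (Slice δ)) (x : δ) (s : List δ) :
    run (w.map Slice.shift) (x :: s) = (run w s).map (x :: ·) := by
  induction w generalizing s with
  | nil => rfl
  | cons l w ih =>
    simp only [List.map_cons, run, step_shift]
    cases l.step s <;> simp [ih]

theorem run_append {δ : Type} [Direction δ] (u v : List (Slice δ)) (s : List δ) :
    run (u ++ v) s = (run u s).bind (run v) := by
  induction u generalizing s with
  | nil => rfl
  | cons l u ih =>
    simp only [List.cons_append, run]
    cases l.step s <;> simp [ih]

theorem step_append {δ : Type} [Direction δ] {l : Slice δ} {s s' : List δ} (r : List δ)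
    (h : l.step s = some s') : l.step (s ++ r) = some (s' ++ r) := by
  rcases l with ⟨d | _ | o, i⟩ | ⟨i, k⟩ <;> simp only [Slice.step] at h ⊢
  · split_ifs at h with hi
    cases h
    rw [if_pos (by simp; omega), List.take_append_of_le_length hi,
      List.drop_append_of_le_length hi]
    simp
  · split at h
    · rename_i a b t hd
      have hi : i ≤ s.length := by
        by_contra hi
        rw [List.drop_eq_nil_of_le (by omega)] at hd
        simp at hd
      rw [List.drop_append_of_le_length hi, hd, List.take_append_of_le_length hi]
      simp only [List.cons_append]
      split_ifs at h ⊢ with hb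
      cases h
      simp
    · cases h
  · split at h
    · rename_i a b t hd
      have hi : i ≤ s.length := by
        by_contra hi
        rw [List.drop_eq_nil_of_le (by omega)] at hd
        simp at hd
      rw [List.drop_append_of_le_length hi, hd, List.take_append_of_le_length hi]
      simp only [List.cons_append]
      cases h
      simp
    · cases h
  · split_ifs at h with hi
    cases h
    rw [if_pos (by simp; omega)]

/-- The contribution of a slice to the writhe. -/
def sliceSign (s : List Bool) : Slice Bool → ℤ
  | .piece (.cross o) i => if s[i]? = s[i + 1]? then eps o else -eps o
  | _ => 0

theorem writheFrom_nil (s : List Bool) : writheFrom s [] = 0 := by simp [writheFrom]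

theorem writheFrom_cons (s : List Bool) (l : Slice Bool) (w : List (Slice Bool)) :
    writheFrom s (l :: w) = sliceSign s l + writheFrom ((l.step s).getD []) w := by
  rcases l with ⟨d | _ | o, i⟩ | ⟨i, k⟩ <;> rfl

theorem sliceSign_shift (x : Bool) (s : List Bool) (l : Slice Bool) :
    sliceSign (x :: s) l.shift = sliceSign s l := by
  rcases l with ⟨d | _ | o, i⟩ | ⟨i, k⟩ <;> simp [sliceSign, Slice.shift]

theorem sliceSign_append {s s' : List Bool} (r : List Bool) {l : Slice Bool}
    (h : l.step s = some s') : sliceSign (s ++ r) l = sliceSign s l := by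
  rcases l with ⟨d | _ | o, i⟩ | ⟨i, k⟩ <;> simp only [sliceSign]
  simp only [Slice.step] at h
  split at h
  · rename_i a b t hd
    have := congrArg List.length hd
    simp at this
    rw [List.getElem?_append_left (by omega), List.getElem?_append_left (by omega)]
  · cases h

theorem writheFrom_append {u : List (Slice Bool)} {s s' : List Bool} (h : run u s = some s')
    (v : List (Slice Bool)) : writheFrom s (u ++ v) = writheFrom s u + writheFrom s' v := by
  induction u generalizing s with
  | nil => cases h; simp [writheFrom]
  | cons l u ih =>
    simp only [run, Option.bind_eq_some_iff] at h
    obtain ⟨t, hl, h⟩ := h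
    rw [List.cons_append, writheFrom_cons, writheFrom_cons, hl, Option.getD_some, ih h, add_assoc]

theorem writheFrom_shift {w : List (Slice Bool)} {s s' : List Bool} (h : run w s = some s')
    (x : Bool) : writheFrom (x :: s) (w.map Slice.shift) = writheFrom s w := by
  induction w generalizing s with
  | nil => rfl
  | cons l w ih =>
    simp only [run, Option.bind_eq_some_iff] at h
    obtain ⟨t, hl, h⟩ := h
    rw [List.map_cons, writheFrom_cons, writheFrom_cons, sliceSign_shift, step_shift, hl]
    simp [ih h]

theorem writheFrom_append_right {w : List (Slice Bool)} {s s' : List Bool}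
    (h : run w s = some s') (r : List Bool) :
    run w (s ++ r) = some (s' ++ r) ∧ writheFrom (s ++ r) w = writheFrom s w := by
  induction w generalizing s with
  | nil => cases h; exact ⟨rfl, rfl⟩
  | cons l w ih =>
    simp only [run, Option.bind_eq_some_iff] at h
    obtain ⟨t, hl, h⟩ := h
    obtain ⟨h1, h2⟩ := ih h
    rw [writheFrom_cons, writheFrom_cons, sliceSign_append r hl, step_append r hl, hl]
    simp [run, step_append r hl, h1, h2]

/-- The words `m` and `m'` join the same directions, and their writhes differ by `c`. -/
def WritheDiff (c : ℤ) (m m' : List (Slice Bool)) : Prop :=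
  ∀ s t t', run m s = some t → run m' s = some t' → t = t' ∧ writheFrom s m = writheFrom s m' + c

theorem WritheDiff.shift {c : ℤ} {m m' : List (Slice Bool)} (hm : m ≠ [])
    (h : WritheDiff c m m') : WritheDiff c (m.map Slice.shift) (m'.map Slice.shift) := by
  intro s t t' h1 h2
  rcases s with _ | ⟨x, s⟩
  -- A shifted nonempty word cannot run above an empty row. For the empty word this fails, which is
  -- the reason for `hm`.
  · obtain ⟨l, m, rfl⟩ := List.exists_cons_of_ne_nil hm
    simp [run, step_shift_nil] at h1
  · rw [run_shift, Option.map_eq_some_iff] at h1 h2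
    obtain ⟨t, h1, rfl⟩ := h1
    obtain ⟨t', h2, rfl⟩ := h2
    obtain ⟨rfl, h3⟩ := h s t t' h1 h2
    exact ⟨rfl, by rw [writheFrom_shift h1, writheFrom_shift h2, h3]⟩

theorem WritheDiff.context {c : ℤ} {m m' : List (Slice Bool)} (h : WritheDiff c m m')
    {u v : List (Slice Bool)} (h1 : run (u ++ m ++ v) [] = some [])
    (h2 : run (u ++ m' ++ v) [] = some []) :
    writheFrom [] (u ++ m ++ v) = writheFrom [] (u ++ m' ++ v) + c := by
  rw [List.append_assoc, run_append, Option.bind_eq_some_iff] at h1 h2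
  obtain ⟨s, hu, h1⟩ := h1
  obtain ⟨s', hu', h2⟩ := h2
  obtain rfl : s = s' := by simpa [hu] using hu'
  rw [run_append, Option.bind_eq_some_iff] at h1 h2
  obtain ⟨t, hm, h1⟩ := h1
  obtain ⟨t', hm', h2⟩ := h2
  obtain ⟨rfl, h3⟩ := h s t t' hm hm'
  rw [List.append_assoc, List.append_assoc, writheFrom_append hu, writheFrom_append hu,
    writheFrom_append hm, writheFrom_append hm', h3]
  ring

theorem writheDiff_exchange (e f : Piece Bool) (m : ℕ) :
    WritheDiff 0 [piece e 0, piece f (0 + e.outs + m)] [piece f (0 + e.ins + m), piece e 0] := by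
  have h2 : ∀ n, piece f (0 + 2 + n) = ((piece f n).shift).shift := by
    intro n; simp only [Slice.shift]; congr 1; omega
  have h0 : ∀ n, piece f (0 + 0 + n) = piece f n := by intro n; congr 1; omega
  intro s t t' h h'
  rcases e with d | _ | o <;> simp only [Piece.ins, Piece.outs, h2, h0, run] at h h' ⊢
  · have h3 : ∀ s : List Bool, (piece (cup d) 0).step s = some (d :: opp d :: s) := by
      intro s; simp [Slice.step]
    simp only [h3, Option.bind_some, step_shift] at h h'
    rcases hf : (piece f m).step s with _ | r
    · simp [hf] at h
    · simp only [hf, Option.map_some, Option.bind_some, Option.some.injEq] at h h'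
      refine ⟨by rw [← h, ← h'], ?_⟩
      have h4 : ∀ s, sliceSign s (piece (cup d) 0) = 0 := fun _ => rfl
      simp [writheFrom_cons, h3, h4, step_shift, sliceSign_shift, hf, writheFrom_nil]
  · rcases s with _ | ⟨a, _ | ⟨b, s⟩⟩
    · simp [Slice.step] at h
    · simp [Slice.step] at h
    have h3 : ∀ s : List Bool, (piece cap 0).step (a :: b :: s) =
        if b = opp a then some s else none := by
      intro s; simp [Slice.step]
    simp only [h3, step_shift] at h h'
    split_ifs at h with hab
    · simp only [Option.bind_some] at h
      rcases hf : (piece f m).step s with _ | r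
      · simp [hf] at h
      · simp only [hf, Option.map_some, Option.bind_some, Option.some.injEq, h3, if_pos hab]
          at h h'
        refine ⟨by rw [← h, ← h'], ?_⟩
        have h4 : ∀ s, sliceSign s (piece cap 0) = 0 := fun _ => rfl
        simp only [writheFrom_cons, h3, h4, step_shift, sliceSign_shift, hf, if_pos hab,
          Option.map_some, Option.getD_some, writheFrom_nil]
        ring
    · simp at h
  · rcases s with _ | ⟨a, _ | ⟨b, s⟩⟩
    · simp [Slice.step] at h
    · simp [Slice.step] at h
    have h3 : ∀ s : List Bool, (piece (cross o) 0).step (a :: b :: s) =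
        some (b :: a :: s) := by
      intro s; simp [Slice.step]
    simp only [h3, Option.bind_some, step_shift] at h h'
    rcases hf : (piece f m).step s with _ | r
    · simp [hf] at h
    · simp only [hf, Option.map_some, Option.bind_some, Option.some.injEq, h3] at h h'
      refine ⟨by rw [← h, ← h'], ?_⟩
      have h4 : ∀ r, sliceSign (a :: b :: r) (piece (cross o) 0) =
          if a = b then eps o else -eps o := by
        intro r; simp [sliceSign]
      simp only [writheFrom_cons, h3, h4, step_shift, sliceSign_shift, hf, Option.map_some,
        Option.getD_some, writheFrom_nil]
      ring

/-- Moves at position i are shifts of moves at position 0, and there they become finite checks on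
the directions of at most three strands, or the exchange of two distant pieces. -/
theorem writheDiff_of_zero {c : ℤ} {m m' : ℕ → List (Slice Bool)}
    (hm : ∀ i, m (i + 1) = (m i).map Slice.shift) (hm' : ∀ i, m' (i + 1) = (m' i).map Slice.shift)
    (h0 : ∀ i, m i ≠ []) (h : WritheDiff c (m 0) (m' 0)) (i : ℕ) : WritheDiff c (m i) (m' i) := by
  induction i with
  | zero => exact h
  | succ i ih => rw [hm, hm']; exact ih.shift (h0 i)

theorem writheDiff_planarMove {m m' : List (Slice Bool)} (h : PlanarMove m m') :
    WritheDiff 0 m m' := by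
  cases h with
  | exchange e f i m =>
    refine writheDiff_of_zero (m := fun i => [piece e i, piece f (i + e.outs + m)])
      (m' := fun i => [piece f (i + e.ins + m), piece e i]) ?_ ?_ ?_ (writheDiff_exchange e f m) i
    · intro i; simp [Slice.shift]; omega
    · intro i; simp [Slice.shift]; omega
    · simp
  | zigzag d i =>
    refine writheDiff_of_zero (m := fun i => [piece (cup d) (i + 1), piece cap i])
      (m' := fun i => []) (fun _ => rfl) (fun _ => rfl) (by simp) ?_ i
    rintro (_ | ⟨a, s⟩) t t' h h' <;> simp [run, Slice.step] at h h'
    obtain ⟨h1, rfl⟩ := h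
    subst h'
    cases d <;> cases a <;> simp [Direction.opp, writheFrom] at h1 ⊢
  | zagzig d i =>
    refine writheDiff_of_zero (m := fun i => [piece (cup d) i, piece cap (i + 1)])
      (m' := fun i => []) (fun _ => rfl) (fun _ => rfl) (by simp) ?_ i
    rintro (_ | ⟨a, s⟩) t t' h h' <;> simp [run, Slice.step] at h h'
    obtain ⟨h1, rfl⟩ := h
    subst h'
    cases d <;> cases a <;> simp [Direction.opp, writheFrom] at h1 ⊢
  | slideCup d o i =>
    refine writheDiff_of_zero (m := fun i => [piece (cup d) i, piece (cross o) (i + 1)])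
      (m' := fun i => [piece (cup d) (i + 1), piece (cross (!o)) i])
      (fun _ => rfl) (fun _ => rfl) (by simp) ?_ i
    rintro (_ | ⟨a, s⟩) t t' h h' <;> simp [run, Slice.step] at h h'
    subst h h'
    cases d <;> cases a <;> cases o <;>
      simp [Direction.opp, writheFrom, Slice.step, eps]
  | slideCap o i =>
    refine writheDiff_of_zero (m := fun i => [piece (cross o) (i + 1), piece cap i])
      (m' := fun i => [piece (cross (!o)) i, piece cap (i + 1)])
      (fun _ => rfl) (fun _ => rfl) (by simp) ?_ i
    rintro (_ | ⟨a, _ | ⟨b, _ | ⟨e, s⟩⟩⟩) t t' h h' <;> simp [run, Slice.step] at h h'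
    obtain ⟨h1, rfl⟩ := h
    obtain ⟨h2, rfl⟩ := h'
    cases a <;> cases b <;> cases e <;> cases o <;>
      simp [Direction.opp, writheFrom, Slice.step, eps] at h1 h2 ⊢

theorem writheDiff_two {m m' : List (Slice Bool)} (h : ReidemeisterII m m') :
    WritheDiff 0 m m' := by
  obtain ⟨o, i⟩ := h
  refine writheDiff_of_zero (m := fun i => [piece (cross o) i, piece (cross (!o)) i])
    (m' := fun i => []) (fun _ => rfl) (fun _ => rfl) (by simp) ?_ i
  rintro (_ | ⟨a, _ | ⟨b, s⟩⟩) t t' h h' <;> simp [run, Slice.step] at h h'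
  subst h h'
  cases a <;> cases b <;> cases o <;> simp [writheFrom, Slice.step, eps]

theorem writheDiff_three {m m' : List (Slice Bool)} (h : ReidemeisterIII m m') :
    WritheDiff 0 m m' := by
  obtain ⟨x, y, z, i, -⟩ := h
  refine writheDiff_of_zero (m := fun i => [piece (cross x) i, piece (cross y) (i + 1),
      piece (cross z) i]) (m' := fun i => [piece (cross z) (i + 1), piece (cross y) i,
      piece (cross x) (i + 1)]) (fun _ => rfl) (fun _ => rfl) (by simp) ?_ i
  rintro (_ | ⟨a, _ | ⟨b, _ | ⟨e, s⟩⟩⟩) t t' h h' <;> simp [run, Slice.step] at h h'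
  subst h h'
  simp [writheFrom, Slice.step]
  ring

/-- The maximum fits only if the two strands at the crossing are parallel, so the sign is `eps o`
for either orientation. -/
theorem writheDiff_right (d o : Bool) (i : ℕ) :
    WritheDiff (eps o) [piece (cup d) (i + 1), piece (cross o) i, piece cap (i + 1)] [] := by
  refine writheDiff_of_zero (m := fun i => [piece (cup d) (i + 1), piece (cross o) i,
    piece cap (i + 1)]) (m' := fun i => []) (fun _ => rfl) (fun _ => rfl) (by simp) ?_ i
  rintro (_ | ⟨a, s⟩) t t' h h' <;> simp [run, Slice.step] at h h'
  obtain ⟨h1, rfl⟩ := h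
  subst h'
  cases d <;> cases a <;> simp [Direction.opp, writheFrom, Slice.step] at h1 ⊢

theorem writheDiff_left (d o : Bool) (i : ℕ) :
    WritheDiff (eps o) [piece (cup d) i, piece (cross o) (i + 1), piece cap i] [] := by
  refine writheDiff_of_zero (m := fun i => [piece (cup d) i, piece (cross o) (i + 1),
    piece cap i]) (m' := fun i => []) (fun _ => rfl) (fun _ => rfl) (by simp) ?_ i
  rintro (_ | ⟨a, s⟩) t t' h h' <;> simp [run, Slice.step] at h h'
  obtain ⟨h1, rfl⟩ := h
  subst h'
  cases d <;> cases a <;> simp [Direction.opp, writheFrom, Slice.step] at h1 ⊢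

theorem writhe_regularMove {w w' : List (Slice Bool)} (h : RegularMove w w')
    (hw : run w [] = some []) (hw' : run w' [] = some []) : writheFrom [] w = writheFrom [] w' := by
  rcases h with ⟨u, v, m, m', h⟩ | ⟨u, v, m, m', h⟩ | ⟨u, v, m, m', h⟩ | ⟨T, d, h⟩
  · simpa using (writheDiff_planarMove h).context hw hw'
  · simpa using (writheDiff_two h).context hw hw'
  · simpa using (writheDiff_three h).context hw hw'
  · have h1 : ∀ d : Bool, (piece (cup d) 0).step [] = some [d, opp d] := by
      intro d; simp [Slice.step]
    have h2 := writheFrom_append_right h [opp (opp d)]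
    have h3 : run (T.map Slice.shift) [d, opp d] = some [d, opp d] := by
      rw [run_shift, h]; rfl
    have h4 : ∀ s, writheFrom s [piece cap 0] = 0 := by intro s; simp [writheFrom]
    rw [writheFrom_cons, writheFrom_cons, h1, h1, Option.getD_some, Option.getD_some,
      writheFrom_append h3, writheFrom_shift h, h4]
    rw [List.singleton_append] at h2
    rw [writheFrom_append h2.1, h2.2, h4]
    rfl

end TiedLink

/-! ### Invariance and skein relation of the Jones polynomial. -/

namespace TiedLink
open Piece Slice Direction

/-! ### The Jones polynomial -/

theorem planarMove_unorient {m m' : List (Slice Bool)} (h : PlanarMove m m') :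
    PlanarMove (m.map Slice.unorient) (m'.map Slice.unorient) := by
  cases h with
  | exchange e f i m =>
    rcases e with d | _ | o <;> rcases f with d' | _ | o'
    · exact .exchange (cup ()) (cup ()) i m
    · exact .exchange (cup ()) cap i m
    · exact .exchange (cup ()) (cross o') i m
    · exact .exchange cap (cup ()) i m
    · exact .exchange cap cap i m
    · exact .exchange cap (cross o') i m
    · exact .exchange (cross o) (cup ()) i m
    · exact .exchange (cross o) cap i m
    · exact .exchange (cross o) (cross o') i m
  | zigzag d i => exact .zigzag () i
  | zagzig d i => exact .zagzig () i
  | slideCup d o i => exact .slideCup () o i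
  | slideCap o i => exact .slideCap o i

theorem regularMove_unorient {w w' : List (Slice Bool)} (h : RegularMove w w') :
    RegularMove (w.map Slice.unorient) (w'.map Slice.unorient) := by
  rcases h with ⟨u, v, m, m', h⟩ | ⟨u, v, _, _, ⟨o, i⟩⟩ | ⟨u, v, _, _, ⟨a, b, c, i, h⟩⟩ | ⟨T, d, h⟩
  · simp only [List.map_append]
    exact .planar _ _ _ _ (planarMove_unorient h)
  · simp only [List.map_append]
    exact .two _ _ _ _ (.mk o i)
  · simp only [List.map_append]
    exact .three _ _ _ _ (.mk a b c i h)
  · have hs : (T.map Slice.shift).map Slice.unorient =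
        (T.map Slice.unorient).map Slice.shift := by
      simp only [List.map_map]
      refine List.map_congr_left fun l _ => ?_
      rcases l with ⟨d | _ | o, i⟩ | ⟨i, k⟩ <;> rfl
    have := RegularMove.infinity (T.map Slice.unorient) () (run_unorient _ _ _ h)
    simpa [Slice.unorient, hs] using this

theorem A_mul (m n : ℤ) : A m * A n = A (m + n) := (LaurentPolynomial.T_add m n).symm

theorem A_zero : A 0 = 1 := LaurentPolynomial.T_zero

theorem negA_pow_three (o : Bool) :
    ((negA ^ (-3 * eps o) : RingAˣ) : RingA) = -A (-(3 * eps o)) := by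
  have h : ∀ n : ℤ, (-A n) ^ 3 = -A (3 * n) := by
    intro n
    rw [show (3 : ℤ) * n = n + n + n by ring, ← A_mul, ← A_mul]
    ring
  cases o
  · have : (-3 * eps false) = ((3 : ℕ) : ℤ) := rfl
    rw [this, zpow_natCast, Units.val_pow_eq_pow_val]
    exact h 1
  · have : (-3 * eps true) = -((3 : ℕ) : ℤ) := rfl
    rw [this, zpow_neg, zpow_natCast, ← inv_pow, Units.val_pow_eq_pow_val]
    exact h (-1)

theorem substA_A (n : ℤ) : substA (A n) = t (-1 / 4 * n) := by
  rw [A, t, LaurentPolynomial.T, substA]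
  erw [AddMonoidAlgebra.mapDomainRingHom_apply, AddMonoidAlgebra.mapDomain_single]
  simp

theorem LinkDiagram.heightRun_unorient (K : LinkDiagram Bool) :
    heightRun K.unorient.word 0 = some 0 := K.unorient.heightRun_word

theorem jonesPolynomial_regularMove {K K' : LinkDiagram Bool} (h : RegularMove K.word K'.word) :
    jonesPolynomial K = jonesPolynomial K' := by
  have h1 : K.writhe = K'.writhe := writhe_regularMove h K.closed K'.closed
  have h2 : kauffmanBracket K.unorient.word = kauffmanBracket K'.unorient.word :=
    kauffmanBracket_regularMove (regularMove_unorient h) K.heightRun_unorient K.unorient.nonempty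
      K'.heightRun_unorient K'.unorient.nonempty
  rw [jonesPolynomial, jonesPolynomial, h1, h2]

/-- A curl multiplies the bracket by -A^{3ε} and changes the writhe by ε, and the two effects
cancel. -/
theorem jonesPolynomial_reidemeisterI {K K' : LinkDiagram Bool} {u m v : List (Slice Bool)}
    (h : ReidemeisterI m []) (hK : K.word = u ++ m ++ v) (hK' : K'.word = u ++ v) :
    jonesPolynomial K = jonesPolynomial K' := by
  obtain ⟨o, i, hm, hd⟩ : ∃ o i, (m.map Slice.unorient =
      [piece (cup ()) (i + 1), piece (cross o) i, piece cap (i + 1)] ∨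
      m.map Slice.unorient = [piece (cup ()) i, piece (cross o) (i + 1), piece cap i]) ∧
      WritheDiff (eps o) m [] := by
    cases h with
    | right d o i => exact ⟨o, i, Or.inl rfl, writheDiff_right d o i⟩
    | left d o i => exact ⟨o, i, Or.inr rfl, writheDiff_left d o i⟩
  have hc := K.closed
  have hc' := K'.closed
  rw [hK] at hc
  rw [hK'] at hc'
  have h1 : K.writhe = K'.writhe + eps o := by
    have := hd.context (u := u) (v := v) hc (by simpa using hc')
    simpa [TiedDiagram.writhe, hK, hK'] using this
  have e : K.unorient.word =
      u.map Slice.unorient ++ m.map Slice.unorient ++ v.map Slice.unorient := by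
    simp [TiedDiagram.unorient, hK]
  have e' : K'.unorient.word = u.map Slice.unorient ++ v.map Slice.unorient := by
    simp [TiedDiagram.unorient, hK']
  have h2 : kauffmanBracket K.unorient.word =
      -A (3 * eps o) * kauffmanBracket K'.unorient.word := by
    have c := K.heightRun_unorient
    have c' := K'.heightRun_unorient
    have n' := K'.unorient.nonempty
    rw [e] at c
    rw [e'] at c' n'
    rw [e, e']
    exact kauffmanBracket_reidemeisterI hm c c' n'
  rw [jonesPolynomial, jonesPolynomial, h1, h2, mul_add, zpow_add, Units.val_mul, negA_pow_three]
  congr 1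
  have := A_mul (-(3 * eps o)) (3 * eps o)
  rw [neg_add_cancel, A_zero] at this
  linear_combination ((negA ^ (-3 * K'.writhe) : RingAˣ) : RingA) *
    kauffmanBracket K'.unorient.word * this

theorem isJonesPolynomial_jonesPolynomial : IsJonesPolynomial jonesPolynomial where
  unknot K d hK := by
    have h1 : K.writhe = 0 := by simp [TiedDiagram.writhe, hK, writheFrom]
    have h2 : K.unorient.word = [piece (cup ()) 0, piece cap 0] := by
      simp [TiedDiagram.unorient, hK, Slice.unorient]
    rw [jonesPolynomial, h1, h2, kauffmanBracket_circle]
    simp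
  invariant K K' h := by
    generalize hw : K.word = w at h
    generalize hw' : K'.word = w' at h
    cases h with
    | regular _ _ h => exact jonesPolynomial_regularMove (by rw [hw, hw']; exact h)
    | one u v m m' h =>
      obtain rfl : m' = [] := by cases h <;> rfl
      exact jonesPolynomial_reidemeisterI h hw (by simpa using hw')
  skein Kp Km K0 u v s i hu hs hp hm h0 := by
    have hcp := Kp.closed
    rw [hp, List.append_assoc, run_append, hu, Option.bind_some] at hcp
    -- Parallel strands have the same direction, so omitting the crossing does not alter the
    -- directions above it, nor any other sign.
    have hstep : ∀ o : Bool, (piece (cross o) i).step s = some s := by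
      intro o
      simp only [Slice.step]
      split
      · rename_i a b r hd
        have ha : s[i]? = some a := by rw [← List.head?_drop, hd]; rfl
        have hb : s[i + 1]? = some b := by
          rw [← List.head?_drop, ← List.tail_drop, hd]; rfl
        rw [ha, hb, Option.some.injEq] at hs
        subst hs
        rw [← hd, List.take_append_drop]
      · rename_i hd
        exfalso
        simp only [List.cons_append, run, Slice.step] at hcp
        simp at hcp
    have hwr : ∀ (K : LinkDiagram Bool) (o : Bool), K.word = u ++ [piece (cross o) i] ++ v →
        K.writhe = K0.writhe + eps o := by
      intro K o hK
      rw [TiedDiagram.writhe, TiedDiagram.writhe, hK, h0, List.append_assoc, writheFrom_append hu,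
        writheFrom_append hu, List.singleton_append, writheFrom_cons, hstep o]
      simp only [sliceSign, if_pos hs, Option.getD_some]
      ring
    have hkb : ∀ (K : LinkDiagram Bool) (o : Bool), K.word = u ++ [piece (cross o) i] ++ v →
        kauffmanBracket K.unorient.word = A (eps o) * kauffmanBracket K0.unorient.word +
          A (-eps o) * kauffmanBracket (u.map Slice.unorient ++
            [piece cap i, piece (cup ()) i] ++ v.map Slice.unorient) := by
      intro K o hK
      have e : K.unorient.word =
          u.map Slice.unorient ++ [piece (cross o) i] ++ v.map Slice.unorient := by
        simp [TiedDiagram.unorient, hK, Slice.unorient]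
      have e' : K0.unorient.word = u.map Slice.unorient ++ v.map Slice.unorient := by
        simp [TiedDiagram.unorient, h0]
      have c := K.heightRun_unorient
      have n' := K0.unorient.nonempty
      rw [e] at c
      rw [e'] at n'
      rw [e, e']
      exact kauffmanBracket_crossing c n'
    have ht : ∀ (q : ℚ) (n : ℤ), q = -1 / 4 * n → t q = substA (A n) := by
      rintro q n rfl
      rw [substA_A]
    rw [ht (-1) 4 (by norm_num), ht 1 (-4) (by norm_num), ht (1 / 2) (-2) (by norm_num),
      ht (-1 / 2) 2 (by norm_num)]
    rw [jonesPolynomial, jonesPolynomial, jonesPolynomial, hwr Kp true hp, hwr Km false hm,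
      hkb Kp true hp, hkb Km false hm, ← map_mul, ← map_mul, ← map_sub, ← map_sub, ← map_mul]
    congr 1
    rw [mul_add (-3 : ℤ), mul_add (-3 : ℤ), zpow_add, zpow_add, Units.val_mul, Units.val_mul,
      negA_pow_three, negA_pow_three]
    set X := ((negA ^ (-3 * K0.writhe) : RingAˣ) : RingA)
    set B := kauffmanBracket K0.unorient.word
    generalize kauffmanBracket (u.map Slice.unorient ++
            [piece cap i, piece (cup ()) i] ++ v.map Slice.unorient) = B'
    -- After normalization the smoothing against the orientation, with bracket `B'`, has the same
    -- coefficient at both crossings and drops out of the difference.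
    have e1 : A 4 * A (-(3 * eps true)) * A (eps true) = A 2 := by simp only [A_mul]; rfl
    have e2 : A 4 * A (-(3 * eps true)) * A (-eps true) = A 0 := by simp only [A_mul]; rfl
    have e3 : A (-4) * A (-(3 * eps false)) * A (eps false) = A (-2) := by
      simp only [A_mul]; rfl
    have e4 : A (-4) * A (-(3 * eps false)) * A (-eps false) = A 0 := by
      simp only [A_mul]; rfl
    linear_combination -X * B * e1 - X * B' * e2 + X * B * e3 + X * B' * e4

end TiedLink

/-! ### Diagrams whose components are all tied together, described by constant labellings. -/

namespace TiedLink
open Piece Slice Direction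

/-! ### Forgetting ties -/

section
variable {δ : Type}

def strip (w : List (Slice δ)) : List (Slice δ) := w.filter fun l => ¬ l.IsTieEnd

theorem strip_nil : strip ([] : List (Slice δ)) = [] := rfl

theorem strip_append (u v : List (Slice δ)) : strip (u ++ v) = strip u ++ strip v :=
  List.filter_append ..

theorem strip_cons_piece (e : Piece δ) (i : ℕ) (w : List (Slice δ)) :
    strip (piece e i :: w) = piece e i :: strip w := by
  simp [strip, List.filter_cons, Slice.IsTieEnd]

theorem strip_cons_tieEnd (i k : ℕ) (w : List (Slice δ)) : strip (tieEnd i k :: w) = strip w := by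
  simp [strip, List.filter_cons, Slice.IsTieEnd]

theorem strip_of_tieFree {w : List (Slice δ)} (h : ∀ l ∈ w, ¬ l.IsTieEnd) : strip w = w := by
  rw [strip, List.filter_eq_self]; simpa using h

theorem strip_strip (w : List (Slice δ)) : strip (strip w) = strip w :=
  strip_of_tieFree fun l hl => by simpa using (List.mem_filter.mp hl).2

/-- The word in which every minimum carries an end of tie `0`. -/
def tieUp : List (Slice δ) → List (Slice δ)
  | [] => []
  | piece (cup d) i :: w => piece (cup d) i :: tieEnd i 0 :: tieUp w
  | l :: w => l :: tieUp w

theorem tieUp_append (u v : List (Slice δ)) : tieUp (u ++ v) = tieUp u ++ tieUp v := by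
  induction u with
  | nil => rfl
  | cons l u ih => rcases l with ⟨d | _ | o, i⟩ | ⟨i, k⟩ <;> simp [tieUp, ih]

theorem strip_tieUp (w : List (Slice δ)) : strip (tieUp w) = strip w := by
  induction w with
  | nil => rfl
  | cons l u ih =>
    rcases l with ⟨d | _ | o, i⟩ | ⟨i, k⟩ <;>
      simp [tieUp, strip_cons_piece, strip_cons_tieEnd, ih]

theorem run_tieUp [Direction δ] (w : List (Slice δ)) (s : List δ) : run (tieUp w) s = run w s := by
  induction w generalizing s with
  | nil => rfl
  | cons l w ih =>
    rcases l with ⟨d | _ | o, i⟩ | ⟨i, k⟩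
    · simp only [tieUp, run]
      simp only [Slice.step]
      by_cases hi : i ≤ s.length
      · simp [hi, ih]
      · simp [hi]
    · simp only [tieUp, run, funext ih]
    · simp only [tieUp, run, funext ih]
    · simp only [tieUp, run, funext ih]

end

theorem heightRun_tieUp (w : List (Slice Unit)) (n : ℕ) :
    heightRun (tieUp w) n = heightRun w n := by
  induction w generalizing n with
  | nil => rfl
  | cons l w ih =>
    rcases l with ⟨d | _ | o, i⟩ | ⟨i, k⟩
    · simp only [tieUp, heightRun]
      simp only [heightStep]
      by_cases hi : i ≤ n
      · simp [hi, ih, show i < n + 2 by omega]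
      · simp [hi]
    · simp only [tieUp, heightRun, funext ih]
    · simp only [tieUp, heightRun, funext ih]
    · simp only [tieUp, heightRun, funext ih]

theorem heightRun_strip {w : List (Slice Unit)} {n m : ℕ} (h : heightRun w n = some m) :
    heightRun (strip w) n = some m := by
  induction w generalizing n with
  | nil => exact h
  | cons l w ih =>
    simp only [heightRun] at h
    obtain ⟨k, hl, hw⟩ := Option.bind_eq_some_iff.mp h
    rcases l with ⟨e, i⟩ | ⟨i, j⟩
    · simp [strip_cons_piece, heightRun, hl, ih hw]
    · simp only [heightStep] at hl
      split_ifs at hl with hi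
      cases hl
      rw [strip_cons_tieEnd]
      exact ih hw

/-! ### Words whose components are all tied together -/

/-- There are only constant labellings. -/
def ConstantRows (w : List (Slice Unit)) : Prop :=
  ∀ (g : ℕ → Prop) (F : ℕ → List Prop), F 0 = [] → Follows (fun k a => a = g k) w F →
    ∃ c, ∀ j ≤ w.length, ∀ a ∈ F j, a = c

theorem allTied_iff_constantRows (D : TiedDiagram Unit) : D.AllTied ↔ ConstantRows D.word := by
  rw [allTied_iff]
  constructor
  · intro h g F h0 hF
    by_cases hne : ∃ j ≤ D.word.length, ∃ a, a ∈ F j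
    · obtain ⟨j, hj, a, ha⟩ := hne
      exact ⟨a, fun j' hj' b hb => h g F h0 hF j' j hj' hj b hb a ha⟩
    · exact ⟨True, fun j hj a ha => absurd ⟨j, hj, a, ha⟩ hne⟩
  · intro h g F h0 hF j j' hj hj' a ha b hb
    obtain ⟨c, hc⟩ := h g F h0 hF
    rw [hc j hj a ha, hc j' hj' b hb]

theorem follows_remove_tieEnd {K : Type} {τ : ℕ → K → Prop} {u v : List (Slice Unit)} {i k : ℕ}
    {F : ℕ → List K} (hF : Follows τ (u ++ tieEnd i k :: v) F) :
    Follows τ (u ++ v) fun j => if j ≤ u.length then F j else F (j + 1) := by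
  intro j l hl
  have htie : F (u.length + 1) = F u.length := (hF u.length (tieEnd i k) (by simp)).1
  rcases lt_or_ge j u.length with hj | hj
  · rw [List.getElem?_append_left hj] at hl
    have := hF j l (by rw [List.getElem?_append_left hj]; exact hl)
    simpa [hj.le, Nat.succ_le_iff.mpr hj] using this
  · rw [List.getElem?_append_right hj] at hl
    have := hF (j + 1) l (by
      rw [List.getElem?_append_right (by omega), show j + 1 - u.length = j - u.length + 1 by omega]
      simpa using hl)
    beta_reduce
    rw [if_neg (by omega : ¬ j + 1 ≤ u.length)]
    rcases hj.eq_or_lt with rfl | hj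
    · rw [if_pos le_rfl, ← htie]; exact this
    · rw [if_neg (by omega)]; exact this

/-- A tie end does not change the row and only restricts the labellings. -/
theorem ConstantRows.insert {u v : List (Slice Unit)} (h : ConstantRows (u ++ v)) (i k : ℕ) :
    ConstantRows (u ++ tieEnd i k :: v) := by
  intro g F h0 hF
  have htie : F (u.length + 1) = F u.length := (hF u.length (tieEnd i k) (by simp)).1
  obtain ⟨c, hc⟩ := h g _ (by simpa using h0) (follows_remove_tieEnd hF)
  refine ⟨c, fun j hj a ha => ?_⟩
  rw [List.length_append, List.length_cons] at hj
  rw [List.length_append] at hc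
  rcases Nat.lt_or_ge u.length j with h1 | h1
  · obtain ⟨j, rfl⟩ : ∃ j', j = j' + 1 := ⟨j - 1, by omega⟩
    have := hc j (by omega) a
    rcases (Nat.lt_succ_iff.mp h1).eq_or_lt with rfl | h2
    · rw [if_pos le_rfl, ← htie] at this; exact this ha
    · rw [if_neg (by omega)] at this; exact this ha
  · have := hc j (by omega) a
    rw [if_pos h1] at this; exact this ha

/-- Labels above a word in which all minima are tied. -/
theorem follows_tieUp {g : ℕ → Prop} {w : List (Slice Unit)} {F : ℕ → List Prop}
    (hF : Follows (fun k a => a = g k) (tieUp w) F) (h0 : ∀ a ∈ F 0, a = g 0) :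
    ∀ j ≤ (tieUp w).length, ∀ a ∈ F j, a = g 0 := by
  have cons : ∀ (l : Slice Unit) (w : List (Slice Unit)) (F : ℕ → List Prop),
      (∀ a ∈ F 0, a = g 0) → (∀ j ≤ w.length, ∀ a ∈ F (j + 1), a = g 0) →
      ∀ j ≤ (l :: w).length, ∀ a ∈ F j, a = g 0 := by
    intro l w F h0 h1 j hj
    rcases j with _ | j
    · exact h0
    · exact h1 j (by simpa using hj)
  induction w generalizing F with
  | nil =>
    intro j hj
    obtain rfl : j = 0 := by simpa [tieUp] using hj
    exact h0
  | cons l w ih =>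
    rcases l with ⟨d | _ | o, i⟩ | ⟨i, k⟩
    · rw [tieUp, follows_cons, follows_cons] at hF
      obtain ⟨⟨p, r, a, h1, h2, h3⟩, ⟨h4, b, h5, h6⟩, h7⟩ := hF
      have ha : a = g 0 := by
        simp only [Nat.reduceAdd] at h5
        rw [h3] at h5
        simp [← h1] at h5
        rw [h5]
        exact h6
      have hF1 : ∀ x ∈ F 1, x = g 0 := by
        rw [h3]
        rw [h2] at h0
        intro x hx
        simp only [List.mem_append, List.mem_cons] at hx h0
        rcases hx with hx | rfl | rfl | hx
        · exact h0 x (Or.inl hx)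
        · exact ha
        · exact ha
        · exact h0 x (Or.inr hx)
      rw [tieUp]
      refine cons _ _ _ h0 (cons _ _ (fun j => F (j + 1)) hF1 (ih h7 ?_))
      intro x hx
      exact hF1 x (by rw [← h4]; exact hx)
    · rw [tieUp, follows_cons] at hF
      obtain ⟨⟨p, r, a, h1, h2, h3⟩, h4⟩ := hF
      rw [tieUp]
      · refine cons _ _ _ h0 (ih h4 ?_)
        intro x hx
        simp only [Nat.reduceAdd] at hx
        rw [h3] at hx
        refine h0 x ?_
        rw [h2]
        simp only [List.mem_append, List.mem_cons] at hx ⊢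
        tauto
      · simp
      · simp
    · rw [tieUp, follows_cons] at hF
      obtain ⟨⟨p, r, a, b, h1, h2, h3⟩, h4⟩ := hF
      rw [tieUp]
      · refine cons _ _ _ h0 (ih h4 ?_)
        intro x hx
        simp only [Nat.reduceAdd] at hx
        rw [h3] at hx
        refine h0 x ?_
        rw [h2]
        simp only [List.mem_append, List.mem_cons] at hx ⊢
        tauto
      · simp
      · simp
    · rw [tieUp, follows_cons] at hF
      obtain ⟨⟨h1, -⟩, h4⟩ := hF
      rw [tieUp]
      · refine cons _ _ _ h0 (ih h4 ?_)
        intro x hx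
        exact h0 x (by rw [← h1]; exact hx)
      · simp
      · simp

theorem constantRows_tieUp (w : List (Slice Unit)) : ConstantRows (tieUp w) := fun g _ h0 hF =>
  ⟨g 0, follows_tieUp hF (by simp [h0])⟩

/-- A word around which all minima are tied. -/
theorem constantRows_context {u m v : List (Slice Unit)}
    (h : ∀ (g : ℕ → Prop) (F : ℕ → List Prop), Follows (fun k a => a = g k) m F →
      (∀ a ∈ F 0, a = g 0) → ∀ j ≤ m.length, ∀ a ∈ F j, a = g 0) :
    ConstantRows (tieUp u ++ m ++ tieUp v) := by
  intro g F h0 hF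
  rw [List.append_assoc, follows_append, follows_append] at hF
  obtain ⟨h1, h2, h3⟩ := hF
  have k1 := follows_tieUp h1 (by simp [h0])
  have k2 := h g _ h2 (k1 _ le_rfl)
  have k3 := follows_tieUp h3 (k2 _ le_rfl)
  refine ⟨g 0, fun j hj => ?_⟩
  simp only [List.length_append] at hj
  rcases Nat.lt_or_ge (tieUp u).length j with h4 | h4
  · obtain ⟨j, rfl⟩ := Nat.exists_eq_add_of_lt h4
    rcases Nat.lt_or_ge m.length (j + 1) with h5 | h5
    · have := k3 (j + 1 - m.length) (by omega)
      rw [show (tieUp u).length + (m.length + (j + 1 - m.length)) = (tieUp u).length + j + 1 by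
        omega] at this
      exact this
    · exact k2 (j + 1) h5
  · exact k1 j h4

/-- The minimum in the middle carries no tie end, since one would stand in the way of the planar
move. The maximum joins it to an older strand, which determines its label. -/
theorem constantRows_cup_cap (u v : List (Slice Unit)) (i j : ℕ) (hij : j + 1 = i ∨ j = i + 1) :
    ConstantRows (tieUp u ++ [piece (cup ()) i, piece cap j] ++ tieUp v) := by
  refine constantRows_context fun g F hF h0 => ?_
  rw [follows_cons, follows_cons] at hF
  obtain ⟨⟨p, r, a, h1, h2, h3⟩, ⟨p', r', b, h4, h5, h6⟩, -⟩ := hF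
  simp only [Nat.reduceAdd] at h5 h6
  rw [h2] at h0
  simp only [List.mem_append] at h0
  have hb0 : (F 1)[j]? = some b := by rw [h5]; simp [← h4]
  have hb1 : (F 1)[j + 1]? = some b := by rw [h5, ← h4]; simp
  have ha : a = g 0 := by
    rw [h3] at hb0 hb1
    rcases hij with rfl | rfl
    · have h7 : (p ++ a :: a :: r)[j + 1]? = some a := by rw [← h1]; simp
      rw [h7, Option.some.injEq] at hb1
      rw [List.getElem?_append_left (by omega)] at hb0
      rw [hb1]
      exact h0 b (Or.inl (List.mem_of_getElem? hb0))
    · have h7 : (p ++ a :: a :: r)[i + 1]? = some a := by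
        rw [← h1]; simp
      rw [h7, Option.some.injEq] at hb0
      have h8 : (p ++ a :: a :: r)[i + 1 + 1]? = r[0]? := by
        rw [← h1, List.getElem?_append_right (by omega)]; simp [show p.length + 1 + 1 - p.length = 2 by omega]
      rw [h8] at hb1
      rw [hb0]
      exact h0 b (Or.inr (List.mem_of_getElem? hb1))
  have hF1 : ∀ x ∈ F 1, x = g 0 := by
    rw [h3]
    intro x hx
    simp only [List.mem_append, List.mem_cons] at hx
    rcases hx with hx | rfl | rfl | hx
    · exact h0 x (Or.inl hx)
    · exact ha
    · exact ha
    · exact h0 x (Or.inr hx)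
  intro k hk
  rcases k with _ | _ | _ | k
  · rw [h2]; simpa using h0
  · exact hF1
  · intro x hx
    refine hF1 x ?_
    rw [h6] at hx
    rw [h5]
    simp only [List.mem_append, List.mem_cons] at hx ⊢
    tauto
  · simp at hk

/-- Here the end belonging to the new minimum sits above the maximum, so that minimum and maximum
can be exchanged. If the maximum lies to its left, the number of the strand has dropped by two. -/
theorem constantRows_cup_cap_tieEnd (u v : List (Slice Unit)) (i j k : ℕ)
    (h : (i + 2 ≤ j ∧ k = i) ∨ (j + 2 ≤ i ∧ k + 2 = i)) :
    ConstantRows (tieUp u ++ [piece (cup ()) i, piece cap j, tieEnd k 0] ++ tieUp v) := by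
  refine constantRows_context fun g F hF h0 => ?_
  rw [follows_cons, follows_cons, follows_cons] at hF
  obtain ⟨⟨p, r, a, h1, h2, h3⟩, ⟨p', r', b, h4, h5, h6⟩, ⟨h7, c, h8, rfl⟩, -⟩ := hF
  simp only [Nat.reduceAdd] at h5 h6 h7 h8
  rw [h2] at h0
  simp only [List.mem_append] at h0
  have ha : a = g 0 := by
    have h9 : (F 1)[i]? = some a := by rw [h3]; simp [← h1]
    rw [h5] at h9
    rw [h6] at h8
    rcases h with ⟨hij, rfl⟩ | ⟨hij, rfl⟩
    · rw [List.getElem?_append_left (by omega)] at h8 h9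
      rw [h8, Option.some.injEq] at h9
      exact h9.symm
    · rw [List.getElem?_append_right (by omega)] at h8 h9
      rw [show k + 2 - p'.length = k - p'.length + 1 + 1 by omega, List.getElem?_cons_succ,
        List.getElem?_cons_succ, h8, Option.some.injEq] at h9
      exact h9.symm
  have hF1 : ∀ x ∈ F 1, x = g 0 := by
    rw [h3]
    intro x hx
    simp only [List.mem_append, List.mem_cons] at hx
    rcases hx with hx | rfl | rfl | hx
    · exact h0 x (Or.inl hx)
    · exact ha
    · exact ha
    · exact h0 x (Or.inr hx)
  have hF2 : ∀ x ∈ F 2, x = g 0 := by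
    intro x hx
    refine hF1 x ?_
    rw [h6] at hx
    rw [h5]
    simp only [List.mem_append, List.mem_cons] at hx ⊢
    tauto
  intro k hk
  rcases k with _ | _ | _ | _ | k
  · rw [h2]; simpa using h0
  · exact hF1
  · exact hF2
  · intro x hx
    exact hF2 x (by rw [← h7]; exact hx)
  · simp at hk; omega

end TiedLink

/-! ### Values of an arbitrary bracket on diagrams that are tied together. -/

namespace TiedLink
open Piece Slice Direction

/-! ### Values of a bracket polynomial on diagrams whose components are all tied together -/

open Classical in
/-- A function on diagrams as a function on words. -/
noncomputable def wordValue (br : TiedDiagram Unit → RingAc) (w : List (Slice Unit)) : RingAc :=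
  if h : w ≠ [] ∧ run w [] = some [] then br ⟨w, h.1, h.2⟩ else 0

theorem wordValue_word (br : TiedDiagram Unit → RingAc) (D : TiedDiagram Unit) :
    wordValue br D.word = br D := dif_pos ⟨D.nonempty, D.closed⟩

theorem exists_diagram {w : List (Slice Unit)} (h0 : w ≠ []) (hw : heightRun w 0 = some 0) :
    ∃ D : TiedDiagram Unit, D.word = w := ⟨⟨w, h0, (closed_iff w).mpr hw⟩, rfl⟩

theorem isPoint_of_hasTieEnd {w : List (Slice Unit)} (hw : heightRun w 0 = some 0) {x : ℕ × ℕ}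
    {k : ℕ} (h : HasTieEnd w x k) : IsPoint w x := by
  rw [isPoint_iff]
  have := heightStep_heightAt hw h
  simp only [heightStep] at this
  split_ifs at this with hx
  exact hx

section
variable {br : TiedDiagram Unit → RingAc}

/-- When everything is tied together, the condition of a tie move holds at every strand and for
every name. -/
theorem wordValue_insert (hbr : IsTiedBracket br) {u v : List (Slice Unit)} {i k : ℕ} (h : ConstantRows (u ++ v))
    (h0 : u ++ v ≠ []) (hw : heightRun (u ++ v) 0 = some 0)
    (hw' : heightRun (u ++ tieEnd i k :: v) 0 = some 0) :
    wordValue br (u ++ v) = wordValue br (u ++ tieEnd i k :: v) := by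
  obtain ⟨D, hD⟩ := exists_diagram h0 hw
  obtain ⟨D', hD'⟩ := exists_diagram (by simp) hw'
  rw [← hD, ← hD', wordValue_word, wordValue_word]
  refine hbr.ties D D' ?_
  rw [hD, hD']
  refine .mk u v i k fun y hy => ?_
  have hall : D.AllTied := (allTied_iff_constantRows D).mpr (by rwa [hD])
  rw [← hD] at hy ⊢
  refine hall _ _ ?_ (isPoint_of_hasTieEnd D.heightRun_word hy)
  obtain ⟨n, hu, hv⟩ := heightRun_append_eq hw'
  rw [isPoint_iff, hD, heightAt, List.take_left' rfl, hu]
  by_contra hi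
  simp only [Option.getD_some] at hi
  simp [heightRun, heightStep, hi] at hv

theorem wordValue_sublist (hbr : IsTiedBracket br) {w w' : List (Slice Unit)} (hs : w.Sublist w')
    (hst : strip w = strip w') (u : List (Slice Unit)) (h : ConstantRows (u ++ w))
    (h0 : u ++ w ≠ []) (hw : heightRun (u ++ w) 0 = some 0)
    (hw' : heightRun (u ++ w') 0 = some 0) :
    wordValue br (u ++ w) = wordValue br (u ++ w') ∧ ConstantRows (u ++ w') := by
  induction hs generalizing u with
  | slnil => exact ⟨rfl, h⟩
  | @cons w w' l hs ih =>
    rcases l with ⟨e, i⟩ | ⟨i, k⟩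
    -- Only tie ends can be missing from the smaller word: an additional piece would make the
    -- stripped words differ in length.
    · exfalso
      rw [strip_cons_piece] at hst
      have h1 := (hs.filter fun l : Slice Unit => ¬ l.IsTieEnd).length_le
      have h2 := congrArg List.length hst
      simp only [List.length_cons] at h2
      change (strip w).length ≤ (strip w').length at h1
      omega
    · rw [strip_cons_tieEnd] at hst
      obtain ⟨n, hu, hv⟩ := heightRun_append_eq hw'
      have hv' := hv
      simp only [heightRun, heightStep] at hv
      have hi : i < n := by
        by_contra hi
        simp [hi] at hv
      have hw2 : heightRun (u ++ tieEnd i k :: w) 0 = some 0 := by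
        rw [heightRun_append, hu] at hw ⊢
        simpa [heightRun, heightStep, hi] using hw
      rw [wordValue_insert hbr h h0 hw hw2]
      have := ih hst (u ++ [tieEnd i k]) (by simpa using h.insert i k) (by simp)
        (by simpa using hw2) (by simpa using hw')
      simpa using this
  | @cons_cons w w' l hs ih =>
    have hst' : strip w = strip w' := by
      rcases l with ⟨e, i⟩ | ⟨i, k⟩
      · rw [strip_cons_piece, strip_cons_piece] at hst
        exact (List.cons_inj_right _).mp hst
      · rwa [strip_cons_tieEnd, strip_cons_tieEnd] at hst
    have := ih hst' (u ++ [l]) (by simpa using h) (by simp) (by simpa using hw)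
      (by simpa using hw')
    simpa using this

/-- The two words are merged: common pieces are taken once, and between them the tie ends of both
words. Tie ends do not change the height, so the result still fits together. -/
theorem exists_common_extension (w₁ w₂ : List (Slice Unit)) {n m : ℕ}
    (h : strip w₁ = strip w₂) (h₁ : heightRun w₁ n = some m) (h₂ : heightRun w₂ n = some m) :
    ∃ w, heightRun w n = some m ∧ w₁.Sublist w ∧ w₂.Sublist w ∧ strip w = strip w₁ := by
  induction w₁ generalizing w₂ n with
  | nil =>
    refine ⟨w₂, h₂, List.nil_sublist _, List.Sublist.refl _, h.symm⟩
  | cons l w₁ ih =>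
    rcases l with ⟨e, i⟩ | ⟨i, k⟩
    · induction w₂ generalizing n with
      | nil => simp [strip_cons_piece, strip_nil] at h
      | cons l w₂ ih₂ =>
        rcases l with ⟨e', i'⟩ | ⟨j, k⟩
        · rw [strip_cons_piece, strip_cons_piece, List.cons.injEq] at h
          obtain ⟨h3, h4⟩ := h
          rw [← h3] at h₂ ⊢
          simp only [heightRun] at h₁ h₂
          obtain ⟨a, ha, h₁⟩ := Option.bind_eq_some_iff.mp h₁
          rw [ha, Option.bind_some] at h₂
          obtain ⟨w, h5, h6, h7, h8⟩ := ih w₂ h4 h₁ h₂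
          refine ⟨piece e i :: w, by simp [heightRun, ha, h5], h6.cons_cons _, h7.cons_cons _, ?_⟩
          rw [strip_cons_piece, strip_cons_piece, h8]
        · rw [strip_cons_tieEnd] at h
          simp only [heightRun] at h₂
          obtain ⟨a, ha, h₃⟩ := Option.bind_eq_some_iff.mp h₂
          have han : a = n := by
            simp only [heightStep] at ha
            split_ifs at ha
            simpa using ha.symm
          subst han
          obtain ⟨w, h5, h6, h7, h8⟩ := ih₂ h₃ h h₁
          exact ⟨tieEnd j k :: w, by simp [heightRun, ha, h5], h6.cons _, h7.cons_cons _, by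
            rw [strip_cons_tieEnd, h8]⟩
    · rw [strip_cons_tieEnd] at h
      simp only [heightRun] at h₁
      obtain ⟨a, ha, h₃⟩ := Option.bind_eq_some_iff.mp h₁
      have han : a = n := by
        simp only [heightStep] at ha
        split_ifs at ha
        simpa using ha.symm
      subst han
      obtain ⟨w, h5, h6, h7, h8⟩ := ih w₂ h h₃ h₂
      exact ⟨tieEnd i k :: w, by simp [heightRun, ha, h5], h6.cons_cons _, h7.cons _, by
        rw [strip_cons_tieEnd, strip_cons_tieEnd, h8]⟩

/-- If all components are tied together the value does not depend on the ties. -/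
theorem wordValue_eq_of_strip (hbr : IsTiedBracket br) {w₁ w₂ : List (Slice Unit)} (h : strip w₁ = strip w₂)
    (h0₁ : w₁ ≠ []) (h0₂ : w₂ ≠ []) (hw₁ : heightRun w₁ 0 = some 0)
    (hw₂ : heightRun w₂ 0 = some 0) (hc₁ : ConstantRows w₁) (hc₂ : ConstantRows w₂) :
    wordValue br w₁ = wordValue br w₂ := by
  obtain ⟨w, h1, h2, h3, h4⟩ := exists_common_extension w₁ w₂ h hw₁ hw₂
  have e1 := (wordValue_sublist hbr h2 h4.symm [] hc₁ h0₁ hw₁ h1).1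
  have e2 := (wordValue_sublist hbr h3 (by rw [h4, h]) [] hc₂ h0₂ hw₂ h1).1
  simp only [List.nil_append] at e1 e2
  rw [e1, e2]

theorem tieUp_ne_nil {w : List (Slice Unit)} (h : w ≠ []) : tieUp w ≠ [] := by
  obtain ⟨l, w, rfl⟩ := List.exists_cons_of_ne_nil h
  rcases l with ⟨d | _ | o, i⟩ | ⟨i, k⟩ <;> simp [tieUp]

theorem tieOccurs_tieUp {w : List (Slice Unit)} (h0 : w ≠ []) (hw : heightRun w 0 = some 0) :
    TieOccurs (tieUp w) 0 := by
  obtain ⟨d, v, rfl⟩ := exists_cup_of_closed h0 hw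
  exact ⟨0, by simp [tieUp]⟩

/-- The value of the bracket polynomial at `tieUp w` may be computed with another system of
ties. -/
theorem wordValue_tieUp (hbr : IsTiedBracket br) {w w' : List (Slice Unit)} (h : strip w' = strip w) (h0 : w ≠ [])
    (h0' : w' ≠ []) (hw : heightRun w 0 = some 0) (hw' : heightRun w' 0 = some 0)
    (hc : ConstantRows w') : wordValue br (tieUp w) = wordValue br w' :=
  wordValue_eq_of_strip hbr (by rw [strip_tieUp, h]) (tieUp_ne_nil h0) h0'
    (by rwa [heightRun_tieUp]) hw' (constantRows_tieUp w) hc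

theorem wordValue_circle (hbr : IsTiedBracket br) :
    wordValue br (tieUp [piece (cup ()) 0, piece cap 0]) = 1 := by
  have hw : heightRun [piece (cup ()) 0, piece cap 0] 0 = some 0 := rfl
  rw [wordValue_tieUp hbr rfl (by simp) (by simp) hw hw]
  · obtain ⟨D, hD⟩ := exists_diagram (by simp) hw
    rw [← hD, wordValue_word]
    exact hbr.circle D hD
  · intro g F h0 hF
    rw [follows_cons, follows_cons] at hF
    obtain ⟨⟨p, r, a, h1, h2, h3⟩, ⟨p', r', b, h4, h5, h6⟩, -⟩ := hF
    simp only [Nat.reduceAdd] at h5 h6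
    rw [h0] at h2
    obtain ⟨rfl, rfl⟩ := List.append_eq_nil_iff.mp h2.symm
    obtain rfl : p' = [] := List.length_eq_zero_iff.mp h4
    refine ⟨a, fun j hj x hx => ?_⟩
    rcases j with _ | _ | _ | j
    · simp [h0] at hx
    · rw [Nat.zero_add, h3] at hx; simpa using hx
    · rw [h5] at h3
      simp only [Nat.reduceAdd] at hx
      rw [h6] at hx
      simp at h3
      simp [h3] at hx
    · simp at hj

/-- In `tieUp` the new circle is attached to tie 0, which the rest of the diagram already uses, so
rule 3 applies and not rule 2. -/
theorem wordValue_union (hbr : IsTiedBracket br) {u v : List (Slice Unit)} {i : ℕ}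
    (h0 : u ++ v ≠ []) (hw : heightRun (u ++ v) 0 = some 0)
    (hw' : heightRun (u ++ [piece (cup ()) i, piece cap i] ++ v) 0 = some 0) :
    wordValue br (tieUp (u ++ [piece (cup ()) i, piece cap i] ++ v)) =
      Polynomial.C (-(A 2 + A (-2))) * wordValue br (tieUp (u ++ v)) := by
  obtain ⟨D, hD⟩ := exists_diagram (tieUp_ne_nil h0) (by rwa [heightRun_tieUp])
  obtain ⟨D', hD'⟩ := exists_diagram
    (w := tieUp (u ++ [piece (cup ()) i, piece cap i] ++ v)) (tieUp_ne_nil (by simp))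
    (by rwa [heightRun_tieUp])
  rw [← hD, ← hD', wordValue_word, wordValue_word]
  refine hbr.tiedUnion D D' (tieUp u) (tieUp v) i 0 (by rw [hD, tieUp_append])
    (by rw [hD]; exact tieOccurs_tieUp h0 hw) ?_
  rw [hD', tieUp_append, tieUp_append]
  simp [tieUp]

/-- As the value does not depend on the ties, ends of tie 0 may be attached next to the crossing,
which makes rule 5 applicable. -/
theorem wordValue_crossing (hbr : IsTiedBracket br) {u v : List (Slice Unit)} {o : Bool} {i : ℕ}
    (h0 : u ++ v ≠ []) (hw : heightRun (u ++ [piece (cross o) i] ++ v) 0 = some 0)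
    (hw₁ : heightRun (u ++ v) 0 = some 0)
    (hw₂ : heightRun (u ++ [piece cap i, piece (cup ()) i] ++ v) 0 = some 0) :
    wordValue br (tieUp (u ++ [piece (cross o) i] ++ v)) =
      Polynomial.C (A (eps o)) * wordValue br (tieUp (u ++ v)) +
      Polynomial.C (A (-eps o)) *
        wordValue br (tieUp (u ++ [piece cap i, piece (cup ()) i] ++ v)) := by
  have tied : ∀ m : List (Slice Unit), ConstantRows (tieUp u ++ tieUp m ++ tieUp v) →
      ∀ h : List (Slice Unit), h = [tieEnd i 0, tieEnd (i + 1) 0] ++ tieUp m →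
      ConstantRows (tieUp u ++ h ++ tieUp v) := by
    rintro m hm _ rfl
    have := (ConstantRows.insert (u := tieUp u) (v := tieUp m ++ tieUp v)
      (by simpa using hm) (i + 1) 0).insert (i := i) (k := 0)
    simpa using this
  have cr : ∀ m : List (Slice Unit), ConstantRows (tieUp u ++ tieUp m ++ tieUp v) := by
    intro m
    rw [← tieUp_append, ← tieUp_append]
    exact constantRows_tieUp _
  obtain ⟨n, hu, hv⟩ := heightRun_append_eq (by
    have := hw
    rw [List.append_assoc] at this
    exact this)
  have hi : i + 2 ≤ n := by
    by_contra hi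
    simp [heightRun, heightStep, hi] at hv
  have hv' : heightRun v n = some 0 := by simpa [heightRun, heightStep, hi] using hv
  have closed : ∀ m : List (Slice Unit), heightRun m n = some n →
      heightRun (tieUp u ++ m ++ tieUp v) 0 = some 0 := by
    intro m hm
    rw [List.append_assoc, heightRun_append, heightRun_tieUp, hu, Option.bind_some,
      heightRun_append, hm, Option.bind_some, heightRun_tieUp, hv']
  have hc : heightRun [tieEnd i 0, tieEnd (i + 1) 0, piece (cross o) i] n = some n := by
    simp [heightRun, heightStep, hi, show i < n by omega, show i + 1 < n by omega]
  have he : heightRun [tieEnd i 0, tieEnd (i + 1) 0] n = some n := by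
    simp [heightRun, heightStep, show i < n by omega, show i + 1 < n by omega]
  have hf : heightRun [tieEnd i 0, tieEnd (i + 1) 0, piece cap i, piece (cup ()) i,
      tieEnd i 0] n = some n := by
    simp [heightRun, heightStep, hi, show i < n by omega, show i + 1 < n by omega,
      show i ≤ n - 2 by omega, show n - 2 + 2 = n by omega]
  rw [wordValue_tieUp hbr (w' := tieUp u ++ [tieEnd i 0, tieEnd (i + 1) 0, piece (cross o) i] ++
      tieUp v) (by simp [strip_append, strip_tieUp, strip_cons_tieEnd, strip_cons_piece])
      (by simp) (by simp) hw (closed _ hc) (tied [piece (cross o) i] (cr _) _ rfl),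
    wordValue_tieUp hbr (w' := tieUp u ++ [tieEnd i 0, tieEnd (i + 1) 0] ++
      tieUp v) (by simp [strip_append, strip_tieUp, strip_cons_tieEnd, strip_cons_piece])
      h0 (by simp) hw₁ (closed _ he) (tied [] (cr _) _ rfl),
    wordValue_tieUp hbr (w' := tieUp u ++ [tieEnd i 0, tieEnd (i + 1) 0, piece cap i,
      piece (cup ()) i, tieEnd i 0] ++
      tieUp v) (by simp [strip_append, strip_tieUp, strip_cons_tieEnd, strip_cons_piece])
      (by simp) (by simp) hw₂ (closed _ hf) (tied [piece cap i, piece (cup ()) i] (cr _) _ rfl)]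
  obtain ⟨D, hD⟩ := exists_diagram (by simp) (closed _ hc)
  obtain ⟨De, hDe⟩ := exists_diagram (by simp) (closed _ he)
  obtain ⟨Df, hDf⟩ := exists_diagram (by simp) (closed _ hf)
  rw [← hD, ← hDe, ← hDf, wordValue_word, wordValue_word, wordValue_word]
  exact hbr.tiedCrossing D De Df _ _ o i 0 hD hDe hDf

/-- The ends placed by `tieUp` may obstruct a move of `w`. The move is carried out on words `x` and
`x'` with the same pieces but other ties. -/
theorem wordValue_planarMove (hbr : IsTiedBracket br) {w w' x x' : List (Slice Unit)}
    (h0 : w ≠ []) (hw : heightRun w 0 = some 0) (h0' : w' ≠ []) (hw' : heightRun w' 0 = some 0)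
    (hx : heightRun x 0 = some 0) (hx' : heightRun x' 0 = some 0) (h : RegularMove x x')
    (hc : ConstantRows x) (hc' : ConstantRows x') (hs : strip x = strip w)
    (hs' : strip x' = strip w') (hx0 : x ≠ []) (hx0' : x' ≠ []) :
    wordValue br (tieUp w) = wordValue br (tieUp w') := by
  rw [wordValue_tieUp hbr hs h0 hx0 hw hx hc, wordValue_tieUp hbr hs' h0' hx0' hw' hx' hc']
  obtain ⟨D, hD⟩ := exists_diagram hx0 hx
  obtain ⟨D', hD'⟩ := exists_diagram hx0' hx'
  rw [← hD, ← hD', wordValue_word, wordValue_word]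
  exact hbr.regular D D' (by rw [hD, hD']; exact h)

/-- A maximum next to a minimum cancels. -/
theorem wordValue_zigzag (hbr : IsTiedBracket br) {u v : List (Slice Unit)} {i j : ℕ}
    (hij : j + 1 = i ∨ j = i + 1) (h0 : u ++ v ≠ []) (hw : heightRun (u ++ v) 0 = some 0)
    (hw' : heightRun (u ++ [piece (cup ()) i, piece cap j] ++ v) 0 = some 0) :
    wordValue br (tieUp (u ++ [piece (cup ()) i, piece cap j] ++ v)) =
      wordValue br (tieUp (u ++ v)) := by
  refine wordValue_planarMove hbr (x := tieUp u ++ [piece (cup ()) i, piece cap j] ++ tieUp v)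
    (x' := tieUp (u ++ v)) (by simp) hw' h0 hw ?_ (by rwa [heightRun_tieUp]) ?_
    (constantRows_cup_cap u v i j hij) (constantRows_tieUp _)
    (by simp [strip_append, strip_tieUp, strip_cons_piece]) (strip_tieUp _) (by simp)
    (tieUp_ne_nil h0)
  · rw [List.append_assoc, heightRun_append] at hw' ⊢
    rw [heightRun_tieUp]
    rw [Option.bind_eq_some_iff] at hw' ⊢
    obtain ⟨n, hu, h⟩ := hw'
    refine ⟨n, hu, ?_⟩
    rw [heightRun_append] at h ⊢
    rwa [funext (heightRun_tieUp v)]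
  · rw [tieUp_append]
    have := RegularMove.planar (tieUp u) (tieUp v) [piece (cup ()) i, piece cap j] [] (by
      rcases hij with rfl | rfl
      · exact .zigzag () j
      · exact .zagzig () i)
    simpa using this

/-- A maximum far from a minimum may be moved below it. -/
theorem wordValue_exchange (hbr : IsTiedBracket br) {u v : List (Slice Unit)} {i j i' j' : ℕ}
    (hij : (i + 2 ≤ j ∧ i' = i ∧ j' + 2 = j) ∨ (j + 2 ≤ i ∧ i' + 2 = i ∧ j' = j))
    (hp : PlanarMove [piece (cup ()) i, piece cap j] [piece cap j', piece (cup ()) i'] ∨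
      PlanarMove [piece cap j', piece (cup ()) i'] [piece (cup ()) i, piece cap j])
    (hw : heightRun (u ++ [piece (cup ()) i, piece cap j] ++ v) 0 = some 0)
    (hw' : heightRun (u ++ [piece cap j', piece (cup ()) i'] ++ v) 0 = some 0) :
    wordValue br (tieUp (u ++ [piece (cup ()) i, piece cap j] ++ v)) =
      wordValue br (tieUp (u ++ [piece cap j', piece (cup ()) i'] ++ v)) := by
  have e' : tieUp (u ++ [piece cap j', piece (cup ()) i'] ++ v) =
      tieUp u ++ [piece cap j', piece (cup ()) i'] ++ (tieEnd i' 0 :: tieUp v) := by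
    simp [tieUp_append, tieUp]
  have hc := constantRows_cup_cap_tieEnd u v i j i' (by omega)
  have e : tieUp u ++ [piece (cup ()) i, piece cap j, tieEnd i' 0] ++ tieUp v =
      tieUp u ++ [piece (cup ()) i, piece cap j] ++ (tieEnd i' 0 :: tieUp v) := by simp
  rw [e] at hc
  have hx : heightRun (tieUp u ++ [piece (cup ()) i, piece cap j] ++ (tieEnd i' 0 :: tieUp v)) 0 =
      some 0 := by
    rw [List.append_assoc, heightRun_append] at hw ⊢
    rw [heightRun_tieUp]
    rw [Option.bind_eq_some_iff] at hw ⊢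
    obtain ⟨n, hu, h⟩ := hw
    refine ⟨n, hu, ?_⟩
    have h1 : i ≤ n := by
      by_contra h1
      simp [heightRun, heightStep, h1] at h
    have h2 : j + 2 ≤ n + 2 := by
      by_contra h2
      simp [heightRun, heightStep, h1, show ¬ j ≤ n by omega] at h
    simp [heightRun, heightStep, h1, show j ≤ n by omega] at h ⊢
    rw [if_pos (by omega), Option.bind_some, heightRun_tieUp, h]
  have hx' : heightRun (tieUp u ++ [piece cap j', piece (cup ()) i'] ++
      (tieEnd i' 0 :: tieUp v)) 0 = some 0 := by rwa [← e', heightRun_tieUp]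
  rcases hp with hp | hp
  · exact wordValue_planarMove hbr (by simp) hw (by simp) hw' hx hx' (.planar _ _ _ _ hp) hc
      (by rw [← e']; exact constantRows_tieUp _)
      (by simp [strip_append, strip_tieUp, strip_cons_tieEnd, strip_cons_piece])
      (by simp [strip_append, strip_tieUp, strip_cons_tieEnd, strip_cons_piece])
      (by simp) (by simp)
  · exact (wordValue_planarMove hbr (by simp) hw' (by simp) hw hx' hx (.planar _ _ _ _ hp)
      (by rw [← e']; exact constantRows_tieUp _) hc
      (by simp [strip_append, strip_tieUp, strip_cons_tieEnd, strip_cons_piece])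
      (by simp [strip_append, strip_tieUp, strip_cons_tieEnd, strip_cons_piece])
      (by simp) (by simp)).symm

end
end TiedLink

/-! ### Reduction to the circle, passage to oriented diagrams, and the theorem. -/

namespace TiedLink
open Piece Slice Direction

/-! ### Reduction to the circle -/

def Slice.IsArc : Slice Unit → Prop
  | piece (cup _) _ => True
  | piece cap _ => True
  | _ => False

theorem exists_first_cap {w : List (Slice Unit)} {n : ℕ} (ha : ∀ l ∈ w, l.IsArc)
    (hw : heightRun w n = some 0) (h : w ≠ [] ∨ 0 < n) :
    ∃ u j v, w = u ++ piece cap j :: v ∧ ∀ l ∈ u, l.isCup = true := by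
  induction w generalizing n with
  | nil =>
    simp only [heightRun, Option.some.injEq] at hw
    simp [hw] at h
  | cons l w ih =>
    rcases l with ⟨d | _ | o, i⟩ | ⟨i, k⟩
    · simp only [heightRun] at hw
      obtain ⟨m, hm, hw⟩ := Option.bind_eq_some_iff.mp hw
      have hm0 : 0 < m := by
        simp only [heightStep] at hm
        split_ifs at hm
        simp only [Option.some.injEq] at hm
        omega
      obtain ⟨u, j, v, rfl, hu⟩ := ih (fun l hl => ha l (by simp [hl])) hw (Or.inr hm0)
      refine ⟨piece (cup d) i :: u, j, v, rfl, ?_⟩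
      intro l hl
      rcases List.mem_cons.mp hl with rfl | hl
      · rfl
      · exact hu l hl
    · exact ⟨[], i, w, rfl, by simp⟩
    · exact (ha (piece (cross o) i) (by simp)).elim
    · exact (ha (tieEnd i k) (by simp)).elim

theorem exists_cup_cap {u v : List (Slice Unit)} {j : ℕ} (hu : ∀ l ∈ u, l.isCup = true)
    (hw : heightRun (u ++ piece cap j :: v) 0 = some 0) :
    ∃ u' i, u = u' ++ [piece (cup ()) i] ∧ ∀ l ∈ u', l.isCup = true := by
  rcases List.eq_nil_or_concat u with rfl | ⟨u', l, rfl⟩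
  · simp [heightRun, heightStep] at hw
  · rw [List.concat_eq_append] at hu ⊢
    rcases l with ⟨d | _ | o, i⟩ | ⟨i, k⟩
    · exact ⟨u', i, rfl, fun l hl => hu l (by simp [hl])⟩
    · exact absurd (hu (piece cap i) (by simp)) (by simp [Slice.isCup])
    · exact absurd (hu (piece (cross o) i) (by simp)) (by simp [Slice.isCup])
    · exact absurd (hu (tieEnd i k) (by simp)) (by simp [Slice.isCup])

section
variable {br : TiedDiagram Unit → RingAc}

/-- Consider the lowest maximum and the minimum directly below it. They form a circle, or cancel, or
are far apart and can be exchanged. The first two cases shorten the word unless it is the circle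
itself; the exchange lowers the maximum. The Kauffman bracket changes in the same way each time. -/
theorem wordValue_arcs (hbr : IsTiedBracket br) {w : List (Slice Unit)}
    (ha : ∀ l ∈ w, l.IsArc) (h0 : w ≠ []) (hw : heightRun w 0 = some 0) :
    wordValue br (tieUp w) = Polynomial.C (kauffmanBracket w) := by
  induction hn : w.length using Nat.strong_induction_on generalizing w with
  | _ n ih =>
  subst hn
  obtain ⟨u, j, v, rfl, hu⟩ := exists_first_cap ha hw (Or.inl h0)
  -- The inner induction is on the number of minima below the lowest maximum, which an exchange
  -- decreases while the length of the word stays the same.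
  induction hk : u.length generalizing u j v with
  | zero =>
    obtain rfl := List.length_eq_zero_iff.mp hk
    simp [heightRun, heightStep] at hw
  | succ k ihk =>
    obtain ⟨u, i, rfl, hu'⟩ := exists_cup_cap hu hw
    have e : u ++ [piece (cup ()) i] ++ piece cap j :: v =
        u ++ [piece (cup ()) i, piece cap j] ++ v := by simp
    rw [e] at ha h0 hw ih ⊢
    obtain ⟨n, hun, hv⟩ := heightRun_append_eq (by
      have := hw
      rw [List.append_assoc] at this
      exact this)
    have hi : i ≤ n := by
      by_contra h1
      simp [heightRun, heightStep, h1] at hv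
    have hj : j ≤ n := by
      by_contra h2
      simp [heightRun, heightStep, hi, h2] at hv
    have hv' : heightRun v n = some 0 := by
      simpa [heightRun, heightStep, hi, hj] using hv
    have huv : heightRun (u ++ v) 0 = some 0 := by rw [heightRun_append, hun]; exact hv'
    have hauv : ∀ l ∈ u ++ v, l.IsArc := by
      intro l hl
      refine ha l ?_
      simp only [List.mem_append] at hl ⊢
      tauto
    -- If nothing else is present, both positions are 0.
    have cancel : i ≠ j → u ++ v ≠ [] := by
      intro hij huv
      obtain ⟨rfl, rfl⟩ := List.append_eq_nil_iff.mp huv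
      simp only [heightRun, Option.some.injEq] at hun
      omega
    have far : ∀ i' j', (i + 2 ≤ j ∧ i' = i ∧ j' + 2 = j) ∨ (j + 2 ≤ i ∧ i' + 2 = i ∧ j' = j) →
        (PlanarMove [piece (cup ()) i, piece cap j] [piece cap j', piece (cup ()) i'] ∨
          PlanarMove [piece cap j', piece (cup ()) i'] [piece (cup ()) i, piece cap j]) →
        wordValue br (tieUp (u ++ [piece (cup ()) i, piece cap j] ++ v)) =
          Polynomial.C (kauffmanBracket (u ++ [piece (cup ()) i, piece cap j] ++ v)) := by
      intro i' j' hij hp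
      have hw' : heightRun (u ++ [piece cap j', piece (cup ()) i'] ++ v) 0 = some 0 := by
        rw [List.append_assoc, heightRun_append, hun]
        simp [heightRun, heightStep, show j' + 2 ≤ n by omega, show i' ≤ n - 2 by omega,
          show n - 2 + 2 = n by omega, hv']
      have hkb : kauffmanBracket (u ++ [piece (cup ()) i, piece cap j] ++ v) =
          kauffmanBracket (u ++ [piece cap j', piece (cup ()) i'] ++ v) := by
        rcases hp with hp | hp
        · exact kauffmanBracket_regularMove (.planar _ _ _ _ hp) hw (by simp) hw' (by simp)
        · exact (kauffmanBracket_regularMove (.planar _ _ _ _ hp) hw' (by simp) hw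
            (by simp)).symm
      rw [wordValue_exchange hbr hij hp hw hw', hkb]
      have e' : u ++ [piece cap j', piece (cup ()) i'] ++ v =
          u ++ piece cap j' :: (piece (cup ()) i' :: v) := by simp
      rw [e'] at hw' ⊢
      refine ihk u j' (piece (cup ()) i' :: v) hu' ?_ (by simp) hw' ?_ (by simpa using hk)
      · intro l hl
        simp only [List.mem_append, List.mem_cons] at hl
        rcases hl with hl | rfl | rfl | hl
        · exact hauv l (by simp [hl])
        · trivial
        · trivial
        · exact hauv l (by simp [hl])
      · intro m hm w ha h0 hw hlen
        exact ih m (by simpa using hm) ha h0 hw hlen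
    by_cases hij : i = j
    · subst hij
      by_cases h0' : u ++ v = []
      · obtain ⟨rfl, rfl⟩ := List.append_eq_nil_iff.mp h0'
        simp only [heightRun, Option.some.injEq] at hun
        obtain rfl : i = 0 := by omega
        rw [show ([] ++ [piece (cup ()) 0, piece cap 0] ++ [] : List (Slice Unit)) =
          [piece (cup ()) 0, piece cap 0] from rfl, wordValue_circle hbr, kauffmanBracket_circle,
          map_one]
      · rw [wordValue_union hbr h0' huv hw, kauffmanBracket_union hw huv h0',
          ih (u ++ v).length (by simp) hauv h0' huv rfl, map_mul]
    · by_cases hij1 : j + 1 = i ∨ j = i + 1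
      · have hkb : kauffmanBracket (u ++ [piece (cup ()) i, piece cap j] ++ v) =
            kauffmanBracket (u ++ [] ++ v) := by
          refine kauffmanBracket_regularMove (.planar _ _ _ _ ?_) hw (by simp) (by simpa using huv)
            (by simpa using cancel hij)
          rcases hij1 with rfl | rfl
          · exact .zigzag () j
          · exact .zagzig () i
        rw [wordValue_zigzag hbr hij1 (cancel hij) huv hw, hkb, List.append_nil,
          ih (u ++ v).length (by simp) hauv (cancel hij) huv rfl]
      · rcases Nat.lt_or_ge i j with h | h
        · obtain ⟨m, rfl⟩ : ∃ m, j = i + 2 + m := ⟨j - (i + 2), by omega⟩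
          exact far i (i + m) (by omega) (Or.inl (.exchange (cup ()) cap i m))
        · obtain ⟨m, rfl⟩ : ∃ m, i = j + 2 + m := ⟨i - (j + 2), by omega⟩
          exact far (j + m) j (by omega) (Or.inr (.exchange cap (cup ()) j m))

def Slice.isCross : Slice Unit → Bool
  | piece (cross _) _ => true
  | _ => false

/-- Both sides obey Kauffman's relation at a crossing, whose smoothings have fewer crossings, and
without crossings the word consists of arcs. -/
theorem wordValue_eq_kauffmanBracket (hbr : IsTiedBracket br) {w : List (Slice Unit)}
    (ht : ∀ l ∈ w, ¬ l.IsTieEnd) (h0 : w ≠ []) (hw : heightRun w 0 = some 0) :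
    wordValue br (tieUp w) = Polynomial.C (kauffmanBracket w) := by
  induction hn : w.countP Slice.isCross using Nat.strong_induction_on generalizing w with
  | _ n ih =>
  subst hn
  by_cases hc : ∃ l ∈ w, l.isCross = true
  · obtain ⟨l, hl, hlc⟩ := hc
    rcases l with ⟨d | _ | o, i⟩ | ⟨i, k⟩
    · simp [Slice.isCross] at hlc
    · simp [Slice.isCross] at hlc
    · obtain ⟨u, v, rfl⟩ := List.append_of_mem hl
      rw [show u ++ piece (cross o) i :: v = u ++ [piece (cross o) i] ++ v by simp] at *
      obtain ⟨n, hun, hv⟩ := heightRun_append_eq (by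
        have := hw
        rw [List.append_assoc] at this
        exact this)
      have hi : i + 2 ≤ n := by
        by_contra hi
        simp [heightRun, heightStep, hi] at hv
      have hv' : heightRun v n = some 0 := by simpa [heightRun, heightStep, hi] using hv
      have huv : heightRun (u ++ v) 0 = some 0 := by rw [heightRun_append, hun]; exact hv'
      have hw₂ : heightRun (u ++ [piece cap i, piece (cup ()) i] ++ v) 0 = some 0 := by
        rw [List.append_assoc, heightRun_append, hun]
        simp [heightRun, heightStep, hi, show i ≤ n - 2 by omega, show n - 2 + 2 = n by omega,
          hv']
      have h0' : u ++ v ≠ [] := by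
        intro h
        obtain ⟨rfl, rfl⟩ := List.append_eq_nil_iff.mp h
        simp only [heightRun, Option.some.injEq] at hun
        omega
      have ht' : ∀ l ∈ u ++ v, ¬ l.IsTieEnd := by
        intro l hl
        refine ht l ?_
        simp only [List.mem_append] at hl ⊢
        tauto
      have ht₂ : ∀ l ∈ u ++ [piece cap i, piece (cup ()) i] ++ v, ¬ l.IsTieEnd := by
        intro l hl
        simp only [List.mem_append, List.mem_cons, List.not_mem_nil, or_false] at hl
        rcases hl with (hl | rfl | rfl) | hl
        · exact ht' l (by simp [hl])
        · exact id
        · exact id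
        · exact ht' l (by simp [hl])
      rw [wordValue_crossing hbr h0' hw huv hw₂, kauffmanBracket_crossing hw h0',
        ih _ (by simp [List.countP_append, List.countP_cons, Slice.isCross]) ht' h0' huv rfl,
        ih _ (by simp [List.countP_append, List.countP_cons, Slice.isCross]) ht₂ (by simp) hw₂ rfl,
        map_add, map_mul, map_mul]
    · simp [Slice.isCross] at hlc
  · refine wordValue_arcs hbr (fun l hl => ?_) h0 hw
    rcases l with ⟨d | _ | o, i⟩ | ⟨i, k⟩
    · trivial
    · trivial
    · exact absurd ⟨_, hl, rfl⟩ hc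
    · exact absurd trivial (ht _ hl)

theorem strip_ne_nil {w : List (Slice Unit)} (h0 : w ≠ []) (hw : heightRun w 0 = some 0) :
    strip w ≠ [] := by
  obtain ⟨d, v, rfl⟩ := exists_cup_of_closed h0 hw
  simp [strip_cons_piece]

/-- A bracket polynomial for tied links is the Kauffman bracket if all components are tied
together. -/
theorem IsTiedBracket.eq_kauffmanBracket (hbr : IsTiedBracket br) {D : TiedDiagram Unit}
    (hD : D.AllTied) : br D = Polynomial.C (kauffmanBracket D.word) := by
  have hw := D.heightRun_word
  have h0 := strip_ne_nil D.nonempty hw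
  rw [← wordValue_word br D, ← kauffmanBracket_filter, ← strip,
    ← wordValue_eq_kauffmanBracket hbr (fun l hl => by simpa using (List.mem_filter.mp hl).2) h0
      (heightRun_strip hw)]
  exact (wordValue_tieUp hbr (strip_strip _).symm h0 D.nonempty (heightRun_strip hw) hw
    ((allTied_iff_constantRows D).mp hD)).symm

end

/-! ### Orientations -/

theorem getElem?_unorient {δ : Type} {w : List (Slice δ)} {j : ℕ} {l : Slice Unit} :
    (w.map Slice.unorient)[j]? = some l ↔ ∃ l', w[j]? = some l' ∧ l'.unorient = l := by
  rw [List.getElem?_map, Option.map_eq_some_iff]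

theorem joined_unorient {δ : Type} {w : List (Slice δ)} {x y : ℕ × ℕ} :
    Joined (w.map Slice.unorient) x y ↔ Joined w x y := by
  constructor
  · intro h
    cases h with
    | through k p q l hl h =>
      obtain ⟨l', hl', rfl⟩ := getElem?_unorient.mp hl
      refine .through k p q l' hl' ?_
      rcases l' with ⟨d | _ | o, i⟩ | ⟨i, j⟩ <;> exact h
    | cup k i d hl =>
      obtain ⟨l', hl', h⟩ := getElem?_unorient.mp hl
      rcases l' with ⟨d | _ | o, i⟩ | ⟨i, j⟩ <;> cases h
      exact .cup k i d hl'
    | cap k i hl =>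
      obtain ⟨l', hl', h⟩ := getElem?_unorient.mp hl
      rcases l' with ⟨d | _ | o, i⟩ | ⟨i, j⟩ <;> cases h
      exact .cap k i hl'
  · intro h
    cases h with
    | through k p q l hl h =>
      refine .through k p q _ (getElem?_unorient.mpr ⟨l, hl, rfl⟩) ?_
      rcases l with ⟨d | _ | o, i⟩ | ⟨i, j⟩ <;> exact h
    | cup k i d hl => exact .cup k i () (getElem?_unorient.mpr ⟨_, hl, rfl⟩)
    | cap k i hl => exact .cap k i (getElem?_unorient.mpr ⟨_, hl, rfl⟩)

theorem hasTieEnd_unorient {δ : Type} {w : List (Slice δ)} {x : ℕ × ℕ} {k : ℕ} :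
    HasTieEnd (w.map Slice.unorient) x k ↔ HasTieEnd w x k := by
  unfold HasTieEnd
  rw [getElem?_unorient]
  constructor
  · rintro ⟨l', hl', h⟩
    rcases l' with ⟨d | _ | o, i⟩ | ⟨i, j⟩ <;> cases h
    exact hl'
  · exact fun h => ⟨_, h, rfl⟩

theorem tiedTogether_unorient {δ : Type} (w : List (Slice δ)) :
    TiedTogether (w.map Slice.unorient) = TiedTogether w := by
  unfold TiedTogether
  simp only [joined_unorient, hasTieEnd_unorient]

theorem isPoint_unorient {δ : Type} [Direction δ] {w : List (Slice δ)} (hw : run w [] = some [])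
    (x : ℕ × ℕ) : IsPoint (w.map Slice.unorient) x ↔ IsPoint w x := by
  have h : run (w.take x.1 ++ w.drop x.1) [] = some [] := by rwa [List.take_append_drop]
  rw [run_append, Option.bind_eq_some_iff] at h
  obtain ⟨s, hs, -⟩ := h
  have hu := run_unorient _ _ _ hs
  rw [List.map_take, List.map_nil] at hu
  simp [IsPoint, hs, hu]

theorem allTied_unorient {δ : Type} [Direction δ] (D : TiedDiagram δ) :
    D.unorient.AllTied ↔ D.AllTied := by
  unfold TiedDiagram.AllTied
  simp only [TiedDiagram.unorient, tiedTogether_unorient, isPoint_unorient D.closed]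

theorem tieUp_unorient {δ : Type} (w : List (Slice δ)) :
    (tieUp w).map Slice.unorient = tieUp (w.map Slice.unorient) := by
  induction w with
  | nil => rfl
  | cons l w ih => rcases l with ⟨d | _ | o, i⟩ | ⟨i, k⟩ <;> simp [tieUp, Slice.unorient, ih]

theorem strip_unorient {δ : Type} (w : List (Slice δ)) :
    (strip w).map Slice.unorient = strip (w.map Slice.unorient) := by
  induction w with
  | nil => rfl
  | cons l w ih =>
    rcases l with ⟨d | _ | o, i⟩ | ⟨i, k⟩ <;>
      simp [strip_cons_piece, strip_cons_tieEnd, Slice.unorient, ih]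

theorem exists_allTied {δ : Type} [Direction δ] (K : LinkDiagram δ) :
    ∃ D : TiedDiagram δ, D.AllTied ∧ D.forgetTies = K := by
  have hne : tieUp K.word ≠ [] := by
    obtain ⟨l, w, h⟩ := List.exists_cons_of_ne_nil K.nonempty
    rw [h]
    rcases l with ⟨d | _ | o, i⟩ | ⟨i, k⟩ <;> simp [tieUp]
  refine ⟨⟨tieUp K.word, hne, by rw [run_tieUp]; exact K.closed⟩, ?_, ?_⟩
  · rw [← allTied_unorient, allTied_iff_constantRows]
    simp only [TiedDiagram.unorient, tieUp_unorient]
    exact constantRows_tieUp _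
  · have : strip (tieUp K.word) = K.word := by
      rw [strip_tieUp, strip_of_tieFree K.tieFree]
    obtain ⟨⟨w, h0, hc⟩, ht⟩ := K
    simp only [TiedDiagram.forgetTies]
    congr 2

theorem writheFrom_strip {w : List (Slice Bool)} {s s' : List Bool} (h : run w s = some s') :
    writheFrom s (strip w) = writheFrom s w := by
  induction w generalizing s with
  | nil => rfl
  | cons l w ih =>
    simp only [run, Option.bind_eq_some_iff] at h
    obtain ⟨u, hl, h⟩ := h
    rcases l with ⟨e, i⟩ | ⟨i, k⟩
    · rw [strip_cons_piece, writheFrom_cons, writheFrom_cons, hl, Option.getD_some, ih h]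
    · have : u = s := by
        simp only [Slice.step] at hl
        split_ifs at hl
        simpa using hl.symm
      subst this
      rw [strip_cons_tieEnd, writheFrom_cons, hl, Option.getD_some, ih h]
      simp [sliceSign]

theorem tiedJ_of_allTied {br : TiedDiagram Unit → RingAc} (hbr : IsTiedBracket br)
    {D : TiedDiagram Bool} (hD : D.AllTied) :
    (tiedJ br D).map substA = Polynomial.C (jonesPolynomial D.forgetTies) := by
  have h1 : D.forgetTies.writhe = D.writhe := writheFrom_strip D.closed
  have h2 : D.forgetTies.unorient.word = strip D.unorient.word := strip_unorient D.word
  rw [tiedJ, hbr.eq_kauffmanBracket ((allTied_unorient D).mpr hD), jonesPolynomial, h1, h2, strip,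
    kauffmanBracket_filter, ← Polynomial.C_mul, Polynomial.map_C]

end TiedLink

theorem mainTheorem7 :
    -- the bracket polynomial for tied links exists
    (∃ br : TiedLink.TiedDiagram Unit → TiedLink.RingAc, TiedLink.IsTiedBracket br) ∧
    -- the Jones polynomial has its characteristic properties
    TiedLink.IsJonesPolynomial TiedLink.jonesPolynomial ∧
    -- every classical link diagram becomes a tied one with all components tied together
    (∀ K : TiedLink.LinkDiagram Bool, ∃ D : TiedLink.TiedDiagram Bool,
      D.AllTied ∧ D.forgetTies = K) ∧
    -- on such diagrams the tied invariant is the Jones polynomial, after `A = t^{-1/4}`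
    (∀ br : TiedLink.TiedDiagram Unit → TiedLink.RingAc, TiedLink.IsTiedBracket br →
      ∀ D : TiedLink.TiedDiagram Bool, D.AllTied →
        (TiedLink.tiedJ br D).map TiedLink.substA =
          Polynomial.C (TiedLink.jonesPolynomial D.forgetTies)) :=
  ⟨⟨_, TiedLink.isTiedBracket_tiedBracket⟩, TiedLink.isJonesPolynomial_jonesPolynomial,
    TiedLink.exists_allTied, fun _ hbr _ hD => TiedLink.tiedJ_of_allTied hbr hD⟩
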